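/- Algorithms are deterministic programs of a random access machine with registers and arrays holding natural numbers, whose running time is measured by logarithmic cost (every value that is handled is charged its bit length). In all the hypotheses below $\varepsilon$ ranges over $(0,1)$. Hypotheses. - PP-SETH: for all $\varepsilon>0$ there is no algorithm which takes as input a 3-CNF formula together with a path decomposition of width $\mathrm{pw}$ of its primal graph (the graph on the variables in which two variables are adjacent if they appear in a common clause) and decides if the formula is satisfiable in time $(2-\varepsilon)^{\mathrm{pw}}\cdot L^{O(1)}$, where $L$ is the size of the input (formula and decomposition). - $k$-Most-Orthogonal Vectors: given $k$ arrays, each containing $n\ge 2$ boolean vectors of dimension $d\ge 1$, and an integer $0\le t\le d$, decide if one can select one vector from each array so that the coordinatewise product of the $k$ selected vectors has at least $t$ zeroes. The maximization version of the $k$-OVA states that for all $k\ge 2$, $\varepsilon>0$ there is no algorithm for this problem with running time $O(n^{(1-\varepsilon)k}d^{O(1)})$. - The maximization version of the SETH states that for all $\varepsilon>0$ there is $q$ such that there is no algorithm which, given a $q$-CNF formula $\phi$ (clauses of at most $q$ literals) on $n$ variables and an integer $t$ between $0$ and the number of clauses of $\phi$, decides if some assignment satisfies at least $t$ clauses in time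 $(2-\varepsilon)^n|\phi|^{O(1)}$. Its unbounded-arity version (implied by it) states that for all $\varepsilon>0$ there is no such algorithm for CNF formulas of arbitrary arity. - Set Cover Conjecture (SCC): for all $\varepsilon>0$ there is no algorithm which, given $m\ge1$ subsets of a set of $n$ elements and an integer $0\le t\le m$, decides in time $O((2-\varepsilon)^n m^{O(1)})$ if at most $t$ of the subsets cover all the elements. - Subset Sum: given positive integers $v_1,\dots,v_n$ ($n\ge1$) and a target value $t\geq \max_i v_i$, decide if some of the integers (each used at most once) sum to exactly $t$. Theorem. If the PP-SETH is false, then both of the following hold: 1. There exist $k_0>1$, $\varepsilon>0$ and a single algorithm which for all $k>k_0$ solves $k$-Most-Orthogonal Vectors in time $O(n^{(1-\varepsilon)k}d^{O(1)})$, where the constants in both $O(\cdot)$ do not depend on $k$. Moreover, the maximization version of the SETH (also with unbounded arity) and the maximization version of the $k$-OVA are false. 2. There exist $\varepsilon>0$ and an algorithm that solves Subset Sum on $n$ elements with target value $t$ in time $O(t^{1-\varepsilon}n^{O(1)})$. Moreover, the SCC is false. Hence the maximization versions of the $k$-OVA and of the SETH, as well as the SCC, each imply the PP-SETH. -/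

import Mathlib

/-! ### Machine model: a random access machine with logarithmic cost

Programs are structured programs over natural-number registers and arrays of natural numbers (a
program mentions only finitely many of them).  Every value that is produced, read, written or used
as an address is charged its bit length. -/

namespace RAM

/-- Memory contents: the value of every register, and of every cell of every array. -/
structure State where
  reg : ℕ → ℕ
  arr : ℕ → ℕ → ℕ

/-- Arithmetic and comparison operations; comparisons return `1` or `0`. -/
inductive Op where
  | add | sub | mul | div | mod | lt | eq

/-- Value of an operation; subtraction is truncated at `0`, and `x / 0 = 0`, `x % 0 = x`. -/
def Op.eval : Op → ℕ → ℕ → ℕ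
  | .add, x, y => x + y
  | .sub, x, y => x - y
  | .mul, x, y => x * y
  | .div, x, y => x / y
  | .mod, x, y => x % y
  | .lt, x, y => if x < y then 1 else 0
  | .eq, x, y => if x = y then 1 else 0

inductive Expr where
  /-- a constant -/
  | const (v : ℕ)
  /-- the content of register `x` -/
  | reg (x : ℕ)
  /-- the content of the cell of array `a` whose address is the value of `i` (indirect access) -/
  | get (a : ℕ) (i : Expr)
  /-- an operation applied to two subexpressions -/
  | op (o : Op) (l r : Expr)

def Expr.eval (s : State) : Expr → ℕ
  | .const v => v
  | .reg x => s.reg x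
  | .get a i => s.arr a (i.eval s)
  | .op o l r => o.eval (l.eval s) (r.eval s)

/-- Logarithmic cost of an expression: every subexpression costs one plus the bit length
of its value. -/
def Expr.cost (s : State) : Expr → ℕ
  | .const v => 1 + Nat.size v
  | .reg x => 1 + Nat.size (s.reg x)
  | .get a i => i.cost s + 1 + Nat.size (s.arr a (i.eval s))
  | .op o l r => l.cost s + r.cost s + 1 + Nat.size (o.eval (l.eval s) (r.eval s))

def State.setReg (s : State) (x v : ℕ) : State :=
  { s with reg := Function.update s.reg x v }

def State.setCell (s : State) (a i v : ℕ) : State :=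
  { s with arr := Function.update s.arr a (Function.update (s.arr a) i v) }

inductive Prog where
  | skip
  /-- register `x` receives the value of `e` -/
  | assign (x : ℕ) (e : Expr)
  /-- cell number `i` of array `a` receives the value of `e` -/
  | store (a : ℕ) (i e : Expr)
  | seq (p q : Prog)
  /-- conditional; a condition is true if its value is not `0` -/
  | ite (b : Expr) (p q : Prog)
  | while (b : Expr) (p : Prog)

/-- `Exec p s s' c`: started in memory `s`, the program `p` halts with memory `s'`,
and the run costs exactly `c`. -/
inductive Exec : Prog → State → State → ℕ → Prop where
  | skip (s : State) : Exec .skip s s 1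
  | assign (x : ℕ) (e : Expr) (s : State) :
      Exec (.assign x e) s (s.setReg x (e.eval s)) (1 + e.cost s)
  | store (a : ℕ) (i e : Expr) (s : State) :
      Exec (.store a i e) s (s.setCell a (i.eval s) (e.eval s)) (1 + i.cost s + e.cost s)
  | seq {p q : Prog} {s s₁ s₂ : State} {c₁ c₂ : ℕ} :
      Exec p s s₁ c₁ → Exec q s₁ s₂ c₂ → Exec (.seq p q) s s₂ (c₁ + c₂)
  | ite_true {b : Expr} {p q : Prog} {s s₁ : State} {c : ℕ} :
      b.eval s ≠ 0 → Exec p s s₁ c → Exec (.ite b p q) s s₁ (1 + b.cost s + c)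
  | ite_false {b : Expr} {p q : Prog} {s s₁ : State} {c : ℕ} :
      b.eval s = 0 → Exec q s s₁ c → Exec (.ite b p q) s s₁ (1 + b.cost s + c)
  | while_true {b : Expr} {p : Prog} {s s₁ s₂ : State} {c₁ c₂ : ℕ} :
      b.eval s ≠ 0 → Exec p s s₁ c₁ → Exec (.while b p) s₁ s₂ c₂ →
        Exec (.while b p) s s₂ (1 + b.cost s + c₁ + c₂)
  | while_false {b : Expr} {p : Prog} {s : State} :
      b.eval s = 0 → Exec (.while b p) s s (1 + b.cost s)

/-- Initial memory on input `w`: register `0` holds the length of `w`, array `0` holds the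
entries of `w`, and everything else is `0`. -/
def init (w : List ℕ) : State where
  reg := fun x => if x = 0 then w.length else 0
  arr := fun a i => if a = 0 then w.getD i 0 else 0

/-- On input `w` the program halts at cost at most `T`, and it accepts (register `0` ends with a
nonzero value) if and only if `answer` holds. -/
def Prog.DecidesWithin (p : Prog) (w : List ℕ) (answer : Prop) (T : ℝ) : Prop :=
  ∃ s c, Exec p (init w) s c ∧ (c : ℝ) ≤ T ∧ (s.reg 0 ≠ 0 ↔ answer)

/-- The program `p` correctly decides every instance `I` in time `T I`. -/
def Prog.Solves {Inst : Type} (p : Prog) (encode : Inst → List ℕ) (yes : Inst → Prop)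
    (T : Inst → ℝ) : Prop :=
  ∀ I : Inst, p.DecidesWithin (encode I) (yes I) (T I)

end RAM

/-! ### CNF formulas, primal graphs and path decompositions -/

/-- A literal over the variables `0, …, n - 1`: a variable with the value that makes it true. -/
abbrev Literal (n : ℕ) := Fin n × Bool

abbrev Clause (n : ℕ) := List (Literal n)

abbrev CNF (n : ℕ) := List (Clause n)

def Clause.Sat {n : ℕ} (σ : Fin n → Bool) (C : Clause n) : Prop :=
  ∃ l ∈ C, σ l.1 = l.2

instance {n : ℕ} (σ : Fin n → Bool) : DecidablePred (Clause.Sat σ) :=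
  fun C => inferInstanceAs (Decidable (∃ l ∈ C, σ l.1 = l.2))

def CNF.Satisfiable {n : ℕ} (φ : CNF n) : Prop :=
  ∃ σ : Fin n → Bool, ∀ C ∈ φ, Clause.Sat σ C

/-- The number of variables, the number of clauses, then each clause as its length followed by
its literals. -/
def CNF.encode {n : ℕ} (φ : CNF n) : List ℕ :=
  n :: φ.length :: φ.flatMap fun C => C.length :: C.map fun l => 2 * l.1.val + l.2.toNat

/-- Two distinct variables are adjacent if they appear together in some clause. -/
def CNF.primalGraph {n : ℕ} (φ : CNF n) : SimpleGraph (Fin n) where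
  Adj x y := x ≠ y ∧ ∃ C ∈ φ, x ∈ C.map Prod.fst ∧ y ∈ C.map Prod.fst
  symm := ⟨fun _ _ h => ⟨h.1.symm, h.2.imp fun _ hC => ⟨hC.1, hC.2.2, hC.2.1⟩⟩⟩
  loopless := ⟨fun _ h => h.1 rfl⟩

structure IsPathDecomposition {V : Type} (G : SimpleGraph V) (bags : List (Finset V)) : Prop where
  vertex_mem : ∀ v, ∃ B ∈ bags, v ∈ B
  edge_mem : ∀ u v, G.Adj u v → ∃ B ∈ bags, u ∈ B ∧ v ∈ B
  interval : ∀ (v : V) (i j l : Fin bags.length), i ≤ j → j ≤ l →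
    v ∈ bags.get i → v ∈ bags.get l → v ∈ bags.get j

/-- Maximum size of a bag, minus one (`0` if there is no nonempty bag). -/
def pathWidth {V : Type} (bags : List (Finset V)) : ℕ :=
  (bags.map Finset.card).foldr max 0 - 1

/-! ### The computational problems -/

/-- A 3-CNF formula together with a path decomposition of its primal graph; each bag is a
repetition-free list of variables. -/
structure PathSATInstance where
  n : ℕ
  φ : CNF n
  arity_le : ∀ C ∈ φ, C.length ≤ 3
  bags : List (List (Fin n))
  nodup : ∀ B ∈ bags, B.Nodup
  isPathDecomposition : IsPathDecomposition φ.primalGraph (bags.map List.toFinset)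

namespace PathSATInstance

def encode (I : PathSATInstance) : List ℕ :=
  I.φ.encode ++ I.bags.length :: I.bags.flatMap fun B => B.length :: B.map Fin.val

def width (I : PathSATInstance) : ℕ := pathWidth (I.bags.map List.toFinset)

def Yes (I : PathSATInstance) : Prop := I.φ.Satisfiable

end PathSATInstance

/-- Max-SAT: can at least `t` clauses be satisfied simultaneously? -/
structure MaxSATInstance where
  n : ℕ
  φ : CNF n
  t : ℕ
  t_le : t ≤ φ.length

namespace MaxSATInstance

def encode (I : MaxSATInstance) : List ℕ := I.t :: I.φ.encode

def Yes (I : MaxSATInstance) : Prop :=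
  ∃ σ : Fin I.n → Bool, I.t ≤ (I.φ.filter fun C => Clause.Sat σ C).length

end MaxSATInstance

/-- `k`-Most-Orthogonal Vectors: `k` arrays of `n` boolean vectors of dimension `d`. -/
structure MOVInstance (k : ℕ) where
  n : ℕ
  d : ℕ
  two_le_n : 2 ≤ n
  one_le_d : 1 ≤ d
  A : Fin k → Fin n → Fin d → Bool
  t : ℕ
  t_le : t ≤ d

namespace MOVInstance

def encode {k : ℕ} (I : MOVInstance k) : List ℕ :=
  k :: I.n :: I.d :: I.t :: (List.finRange k).flatMap fun i => (List.finRange I.n).flatMap fun a =>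
    (List.finRange I.d).map fun j => (I.A i a j).toNat

/-- One vector can be selected from each array such that the coordinatewise product of the selected
vectors has at least `t` zeroes. -/
def Yes {k : ℕ} (I : MOVInstance k) : Prop :=
  ∃ s : Fin k → Fin I.n,
    I.t ≤ (Finset.univ.filter fun j : Fin I.d => ∃ i : Fin k, I.A i (s i) j = false).card

end MOVInstance

/-- Subset Sum on `n ≥ 1` positive integers, none of which exceeds the target value `t`. -/
structure SubsetSumInstance where
  n : ℕ
  one_le_n : 1 ≤ n
  v : Fin n → ℕ
  t : ℕ
  one_le_v : ∀ i, 1 ≤ v i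
  v_le : ∀ i, v i ≤ t

namespace SubsetSumInstance

def encode (I : SubsetSumInstance) : List ℕ := I.n :: I.t :: List.ofFn I.v

def Yes (I : SubsetSumInstance) : Prop := ∃ S : Finset (Fin I.n), ∑ i ∈ S, I.v i = I.t

end SubsetSumInstance

/-- Set Cover: can the `n` elements be covered by at most `t` of the `m ≥ 1` given sets? -/
structure SetCoverInstance where
  n : ℕ
  m : ℕ
  one_le_m : 1 ≤ m
  F : Fin m → Finset (Fin n)
  t : ℕ
  t_le : t ≤ m

namespace SetCoverInstance

/-- The sets are given by the rows of the incidence matrix. -/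
def encode (I : SetCoverInstance) : List ℕ :=
  I.n :: I.m :: I.t :: (List.finRange I.m).flatMap fun j =>
    (List.finRange I.n).map fun x => if x ∈ I.F j then 1 else 0

def Yes (I : SetCoverInstance) : Prop :=
  ∃ S : Finset (Fin I.m), S.card ≤ I.t ∧ ∀ x, ∃ j ∈ S, x ∈ I.F j

end SetCoverInstance

/-! ### The hypotheses

In all of them `ε` ranges over `(0, 1)`; larger values only strengthen the time bound whose
attainability is denied. -/

/-- Satisfiability of 3-CNF formulas with a given path decomposition of width `pw` of the primal
graph cannot be decided in time `(2 - ε) ^ pw` times a polynomial in the size of the input. -/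
def PPSETH : Prop :=
  ∀ ε : ℝ, 0 < ε → ε < 1 → ¬ ∃ (p : RAM.Prog) (C c : ℕ),
    p.Solves PathSATInstance.encode PathSATInstance.Yes
      fun I => C * (2 - ε) ^ I.width * (I.encode.length : ℝ) ^ c

/-- Maximization version of the SETH: for each `ε` there is an arity `q` such that Max-`q`-SAT on
`n` variables cannot be solved in time `(2 - ε) ^ n` times a polynomial in the size. -/
def MaxSETH : Prop :=
  ∀ ε : ℝ, 0 < ε → ε < 1 → ∃ q : ℕ, ¬ ∃ (p : RAM.Prog) (C c : ℕ),
    p.Solves (Inst := {I : MaxSATInstance // ∀ K ∈ I.φ, K.length ≤ q})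
      (fun I => I.1.encode) (fun I => I.1.Yes)
      fun I => C * (2 - ε) ^ I.1.n * (I.1.encode.length : ℝ) ^ c

/-- The same for CNF formulas of unbounded arity; it is implied by the
bounded-arity form `MaxSETH`, so refuting it is the stronger claim. -/
def MaxSETHUnboundedArity : Prop :=
  ∀ ε : ℝ, 0 < ε → ε < 1 → ¬ ∃ (p : RAM.Prog) (C c : ℕ),
    p.Solves MaxSATInstance.encode MaxSATInstance.Yes
      fun I => C * (2 - ε) ^ I.n * (I.encode.length : ℝ) ^ c

/-- Maximization version of the `k`-Orthogonal Vectors Assumption. -/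
def MaxKOVA : Prop :=
  ∀ k : ℕ, 2 ≤ k → ∀ ε : ℝ, 0 < ε → ε < 1 → ¬ ∃ (p : RAM.Prog) (C c : ℕ),
    p.Solves (MOVInstance.encode (k := k)) MOVInstance.Yes
      fun I => C * (I.n : ℝ) ^ ((1 - ε) * k) * (I.d : ℝ) ^ c

/-- Set Cover Conjecture. -/
def SCC : Prop :=
  ∀ ε : ℝ, 0 < ε → ε < 1 → ¬ ∃ (p : RAM.Prog) (C c : ℕ),
    p.Solves SetCoverInstance.encode SetCoverInstance.Yes
      fun I => C * (2 - ε) ^ I.n * (I.m : ℝ) ^ c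

/-- There are `k₀ > 1`, `ε > 0` and one algorithm which, for all `k > k₀`, solves
`k`-Most-Orthogonal Vectors in time `O(n ^ ((1 - ε) k) d ^ O(1))`, with constants independent
of `k`. -/
def FastMostOrthogonalVectors : Prop :=
  ∃ (k₀ : ℕ) (ε : ℝ), 1 < k₀ ∧ 0 < ε ∧ ∃ (p : RAM.Prog) (C c : ℕ), ∀ k : ℕ, k₀ < k →
    p.Solves (MOVInstance.encode (k := k)) MOVInstance.Yes
      fun I => C * (I.n : ℝ) ^ ((1 - ε) * k) * (I.d : ℝ) ^ c

/-- There are `ε > 0` and an algorithm which solves Subset Sum on `n` elements with target value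
`t` in time `O(t ^ (1 - ε) n ^ O(1))`. -/
def FastSubsetSum : Prop :=
  ∃ ε : ℝ, 0 < ε ∧ ∃ (p : RAM.Prog) (C c : ℕ),
    p.Solves SubsetSumInstance.encode SubsetSumInstance.Yes
      fun I => C * (I.t : ℝ) ^ (1 - ε) * (I.n : ℝ) ^ c

/-! A formula with a path decomposition of width about `S` can simulate a nondeterministic
computation with `S` bits of memory. Consider a straight-line program each of whose instructions
guesses one bit into a register and then tests four clauses with three literals on the registers.
Introduce a variable for the initial content of each register and one for each guess. The variables
that are current at a given time form a bag. A variable that has been overwritten never becomes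
current again, and the clauses of an instruction only speak of variables that are current after its
guess, so the bags form a path decomposition (`BitProg.isPathDecomposition`). An assignment is the
record of a run, so the formula is satisfiable if and only if the program has a successful run
(`BitProg.run_iff_satAt`). If PP-SETH fails, every problem with such a program on `S` bits that is
generated in polynomial time is thus decided in time `(2 - ε) ^ S` times a polynomial
(`exists_solves_of_generates`).

It remains to solve the four problems with little memory. All four programs use a counter of `B`
bits that starts at `2 ^ B - 1 - T` and must not overflow, so that at most `T` can be added to it.
For Subset Sum (`run_choose`) the counter is the whole memory, apart from three registers: add a
guessed subset of the numbers with `T = t` and require all ones at the end, which takes about `log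
t` bits. For Set Cover (`run_cover`) one bit per element records whether it is covered, and the
counter counts the chosen sets. Max-SAT and Most-Orthogonal Vectors are both of the form "some fixed
data violate at most `T` of `m` conditions" (`run_budget`): the data are an assignment, or the
selected positions. Counters for these counts have logarithmic length and cost a polynomial factor
only.

For `k` arrays of `n` vectors, storing each position separately would take `k` times the rounded-up
logarithm of `n`, and for small `n` the rounding would destroy the saving. The positions in `G`
arrays are therefore stored together, as one number below `n ^ G`; a large constant `G` makes the
loss a factor close to `1` in the exponent. The factors `n ^ O(G)` and `k ^ O(1)` are absorbed once
`k` is large, because `n ≥ 2`.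

On the machine side, the reductions are written in a small language of list generators with bounded
loops. It is compiled once and for all, with a polynomial cost bound (`Gen.compile_spec`), so that
for each problem only the emitted list and the loop limits have to be examined. The assumed
algorithm is then run on a translated copy of the memory (`Exec.shift`). -/

namespace RAM

/-! ### Relocation of programs -/

/-- Names of registers and arrays are translated, but addresses inside an array are not, since they
are computed values. This makes room for the assumed algorithm beside the memory used by a
reduction. -/
def Expr.shift (r a : ℕ) : Expr → Expr
  | .const v => .const v
  | .reg x => .reg (x + r)
  | .get b i => .get (b + a) (i.shift r a)
  | .op o l m => .op o (l.shift r a) (m.shift r a)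

def Prog.shift (r a : ℕ) : Prog → Prog
  | .skip => .skip
  | .assign x e => .assign (x + r) (e.shift r a)
  | .store b i e => .store (b + a) (i.shift r a) (e.shift r a)
  | .seq p q => .seq (p.shift r a) (q.shift r a)
  | .ite b p q => .ite (b.shift r a) (p.shift r a) (q.shift r a)
  | .while b p => .while (b.shift r a) (p.shift r a)

/-- The part of the memory that a program shifted by `r` registers and `a` arrays can access. -/
def State.view (r a : ℕ) (s : State) : State := ⟨fun x => s.reg (x + r), fun b => s.arr (b + a)⟩

theorem Expr.eval_shift (r a : ℕ) (s : State) (e : Expr) :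
    (e.shift r a).eval s = e.eval (s.view r a) := by
  induction e with
  | const v => rfl
  | reg x => rfl
  | get b i ih => simp [shift, eval, ih, State.view]
  | op o l m ihl ihm => simp [shift, eval, ihl, ihm]

theorem Expr.cost_shift (r a : ℕ) (s : State) (e : Expr) :
    (e.shift r a).cost s = e.cost (s.view r a) := by
  induction e with
  | const v => rfl
  | reg x => rfl
  | get b i ih => simp [shift, cost, ih, eval_shift, State.view]
  | op o l m ihl ihm => simp [shift, cost, ihl, ihm, eval_shift]

theorem State.view_setReg (r a : ℕ) (s : State) (x v : ℕ) :
    (s.setReg (x + r) v).view r a = (s.view r a).setReg x v := by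
  simp only [view, setReg, State.mk.injEq, and_true]
  funext y
  simp [Function.update_apply]

theorem State.view_setCell (r a : ℕ) (s : State) (b i v : ℕ) :
    (s.setCell (b + a) i v).view r a = (s.view r a).setCell b i v := by
  simp only [view, setCell, State.mk.injEq, true_and]
  funext y
  by_cases h : y = b
  · subst h; simp
  · simp [h]

/-- The cost is preserved exactly because the machine charges for values and not for the names of
registers and arrays. -/
theorem Exec.shift {r a : ℕ} {p : Prog} {s s' : State} {c : ℕ} (h : Exec p s s' c) :
    ∀ t : State, t.view r a = s → ∃ t', Exec (p.shift r a) t t' c ∧ t'.view r a = s' := by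
  induction h with
  | skip s => exact fun t ht => ⟨t, .skip t, ht⟩
  | assign x e s =>
    rintro t rfl
    refine ⟨_, ?_, State.view_setReg r a t x _⟩
    rw [← Expr.eval_shift, ← Expr.cost_shift]
    exact .assign _ _ _
  | store b i e s =>
    rintro t rfl
    refine ⟨_, ?_, State.view_setCell r a t b _ _⟩
    rw [← Expr.eval_shift, ← Expr.eval_shift, ← Expr.cost_shift, ← Expr.cost_shift]
    exact .store _ _ _ _
  | seq _ _ ihp ihq =>
    intro t ht
    obtain ⟨t₁, h₁, e₁⟩ := ihp t ht
    obtain ⟨t₂, h₂, e₂⟩ := ihq t₁ e₁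
    exact ⟨t₂, .seq h₁ h₂, e₂⟩
  | ite_true hb _ ih =>
    rintro t rfl
    obtain ⟨t₁, h₁, e₁⟩ := ih t rfl
    refine ⟨t₁, ?_, e₁⟩
    rw [← Expr.cost_shift]
    exact .ite_true (by rwa [Expr.eval_shift]) h₁
  | ite_false hb _ ih =>
    rintro t rfl
    obtain ⟨t₁, h₁, e₁⟩ := ih t rfl
    refine ⟨t₁, ?_, e₁⟩
    rw [← Expr.cost_shift]
    exact .ite_false (by rwa [Expr.eval_shift]) h₁
  | while_true hb _ _ ih₁ ih₂ =>
    rintro t rfl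
    obtain ⟨t₁, h₁, e₁⟩ := ih₁ t rfl
    obtain ⟨t₂, h₂, e₂⟩ := ih₂ t₁ e₁
    refine ⟨t₂, ?_, e₂⟩
    rw [← Expr.cost_shift]
    exact .while_true (by rwa [Expr.eval_shift]) h₁ h₂
  | while_false hb =>
    rintro t rfl
    refine ⟨t, ?_, rfl⟩
    rw [← Expr.cost_shift]
    exact .while_false (by rwa [Expr.eval_shift])

/-- A loop that runs `N` times, by an invariant indexed by the number of completed rounds. -/
theorem Exec.while_count {b : Expr} {p : Prog} {N Tb T : ℕ} (Inv : ℕ → State → Prop)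
    (step : ∀ i < N, ∀ s, Inv i s → b.eval s ≠ 0 ∧ b.cost s ≤ Tb ∧
      ∃ s' c, Exec p s s' c ∧ c ≤ T ∧ Inv (i + 1) s')
    (halt : ∀ s, Inv N s → b.eval s = 0 ∧ b.cost s ≤ Tb) :
    ∀ s, Inv 0 s → ∃ s' c, Exec (.while b p) s s' c ∧ c ≤ (N + 1) * (1 + Tb + T) ∧ Inv N s' := by
  have key : ∀ k i, i + k = N → ∀ s, Inv i s →
      ∃ s' c, Exec (.while b p) s s' c ∧ c ≤ (k + 1) * (1 + Tb + T) ∧ Inv N s' := by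
    intro k
    induction k with
    | zero =>
      rintro i rfl s hs
      obtain ⟨h₁, h₂⟩ := halt s hs
      exact ⟨s, _, .while_false h₁, by omega, hs⟩
    | succ k ih =>
      intro i hi s hs
      obtain ⟨h₁, h₂, s₁, c₁, e₁, hc₁, hs₁⟩ := step i (by omega) s hs
      obtain ⟨s₂, c₂, e₂, hc₂, hs₂⟩ := ih (i + 1) (by omega) s₁ hs₁
      refine ⟨s₂, _, .while_true h₁ e₁ e₂, ?_, hs₂⟩
      have : (k + 1 + 1) * (1 + Tb + T) = (k + 1) * (1 + Tb + T) + (1 + Tb + T) := by ring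
      omega
  exact fun s hs => key N 0 (by simp) s hs

/-! ### A language of list generators -/

/-- Number of registers available to generators. -/
abbrev numRegs : ℕ := 40

/-- Generators of lists of natural numbers.  Binders bind the registers from the current level on:
`loop n g` binds the limit and the index, `bind e g` the value of `e`, `size e g` a scratch register
and the bit length of `e`, and `fold n init step g` the limit, the index and the accumulator. -/
inductive Gen where
  | nil
  | emit (es : List Expr)
  | seq (g h : Gen)
  | guard (b : Expr) (g : Gen)
  | loop (n : Expr) (g : Gen)
  | bind (e : Expr) (g : Gen)
  | size (e : Expr) (g : Gen)
  | fold (n init step : Expr) (g : Gen)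

/-- The step reads the limit in register `D`, the index in `D + 1` and the previous accumulator in
`D + 2`, which is the layout maintained by the compiled loop. -/
def foldAcc (D : ℕ) (s : State) (n init step : Expr) : ℕ → ℕ
  | 0 => init.eval s
  | i + 1 => step.eval
      (((s.setReg D (n.eval s)).setReg (D + 1) i).setReg (D + 2) (foldAcc D s n init step i))

namespace Gen

/-- The list of chunks emitted by a generator. -/
def den : Gen → ℕ → State → List (List ℕ)
  | nil, _, _ => []
  | emit es, _, s => [es.map fun e => e.eval s]
  | seq g h, D, s => g.den D s ++ h.den D s
  | guard b g, D, s => if b.eval s ≠ 0 then g.den D s else []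
  | .loop n g, D, s => (List.range (n.eval s)).flatMap fun i =>
      g.den (D + 2) ((s.setReg D (n.eval s)).setReg (D + 1) i)
  | bind e g, D, s => g.den (D + 1) (s.setReg D (e.eval s))
  | size e g, D, s => g.den (D + 2) ((s.setReg D 0).setReg (D + 1) (Nat.size (e.eval s)))
  | fold n init step g, D, s => g.den (D + 3)
      (((s.setReg D (n.eval s)).setReg (D + 1) (n.eval s)).setReg (D + 2)
        (foldAcc D s n init step (n.eval s)))

/-- All loops make at most `Y` rounds, and all accumulators have at most `Y` bits. -/
def Bounded (Y : ℕ) : Gen → ℕ → State → Prop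
  | nil, _, _ => True
  | emit _, _, _ => True
  | seq g h, D, s => g.Bounded Y D s ∧ h.Bounded Y D s
  | guard b g, D, s => b.eval s ≠ 0 → g.Bounded Y D s
  | .loop n g, D, s => n.eval s ≤ Y ∧ ∀ i < n.eval s,
      g.Bounded Y (D + 2) ((s.setReg D (n.eval s)).setReg (D + 1) i)
  | bind e g, D, s => g.Bounded Y (D + 1) (s.setReg D (e.eval s))
  | size e g, D, s =>
      g.Bounded Y (D + 2) ((s.setReg D 0).setReg (D + 1) (Nat.size (e.eval s)))
  | fold n init step g, D, s => n.eval s ≤ Y ∧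
      (∀ i ≤ n.eval s, Nat.size (foldAcc D s n init step i) ≤ Y) ∧ g.Bounded Y (D + 3)
      (((s.setReg D (n.eval s)).setReg (D + 1) (n.eval s)).setReg (D + 2)
        (foldAcc D s n init step (n.eval s)))

end Gen

/-- The expression reads only registers below `D`, and does not read array `o`. -/
def Expr.ok (o D : ℕ) : Expr → Bool
  | .const _ => true
  | .reg x => x < D
  | .get a i => a ≠ o && i.ok o D
  | .op _ l r => l.ok o D && r.ok o D

def Gen.ok (o : ℕ) : Gen → ℕ → Bool
  | nil, _ => true
  | emit es, D => es.all fun e => e.ok o D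
  | seq g h, D => g.ok o D && h.ok o D
  | guard b g, D => b.ok o D && g.ok o D
  | .loop n g, D => D + 2 ≤ numRegs && n.ok o D && g.ok o (D + 2)
  | bind e g, D => D + 1 ≤ numRegs && e.ok o D && g.ok o (D + 1)
  | size e g, D => D + 2 ≤ numRegs && e.ok o D && g.ok o (D + 2)
  | fold n init step g, D => D + 3 ≤ numRegs && n.ok o D && init.ok o D && step.ok o (D + 3) &&
      g.ok o (D + 3)

/-- Appends the values of the expressions to array `o`, whose length is in register `q`. -/
def emitProg (o q : ℕ) : List Expr → Prog
  | [] => .skip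
  | e :: es => .seq (.store o (.reg q) e)
      (.seq (.assign q (.op .add (.reg q) (.const 1))) (emitProg o q es))

/-- `D` is the first free register. Each binder takes registers from `D` on and passes a higher
level to its body, so a body never overwrites an enclosing limit or index. The output pointer `q`
will lie beyond all of them. -/
def Gen.compile (o q : ℕ) : Gen → ℕ → Prog
  | nil, _ => .skip
  | emit es, _ => emitProg o q es
  | seq g h, D => .seq (g.compile o q D) (h.compile o q D)
  | guard b g, D => .ite b (g.compile o q D) .skip
  | .loop n g, D => .seq (.assign D n) (.seq (.assign (D + 1) (.const 0))
      (.while (.op .lt (.reg (D + 1)) (.reg D)) (.seq (g.compile o q (D + 2))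
        (.assign (D + 1) (.op .add (.reg (D + 1)) (.const 1))))))
  | bind e g, D => .seq (.assign D e) (g.compile o q (D + 1))
  | size e g, D => .seq (.assign D e) (.seq (.assign (D + 1) (.const 0))
      (.seq (.while (.reg D) (.seq (.assign D (.op .div (.reg D) (.const 2)))
        (.assign (D + 1) (.op .add (.reg (D + 1)) (.const 1))))) (g.compile o q (D + 2))))
  | fold n init step g, D => .seq (.assign D n) (.seq (.assign (D + 1) (.const 0))
      (.seq (.assign (D + 2) init)
      (.seq (.while (.op .lt (.reg (D + 1)) (.reg D)) (.seq (.assign (D + 2) step)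
        (.assign (D + 1) (.op .add (.reg (D + 1)) (.const 1))))) (g.compile o q (D + 3)))))

/-! ### Agreement of memories below a level -/

/-- Array `o` is exempt because it receives the output. Expressions that pass `Expr.ok` read neither
it nor registers from `D` on, so they cannot notice scratch work or earlier emissions. -/
def State.Same (o D : ℕ) (s s' : State) : Prop :=
  (∀ x < D, s'.reg x = s.reg x) ∧ ∀ a, a ≠ o → s'.arr a = s.arr a

namespace State.Same

variable {o D : ℕ} {s s' s'' : State}

theorem refl (o D : ℕ) (s : State) : s.Same o D s := ⟨fun _ _ => rfl, fun _ _ => rfl⟩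

theorem trans (h : s.Same o D s') (h' : s'.Same o D s'') : s.Same o D s'' :=
  ⟨fun x hx => (h'.1 x hx).trans (h.1 x hx), fun a ha => (h'.2 a ha).trans (h.2 a ha)⟩

theorem mono {D' : ℕ} (h : s.Same o D' s') (hD : D ≤ D') : s.Same o D s' :=
  ⟨fun x hx => h.1 x (by omega), h.2⟩

theorem setReg (h : s.Same o D s') {D' : ℕ} (hD : D' = D + 1) (v : ℕ) :
    (s.setReg D v).Same o D' (s'.setReg D v) := by
  subst hD
  refine ⟨fun x hx => ?_, h.2⟩
  by_cases hxD : x = D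
  · simp [State.setReg, hxD]
  · simp [State.setReg, hxD, h.1 x (by omega)]

theorem setReg_right (h : s.Same o D s') {x : ℕ} (hx : D ≤ x) (v : ℕ) :
    s.Same o D (s'.setReg x v) :=
  ⟨fun y hy => by simp [State.setReg, show y ≠ x by omega, h.1 y hy], h.2⟩

end State.Same

theorem Expr.eval_congr {o D : ℕ} {s s' : State} (h : s.Same o D s') :
    ∀ e : Expr, e.ok o D → e.eval s' = e.eval s := by
  intro e
  induction e with
  | const v => simp [eval]
  | reg x => intro he; exact h.1 x (by simpa [ok] using he)
  | get a i ih =>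
    intro he
    simp only [ok, ne_eq, decide_not, Bool.and_eq_true, Bool.not_eq_eq_eq_not, Bool.not_true,
      decide_eq_false_iff_not] at he
    simp [eval, ih he.2, h.2 a he.1]
  | op o l r ihl ihr =>
    intro he
    simp only [ok, Bool.and_eq_true] at he
    simp [eval, ihl he.1, ihr he.2]

theorem foldAcc_congr {o D : ℕ} {s s' : State} (h : s.Same o D s') {n init step : Expr}
    (hn : n.ok o D) (hi : init.ok o D) (hs : step.ok o (D + 3)) (i : ℕ) :
    foldAcc D s' n init step i = foldAcc D s n init step i := by
  induction i with
  | zero => exact Expr.eval_congr h _ hi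
  | succ i ih =>
    rw [foldAcc, foldAcc, ih, Expr.eval_congr h _ hn]
    exact Expr.eval_congr (((h.setReg rfl _).setReg rfl _).setReg rfl _) _ hs

/-- Lets the output of a later part be computed from the memory before an earlier part has run: what
the earlier part changes is invisible to the later one. -/
theorem Gen.den_congr {o : ℕ} (g : Gen) : ∀ {D : ℕ} {s s' : State}, s.Same o D s' → g.ok o D →
    g.den D s' = g.den D s := by
  induction g with
  | nil => intros; rfl
  | emit es =>
    intro D s s' h hg
    simp only [ok, List.all_eq_true] at hg
    simp only [den, List.cons.injEq, and_true]
    exact List.map_congr_left fun e he => Expr.eval_congr h e (hg e he)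
  | seq g g' ih ih' =>
    intro D s s' h hg
    simp only [ok, Bool.and_eq_true] at hg
    simp only [den, ih h hg.1, ih' h hg.2]
  | guard b g ih =>
    intro D s s' h hg
    simp only [ok, Bool.and_eq_true] at hg
    simp only [den, ih h hg.2, Expr.eval_congr h b hg.1]
  | loop n g ih =>
    intro D s s' h hg
    simp only [ok, Bool.and_eq_true] at hg
    simp only [den, Expr.eval_congr h n hg.1.2]
    congr 1; funext i
    exact ih ((h.setReg rfl _).setReg rfl _) hg.2
  | bind e g ih =>
    intro D s s' h hg
    simp only [ok, Bool.and_eq_true] at hg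
    simp only [den, Expr.eval_congr h e hg.1.2]
    exact ih (h.setReg rfl _) hg.2
  | size e g ih =>
    intro D s s' h hg
    simp only [ok, Bool.and_eq_true] at hg
    simp only [den, Expr.eval_congr h e hg.1.2]
    exact ih ((h.setReg rfl _).setReg rfl _) hg.2
  | fold n init step g ih =>
    intro D s s' h hg
    simp only [ok, Bool.and_eq_true] at hg
    simp only [den, Expr.eval_congr h n hg.1.1.1.2,
      foldAcc_congr h hg.1.1.1.2 hg.1.1.2 hg.1.2]
    exact ih (((h.setReg rfl _).setReg rfl _).setReg rfl _) hg.2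

theorem Gen.bounded_congr {o Y : ℕ} (g : Gen) : ∀ {D : ℕ} {s s' : State}, s.Same o D s' →
    g.ok o D → (g.Bounded Y D s' ↔ g.Bounded Y D s) := by
  induction g with
  | nil => intros; rfl
  | emit es => intros; rfl
  | seq g g' ih ih' =>
    intro D s s' h hg
    simp only [ok, Bool.and_eq_true] at hg
    simp only [Bounded, ih h hg.1, ih' h hg.2]
  | guard b g ih =>
    intro D s s' h hg
    simp only [ok, Bool.and_eq_true] at hg
    simp only [Bounded, ih h hg.2, Expr.eval_congr h b hg.1]
  | loop n g ih =>
    intro D s s' h hg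
    simp only [ok, Bool.and_eq_true] at hg
    simp only [Bounded, Expr.eval_congr h n hg.1.2]
    refine and_congr_right fun _ => forall₂_congr fun i _ => ?_
    exact ih ((h.setReg rfl _).setReg rfl _) hg.2
  | bind e g ih =>
    intro D s s' h hg
    simp only [ok, Bool.and_eq_true] at hg
    simp only [Bounded, Expr.eval_congr h e hg.1.2]
    exact ih (h.setReg rfl _) hg.2
  | size e g ih =>
    intro D s s' h hg
    simp only [ok, Bool.and_eq_true] at hg
    simp only [Bounded, Expr.eval_congr h e hg.1.2]
    exact ih ((h.setReg rfl _).setReg rfl _) hg.2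
  | fold n init step g ih =>
    intro D s s' h hg
    simp only [ok, Bool.and_eq_true] at hg
    simp only [Bounded, Expr.eval_congr h n hg.1.1.1.2,
      foldAcc_congr h hg.1.1.1.2 hg.1.1.2 hg.1.2]
    rw [ih (((h.setReg rfl _).setReg rfl _).setReg rfl _) hg.2]

/-! ### Effect of a compiled generator -/

/-- The contents of an array after the list `l` has been written from address `p` on. -/
def writeAt : (ℕ → ℕ) → ℕ → List ℕ → ℕ → ℕ
  | f, _, [] => f
  | f, p, v :: l => writeAt (Function.update f p v) (p + 1) l

theorem writeAt_append (f : ℕ → ℕ) (p : ℕ) (l l' : List ℕ) :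
    writeAt f p (l ++ l') = writeAt (writeAt f p l) (p + l.length) l' := by
  induction l generalizing f p with
  | nil => rfl
  | cons v l ih => simp [writeAt, ih, add_comm, add_left_comm]

theorem writeAt_of_lt (f : ℕ → ℕ) (p : ℕ) (l : List ℕ) (i : ℕ) (hi : i < p) :
    writeAt f p l i = f i := by
  induction l generalizing f p with
  | nil => rfl
  | cons v l ih => rw [writeAt, ih _ _ (by omega), Function.update_of_ne (by omega)]

theorem writeAt_add (f : ℕ → ℕ) (p : ℕ) (l : List ℕ) (i : ℕ) :
    writeAt f p l (p + i) = l.getD i (f (p + i)) := by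
  induction l generalizing f p i with
  | nil => rfl
  | cons v l ih =>
    rw [writeAt]
    cases i with
    | zero => simp [writeAt_of_lt]
    | succ i =>
      have := ih (Function.update f p v) (p + 1) i
      rw [show p + 1 + i = p + (i + 1) by ring] at this
      rw [this, Function.update_of_ne (by omega)]
      simp

/-- The field `rest` protects the registers beyond those of the generators, apart from the pointer;
they have to be clean when the relocated algorithm starts there. -/
structure Effect (o q D : ℕ) (s s' : State) (l : List ℕ) : Prop where
  same : s.Same o D s'
  out : s'.arr o = writeAt (s.arr o) (s.reg q) l
  ptr : s'.reg q = s.reg q + l.length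
  rest : ∀ x, numRegs ≤ x → x ≠ q → s'.reg x = s.reg x

namespace Effect

variable {o q D : ℕ} {s s' s'' : State} {l l' : List ℕ}

theorem refl (o q D : ℕ) (s : State) : Effect o q D s s [] :=
  ⟨.refl _ _ _, rfl, rfl, fun _ _ _ => rfl⟩

theorem trans (h : Effect o q D s s' l) (h' : Effect o q D s' s'' l') :
    Effect o q D s s'' (l ++ l') where
  same := h.same.trans h'.same
  out := by rw [h'.out, h.out, h.ptr, writeAt_append]
  ptr := by rw [h'.ptr, h.ptr, List.length_append, add_assoc]
  rest x hx hxq := (h'.rest x hx hxq).trans (h.rest x hx hxq)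

theorem mono {D' : ℕ} (h : Effect o q D' s s' l) (hD : D ≤ D') : Effect o q D s s' l :=
  { h with same := h.same.mono hD }

theorem setReg (h : Effect o q D s s' l) {x : ℕ} (hD : D ≤ x) (hx : x < numRegs)
    (hq : numRegs ≤ q) (v : ℕ) : Effect o q D s (s'.setReg x v) l where
  same := h.same.setReg_right hD v
  out := h.out
  ptr := by
    rw [← h.ptr]
    exact Function.update_of_ne (by omega) _ _
  rest y hy hyq := by
    rw [← h.rest y hy hyq]
    exact Function.update_of_ne (by omega) _ _

end Effect

/-! ### Cost -/

def State.Sized (o D X : ℕ) (s : State) : Prop :=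
  (∀ x < D, Nat.size (s.reg x) ≤ X) ∧ ∀ a, a ≠ o → ∀ i, Nat.size (s.arr a i) ≤ X

theorem State.Sized.congr {o D X : ℕ} {s s' : State} (h : s.Sized o D X) (hs : s.Same o D s') :
    s'.Sized o D X :=
  ⟨fun x hx => by rw [hs.1 x hx]; exact h.1 x hx, fun a ha => by rw [hs.2 a ha]; exact h.2 a ha⟩

theorem State.Sized.mono {o D X X' : ℕ} {s : State} (h : s.Sized o D X) (hX : X ≤ X') :
    s.Sized o D X' :=
  ⟨fun x hx => (h.1 x hx).trans hX, fun a ha i => (h.2 a ha i).trans hX⟩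

theorem State.Sized.setReg {o D X : ℕ} {s : State} (h : s.Sized o D X) {D' : ℕ} (hD : D' = D + 1)
    {v : ℕ} (hv : Nat.size v ≤ X) : (s.setReg D v).Sized o D' X := by
  subst hD
  refine ⟨fun x hx => ?_, h.2⟩
  by_cases hxD : x = D
  · simpa [State.setReg, hxD] using hv
  · simpa [State.setReg, hxD] using h.1 x (by omega)

theorem size_add_le (x y : ℕ) : Nat.size (x + y) ≤ Nat.size x + Nat.size y + 1 := by
  rw [Nat.size_le]
  have h₁ := Nat.lt_size_self x
  have h₂ := Nat.lt_size_self y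
  have h₃ : 2 ^ Nat.size x ≤ 2 ^ (Nat.size x + Nat.size y) := by gcongr <;> omega
  have h₄ : 2 ^ Nat.size y ≤ 2 ^ (Nat.size x + Nat.size y) := by gcongr <;> omega
  rw [pow_succ]; omega

theorem size_mul_le (x y : ℕ) : Nat.size (x * y) ≤ Nat.size x + Nat.size y := by
  rw [Nat.size_le, pow_add]
  exact Nat.mul_lt_mul'' (Nat.lt_size_self x) (Nat.lt_size_self y)

theorem size_eval_op_le (o : Op) (x y : ℕ) :
    Nat.size (o.eval x y) ≤ Nat.size x + Nat.size y + 1 := by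
  cases o with
  | add => exact size_add_le x y
  | sub => exact (Nat.size_le_size (Nat.sub_le x y)).trans (by omega)
  | mul => exact (size_mul_le x y).trans (by omega)
  | div => exact (Nat.size_le_size (Nat.div_le_self x y)).trans (by omega)
  | mod => exact (Nat.size_le_size (Nat.mod_le x y)).trans (by omega)
  | lt => simp only [Op.eval]; split <;> simp [Nat.size_one]
  | eq => simp only [Op.eval]; split <;> simp [Nat.size_one]

/-- An operation yields at most the sum of the bit lengths of its arguments plus one. The expression
is fixed, so its value and cost are polynomial in the bit lengths stored in memory. -/
theorem Expr.exists_bound (o D : ℕ) (e : Expr) (he : e.ok o D) : ∃ f : Polynomial ℕ,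
    ∀ X s, s.Sized o D X → Nat.size (e.eval s) ≤ f.eval X ∧ e.cost s ≤ f.eval X := by
  induction e with
  | const v =>
    refine ⟨.C (1 + Nat.size v), fun X s _ => ?_⟩
    simp [eval, cost]
  | reg x =>
    refine ⟨1 + .X, fun X s h => ?_⟩
    have := h.1 x (by simpa [ok] using he)
    simp only [eval, cost, Polynomial.eval_add, Polynomial.eval_one, Polynomial.eval_X]
    omega
  | get a i ih =>
    simp only [ok, ne_eq, decide_not, Bool.and_eq_true, Bool.not_eq_eq_eq_not, Bool.not_true,
      decide_eq_false_iff_not] at he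
    obtain ⟨f, hf⟩ := ih he.2
    refine ⟨f + 1 + .X, fun X s h => ?_⟩
    have h₁ := h.2 a he.1 (i.eval s)
    have h₂ := hf X s h
    simp only [eval, cost, Polynomial.eval_add, Polynomial.eval_one, Polynomial.eval_X]
    omega
  | op o l r ihl ihr =>
    simp only [ok, Bool.and_eq_true] at he
    obtain ⟨f, hf⟩ := ihl he.1
    obtain ⟨g, hg⟩ := ihr he.2
    refine ⟨2 * f + 2 * g + 2, fun X s h => ?_⟩
    have h₁ := hf X s h
    have h₂ := hg X s h
    have h₃ := size_eval_op_le o (l.eval s) (r.eval s)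
    simp only [eval, cost, Polynomial.eval_add, Polynomial.eval_mul, Polynomial.eval_ofNat]
    omega

end RAM

/-! ### Correctness, cost and output length of compiled generators -/

namespace RAM

theorem size_le_self (v : ℕ) : Nat.size v ≤ v := Nat.size_le.2 Nat.lt_two_pow_self

theorem Exec.assign_of {x v : ℕ} {e : Expr} {s : State} (h : e.eval s = v) :
    Exec (.assign x e) s (s.setReg x v) (1 + e.cost s) := h ▸ .assign x e s

theorem emitProg_spec {o q D : ℕ} (hD : D ≤ numRegs) (hq : numRegs ≤ q) (es : List Expr) :
    (∀ e ∈ es, e.ok o D) → ∃ f : Polynomial ℕ, ∀ X s, s.Sized o D X →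
      Nat.size (s.reg q + es.length) ≤ X → ∃ s' c, Exec (emitProg o q es) s s' c ∧
        Effect o q D s s' (es.map fun e => e.eval s) ∧ c ≤ f.eval X := by
  induction es with
  | nil => exact fun _ => ⟨1, fun X s _ _ => ⟨s, 1, .skip s, .refl _ _ _ _, by simp⟩⟩
  | cons e es ih =>
    intro hes
    obtain ⟨f, hf⟩ := ih fun e' he' => hes e' (.tail _ he')
    obtain ⟨g, hg⟩ := e.exists_bound o D (hes e (.head _))
    refine ⟨f + g + 10 + 4 * .X, fun X s hs hl => ?_⟩
    obtain ⟨_, hc⟩ := hg X s hs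
    have h₁ : Nat.size (s.reg q) ≤ X := (Nat.size_le_size (by omega)).trans hl
    have h₂ : Nat.size (s.reg q + 1) ≤ X :=
      (Nat.size_le_size (by simp only [List.length_cons]; omega)).trans hl
    set s₁ := s.setCell o (s.reg q) (e.eval s) with hs₁
    set s₂ := s₁.setReg q (s.reg q + 1) with hs₂
    have hE : Effect o q D s s₂ [e.eval s] := by
      refine ⟨⟨fun x hx => ?_, fun a ha => ?_⟩, ?_, ?_, fun x _ hxq => ?_⟩
      · simp [hs₂, hs₁, State.setReg, State.setCell, show x ≠ q by omega]
      · simp [hs₂, hs₁, State.setReg, State.setCell, ha]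
      · simp [hs₂, hs₁, State.setReg, State.setCell, writeAt]
      · simp [hs₂, State.setReg]
      · simp [hs₂, hs₁, State.setReg, State.setCell, hxq]
    obtain ⟨s', c, he, hE', hc'⟩ := hf X s₂ (hs.congr hE.same) (by
      rw [hE.ptr]; simpa [add_assoc, add_comm, add_left_comm] using hl)
    have e₁ : Exec (.store o (.reg q) e) s s₁ _ := .store o (.reg q) e s
    have e₂ : Exec (.assign q (.op .add (.reg q) (.const 1))) s₁ s₂ _ := .assign q _ s₁
    refine ⟨s', _, .seq e₁ (.seq e₂ he), ?_, ?_⟩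
    · have : (es.map fun e => e.eval s₂) = es.map fun e => e.eval s :=
        List.map_congr_left fun e' he' => Expr.eval_congr hE.same e' (hes e' (.tail _ he'))
      rw [this] at hE'
      exact hE.trans hE'
    · have h₃ : s₁.reg q = s.reg q := rfl
      simp only [Expr.cost, Expr.eval, Op.eval, h₃, Nat.size_one, Polynomial.eval_add,
        Polynomial.eval_mul, Polynomial.eval_ofNat, Polynomial.eval_X]
      omega

theorem flatMap_range_succ {α : Type*} (f : ℕ → List α) (i : ℕ) :
    (List.range (i + 1)).flatMap f = (List.range i).flatMap f ++ f i := by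
  simp [List.range_succ]

theorem length_flatten_flatMap_range_le {α : Type*} (f : ℕ → List (List α)) {i n : ℕ}
    (h : i ≤ n) :
    ((List.range i).flatMap f).flatten.length ≤ ((List.range n).flatMap f).flatten.length := by
  induction n, h using Nat.le_induction with
  | base => exact le_rfl
  | succ n _ ih => rw [flatMap_range_succ, List.flatten_append, List.length_append]; omega

/-- Halving until zero counts the bits. The quantity `Nat.size v + s.reg (D + 1)` is constant during
the loop, which is why its bound by `X` survives the induction. -/
theorem halve_spec {o q D X : ℕ} (hD : D + 2 ≤ numRegs) (hq : numRegs ≤ q) (v : ℕ) :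
    ∀ s : State, s.reg D = v → Nat.size v + s.reg (D + 1) ≤ X → ∃ s' c,
      Exec (.while (.reg D) (.seq (.assign D (.op .div (.reg D) (.const 2)))
        (.assign (D + 1) (.op .add (.reg (D + 1)) (.const 1))))) s s' c ∧
      Effect o q D s s' [] ∧ s'.reg D = 0 ∧ s'.reg (D + 1) = s.reg (D + 1) + Nat.size v ∧
      c ≤ (Nat.size v + 1) * (20 + 20 * X) := by
  induction v using Nat.strong_induction_on with
  | _ v ih =>
    intro s hv hX
    by_cases h0 : v = 0
    · subst h0
      refine ⟨s, _, .while_false hv, .refl _ _ _ _, hv, by simp, ?_⟩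
      simp [Expr.cost, hv]; omega
    · have hs : Nat.size v = Nat.size (v / 2) + 1 := by
        have h₁ : v = Nat.bit v.bodd v.div2 := (Nat.bit_bodd_div2 v).symm
        have h₂ : Nat.bit v.bodd v.div2 ≠ 0 := by rwa [← h₁]
        have := Nat.size_bit h₂
        rw [← h₁, Nat.div2_val] at this
        exact this
      set s₁ := s.setReg D (v / 2) with hs₁
      set s₂ := s₁.setReg (D + 1) (s.reg (D + 1) + 1) with hs₂
      have r₁ : s₁.reg (D + 1) = s.reg (D + 1) := by simp [hs₁, State.setReg]
      have e₁ := Exec.assign_of (x := D) (e := .op .div (.reg D) (.const 2)) (s := s)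
        (v := v / 2) (by simp [Expr.eval, Op.eval, hv])
      have e₂ := Exec.assign_of (x := D + 1) (e := .op .add (.reg (D + 1)) (.const 1)) (s := s₁)
        (v := s.reg (D + 1) + 1) (by simp [Expr.eval, Op.eval, r₁])
      have r₂ : s₂.reg D = v / 2 := by simp [hs₂, hs₁, State.setReg]
      have r₃ : s₂.reg (D + 1) = s.reg (D + 1) + 1 := by simp [hs₂, State.setReg]
      obtain ⟨s', c, he, hE, h₁, h₂, hc⟩ := ih (v / 2) (by omega) s₂ r₂ (by omega)
      refine ⟨s', _, .while_true (by simpa [Expr.eval, hv] using h0) (.seq e₁ e₂) he, ?_, h₁,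
        by omega, ?_⟩
      · have := (((Effect.refl o q D s).setReg (x := D) le_rfl (by omega) hq (v / 2)).setReg
          (x := D + 1) (by omega) (by omega) hq (s.reg (D + 1) + 1)).trans hE
        simpa using this
      · simp only [Expr.cost, Expr.eval, Op.eval, hv, r₁, Nat.size_one,
          show Nat.size 2 = 2 from rfl]
        have a₁ := size_le_self (s.reg (D + 1))
        have a₂ := size_le_self (s.reg (D + 1) + 1)
        have : (Nat.size v + 1) * (20 + 20 * X) =
          (Nat.size (v / 2) + 1) * (20 + 20 * X) + (20 + 20 * X) := by rw [hs]; ring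
        omega

/-- Induction on the generator. `Y` bounds the numbers of rounds and `X` the bit lengths; they are
separate because binding a value may lengthen the stored numbers without affecting the loop limits.
Accumulators have to be bounded by hypothesis: iterating a step such as squaring would produce
exponentially long numbers. -/
theorem Gen.compile_spec {o q : ℕ} (hq : numRegs ≤ q) (g : Gen) :
    ∀ D, D ≤ numRegs → g.ok o D → ∃ f : Polynomial ℕ, ∀ X Y s, Y ≤ X → s.Sized o D X →
      g.Bounded Y D s → Nat.size (s.reg q + (g.den D s).flatten.length) ≤ X →
      ∃ s' c, Exec (g.compile o q D) s s' c ∧ Effect o q D s s' (g.den D s).flatten ∧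
        c ≤ f.eval X := by
  induction g with
  | nil => exact fun D _ _ => ⟨1, fun X Y s _ _ _ _ => ⟨s, 1, .skip s, .refl _ _ _ _, by simp⟩⟩
  | emit es =>
    intro D hD hg
    obtain ⟨f, hf⟩ := emitProg_spec hD hq es (by simpa [ok] using hg)
    refine ⟨f, fun X Y s _ hs _ hl => ?_⟩
    obtain ⟨s', c, h₁, h₂, h₃⟩ := hf X s hs (by simpa [den] using hl)
    exact ⟨s', c, h₁, by simpa [den] using h₂, h₃⟩
  | seq g h ihg ihh =>
    intro D hD hgh
    simp only [ok, Bool.and_eq_true] at hgh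
    obtain ⟨f₁, hf₁⟩ := ihg D hD hgh.1
    obtain ⟨f₂, hf₂⟩ := ihh D hD hgh.2
    refine ⟨f₁ + f₂, fun X Y s hY hs hb hl => ?_⟩
    simp only [den, List.flatten_append, List.length_append] at hl ⊢
    obtain ⟨s₁, c₁, e₁, E₁, hc₁⟩ := hf₁ X Y s hY hs hb.1
      ((Nat.size_le_size (by omega)).trans hl)
    have hd := h.den_congr E₁.same hgh.2
    obtain ⟨s₂, c₂, e₂, E₂, hc₂⟩ := hf₂ X Y s₁ hY (hs.congr E₁.same)
      ((h.bounded_congr E₁.same hgh.2).2 hb.2) (by rw [E₁.ptr, hd, add_assoc]; exact hl)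
    refine ⟨s₂, _, .seq e₁ e₂, E₁.trans (hd ▸ E₂), ?_⟩
    rw [Polynomial.eval_add]; omega
  | guard b g ih =>
    intro D hD hg
    simp only [ok, Bool.and_eq_true] at hg
    obtain ⟨f, hf⟩ := ih D hD hg.2
    obtain ⟨fb, hfb⟩ := b.exists_bound o D hg.1
    refine ⟨f + fb + 2, fun X Y s hY hs hb hl => ?_⟩
    obtain ⟨_, hcb⟩ := hfb X s hs
    simp only [Polynomial.eval_add, Polynomial.eval_ofNat]
    by_cases h0 : b.eval s = 0
    · refine ⟨s, _, .ite_false h0 (.skip s), ?_, by omega⟩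
      simpa [den, h0] using Effect.refl o q D s
    · simp only [den, ne_eq, h0, not_false_eq_true, if_true] at hl ⊢
      obtain ⟨s', c, e, E, hc⟩ := hf X Y s hY hs (hb h0) hl
      exact ⟨s', _, .ite_true h0 e, E, by omega⟩
  | loop n g ih =>
    intro D hD hg
    simp only [ok, Bool.and_eq_true, decide_eq_true_eq] at hg
    obtain ⟨⟨hD', hn⟩, hg⟩ := hg
    obtain ⟨f, hf⟩ := ih (D + 2) hD' hg
    obtain ⟨fn, hfn⟩ := n.exists_bound o D hn
    refine ⟨fn + 10 + (.X + 1) * (20 + 10 * .X + f), fun X Y s hY hs hb hl => ?_⟩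
    obtain ⟨_, hcn⟩ := hfn X s hs
    obtain ⟨hNY, hb⟩ := hb
    set N := n.eval s with hN
    set L : ℕ → List (List ℕ) :=
      fun i => g.den (D + 2) ((s.setReg D N).setReg (D + 1) i) with hL
    have hden : (Gen.loop n g).den D s = (List.range N).flatMap L := rfl
    rw [hden] at hl ⊢
    set s₀ := (s.setReg D N).setReg (D + 1) 0 with hs₀
    have hsize : ∀ i ≤ N, Nat.size i ≤ X := fun i hi => (size_le_self i).trans (by omega)
    let Inv : ℕ → State → Prop := fun i t =>
      Effect o q D s t ((List.range i).flatMap L).flatten ∧ t.reg D = N ∧ t.reg (D + 1) = i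
    obtain ⟨s', c, e, hc, hI⟩ := Exec.while_count (N := N) (Tb := 4 + 2 * X)
      (T := f.eval X + 4 + 4 * X) (b := .op .lt (.reg (D + 1)) (.reg D))
      (p := .seq (g.compile o q (D + 2)) (.assign (D + 1) (.op .add (.reg (D + 1)) (.const 1))))
      Inv (by
        rintro i hi t ⟨hE, ht, ht'⟩
        have hsz := hsize i hi.le
        have hsz' := hsize (i + 1) hi
        have hszN := hsize N le_rfl
        refine ⟨by simp [Expr.eval, Op.eval, ht, ht', hi], ?_, ?_⟩
        · simp [Expr.cost, Expr.eval, Op.eval, ht, ht', hi]; omega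
        have hsame : ((s.setReg D N).setReg (D + 1) i).Same o (D + 2) t := by
          refine ⟨fun x hx => ?_, hE.same.2⟩
          rcases (by omega : x < D ∨ x = D ∨ x = D + 1) with h | rfl | rfl
          · simp [State.setReg, show x ≠ D by omega, show x ≠ D + 1 by omega, hE.same.1 x h]
          · simp [State.setReg, ht]
          · simp [State.setReg, ht']
        have hd := g.den_congr hsame hg
        have hsz₂ : ((s.setReg D N).setReg (D + 1) i).Sized o (D + 2) X :=
          (hs.setReg rfl hszN).setReg rfl hsz
        -- The output of the first `i + 1` rounds is no longer than that of all rounds, so the bound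
        -- on the final pointer also serves for round `i`.
        obtain ⟨t₁, c₁, e₁, E₁, hc₁⟩ := hf X Y t hY (hsz₂.congr hsame)
          ((g.bounded_congr hsame hg).2 (hb i hi)) (by
            refine le_trans (Nat.size_le_size ?_) hl
            have := length_flatten_flatMap_range_le L (Nat.succ_le_of_lt hi)
            rw [Nat.succ_eq_add_one, flatMap_range_succ, List.flatten_append,
              List.length_append] at this
            rw [hE.ptr, hd]
            simp only [hL] at this ⊢
            omega)
        have q₁ : t₁.reg D = N := (E₁.same.1 D (by omega)).trans ht
        have q₂ : t₁.reg (D + 1) = i := (E₁.same.1 (D + 1) (by omega)).trans ht'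
        refine ⟨t₁.setReg (D + 1) (i + 1), _, .seq e₁ (.assign_of (by simp [Expr.eval, Op.eval, q₂])),
          ?_, ?_, ?_, ?_⟩
        · simp only [Expr.cost, Expr.eval, Op.eval, q₂, Nat.size_one]; omega
        · rw [flatMap_range_succ, List.flatten_append]
          rw [hd] at E₁
          exact (hE.trans (E₁.mono (by omega))).setReg (by omega) (by omega) hq _
        · simp [State.setReg, q₁]
        · simp [State.setReg])
      (by
        rintro t ⟨hE, ht, ht'⟩
        have hszN := hsize N le_rfl
        refine ⟨by simp [Expr.eval, Op.eval, ht, ht'], ?_⟩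
        simp [Expr.cost, Expr.eval, Op.eval, ht, ht']; omega)
      s₀
      ⟨by
        have := (((Effect.refl o q D s).setReg (x := D) le_rfl (by omega) hq N).setReg
          (x := D + 1) (by omega) (by omega) hq 0)
        simpa using this, by simp [hs₀, State.setReg], by simp [hs₀, State.setReg]⟩
    refine ⟨s', _, .seq (.assign D n s) (.seq (.assign (D + 1) (.const 0) _) e), hI.1, ?_⟩
    simp only [Expr.cost, Nat.size_zero, Polynomial.eval_add, Polynomial.eval_mul,
      Polynomial.eval_ofNat, Polynomial.eval_X, Polynomial.eval_one]
    have : (N + 1) * (1 + (4 + 2 * X) + (f.eval X + 4 + 4 * X)) ≤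
        (X + 1) * (20 + 10 * X + f.eval X) := by
      apply Nat.mul_le_mul <;> omega
    omega
  | bind e g ih =>
    intro D hD hg
    simp only [ok, Bool.and_eq_true, decide_eq_true_eq] at hg
    obtain ⟨⟨hD', he⟩, hg⟩ := hg
    obtain ⟨f, hf⟩ := ih (D + 1) hD' hg
    obtain ⟨fe, hfe⟩ := e.exists_bound o D he
    -- The bound value may have `fe.eval X` bits, so the body runs under the size bound `X + fe.eval
    -- X`.
    refine ⟨f.comp (.X + fe) + fe + 1, fun X Y s hY hs hb hl => ?_⟩
    obtain ⟨hv, hce⟩ := hfe X s hs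
    have hq' : (s.setReg D (e.eval s)).reg q = s.reg q :=
      Function.update_of_ne (by omega) _ _
    obtain ⟨s', c, e', E, hc⟩ := hf (X + fe.eval X) Y (s.setReg D (e.eval s)) (by omega)
      ((hs.mono (by omega)).setReg rfl (by omega)) hb (by rw [hq']; simp only [den] at hl; omega)
    refine ⟨s', _, .seq (.assign D e s) e', ?_, ?_⟩
    · exact ((Effect.refl o q D s).setReg le_rfl (by omega) hq _).trans (E.mono (by omega))
    · simp only [Polynomial.eval_add, Polynomial.eval_comp, Polynomial.eval_X,
        Polynomial.eval_one]
      omega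
  | size e g ih =>
    intro D hD hg
    simp only [ok, Bool.and_eq_true, decide_eq_true_eq] at hg
    obtain ⟨⟨hD', he⟩, hg⟩ := hg
    obtain ⟨f, hf⟩ := ih (D + 2) hD' hg
    obtain ⟨fe, hfe⟩ := e.exists_bound o D he
    refine ⟨f.comp (.X + fe) + fe + 10 + (fe + 1) * (20 + 20 * fe), fun X Y s hY hs hb hl => ?_⟩
    obtain ⟨hv, hce⟩ := hfe X s hs
    set v := e.eval s with hvdef
    set s₁ := (s.setReg D v).setReg (D + 1) 0 with hs₁
    obtain ⟨s₂, c₂, e₂, E₂, h0, h1, hc₂⟩ := halve_spec (o := o) (q := q) (X := fe.eval X) hD' hq v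
      s₁ (by simp [hs₁, State.setReg]) (by simpa [hs₁, State.setReg] using hv)
    have h1 : s₂.reg (D + 1) = Nat.size v := by simpa [hs₁, State.setReg] using h1
    have E₀ : Effect o q D s s₁ [] := ((Effect.refl o q D s).setReg le_rfl (by omega) hq _).setReg
      (by omega) (by omega) hq _
    have E₁ : Effect o q D s s₂ [] := E₀.trans E₂
    -- The halving loop has consumed the value in register `D`; hence the `0` in the semantics of
    -- `size`.
    have hsame : ((s.setReg D 0).setReg (D + 1) (Nat.size v)).Same o (D + 2) s₂ := by
      refine ⟨fun x hx => ?_, E₁.same.2⟩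
      rcases (by omega : x < D ∨ x = D ∨ x = D + 1) with h | rfl | rfl
      · simp [State.setReg, show x ≠ D by omega, show x ≠ D + 1 by omega, E₁.same.1 x h]
      · simp [State.setReg, h0]
      · simp [State.setReg, h1]
    have hd := g.den_congr hsame hg
    have hq₂ := E₁.ptr
    simp only [den] at hl
    obtain ⟨s', c, e', E, hc⟩ := hf (X + fe.eval X) Y s₂ (by omega)
      (State.Sized.congr (((hs.mono (by omega)).setReg rfl (by simp)).setReg rfl
        ((size_le_self _).trans (by omega))) hsame)
      ((g.bounded_congr hsame hg).2 hb) (by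
        rw [hd, hq₂, List.length_nil, add_zero]; exact hl.trans (Nat.le_add_right _ _))
    refine ⟨s', _, .seq (.assign D e s) (.seq (.assign (D + 1) (.const 0) _) (.seq e₂ e')), ?_, ?_⟩
    · rw [hd] at E
      exact E₁.trans (E.mono (by omega))
    · simp only [Expr.cost, Nat.size_zero, Polynomial.eval_add, Polynomial.eval_mul,
        Polynomial.eval_ofNat, Polynomial.eval_X, Polynomial.eval_one, Polynomial.eval_comp]
      have : (Nat.size v + 1) * (20 + 20 * fe.eval X) ≤
        (fe.eval X + 1) * (20 + 20 * fe.eval X) := by gcongr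
      omega
  | fold n init step g ih =>
    intro D hD hg
    simp only [ok, Bool.and_eq_true, decide_eq_true_eq] at hg
    obtain ⟨⟨⟨⟨hD', hn⟩, hi⟩, hst⟩, hg⟩ := hg
    obtain ⟨f, hf⟩ := ih (D + 3) hD' hg
    obtain ⟨fn, hfn⟩ := n.exists_bound o D hn
    obtain ⟨fi, hfi⟩ := init.exists_bound o D hi
    obtain ⟨fs, hfs⟩ := step.exists_bound o (D + 3) hst
    refine ⟨f + fn + fi + 10 + (.X + 1) * (20 + 10 * .X + fs), fun X Y s hY hs hb hl => ?_⟩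
    obtain ⟨_, hcn⟩ := hfn X s hs
    obtain ⟨hNY, hacc, hb⟩ := hb
    set N := n.eval s with hN
    set A := foldAcc D s n init step with hA
    have hA0 : A 0 = init.eval s := rfl
    have hsize : ∀ i ≤ N, Nat.size i ≤ X := fun i hi => (size_le_self i).trans (by omega)
    set s₁ := (s.setReg D N).setReg (D + 1) 0 with hs₁
    have E₁ : Effect o q D s s₁ [] := ((Effect.refl o q D s).setReg le_rfl (by omega) hq _).setReg
      (by omega) (by omega) hq _
    have hcinit := (hfi X s₁ (hs.congr E₁.same)).2
    have hvinit := Expr.eval_congr E₁.same _ hi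
    set s₂ := s₁.setReg (D + 2) (A 0) with hs₂
    let Inv : ℕ → State → Prop := fun i t =>
      Effect o q D s t [] ∧ t.reg D = N ∧ t.reg (D + 1) = i ∧ t.reg (D + 2) = A i
    have hsame : ∀ i t, Inv i t →
        (((s.setReg D N).setReg (D + 1) i).setReg (D + 2) (A i)).Same o (D + 3) t := by
      rintro i t ⟨hE, h₁, h₂, h₃⟩
      refine ⟨fun x hx => ?_, hE.same.2⟩
      rcases (by omega : x < D ∨ x = D ∨ x = D + 1 ∨ x = D + 2) with h | rfl | rfl | rfl
      · simp [State.setReg, show x ≠ D by omega, show x ≠ D + 1 by omega,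
          show x ≠ D + 2 by omega, hE.same.1 x h]
      · simp [State.setReg, h₁]
      · simp [State.setReg, h₂]
      · simp [State.setReg, h₃]
    have hsz : ∀ i ≤ N,
        (((s.setReg D N).setReg (D + 1) i).setReg (D + 2) (A i)).Sized o (D + 3) X :=
      fun i hi => ((hs.setReg rfl (hsize N le_rfl)).setReg rfl (hsize i hi)).setReg rfl
        ((hacc i hi).trans hY)
    obtain ⟨s₃, c₃, e₃, hc₃, hI⟩ := Exec.while_count (N := N) (Tb := 4 + 2 * X)
      (T := fs.eval X + 5 + 4 * X) (b := .op .lt (.reg (D + 1)) (.reg D))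
      (p := .seq (.assign (D + 2) step)
        (.assign (D + 1) (.op .add (.reg (D + 1)) (.const 1))))
      Inv (by
        intro i hi t ht
        have hsame' := hsame i t ht
        obtain ⟨hE, h₁, h₂, h₃⟩ := ht
        have hsz₁ := hsize i hi.le
        have hsz₂ := hsize (i + 1) hi
        have hszN := hsize N le_rfl
        refine ⟨by simp [Expr.eval, Op.eval, h₁, h₂, hi], ?_, ?_⟩
        · simp [Expr.cost, Expr.eval, Op.eval, h₁, h₂, hi]; omega
        have hcs := (hfs X t ((hsz i hi.le).congr hsame')).2
        have h₂' : (t.setReg (D + 2) (A (i + 1))).reg (D + 1) = i := by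
          simp [State.setReg, h₂]
        have hvs : step.eval t = A (i + 1) := Expr.eval_congr hsame' _ hst
        refine ⟨(t.setReg (D + 2) (A (i + 1))).setReg (D + 1) (i + 1), _,
          .seq (.assign_of hvs) (.assign_of (by simp [Expr.eval, Op.eval, h₂'])), ?_, ?_, ?_, ?_, ?_⟩
        · simp only [Expr.cost, Expr.eval, Op.eval, h₂', Nat.size_one]; omega
        · exact (hE.setReg (by omega) (by omega) hq _).setReg (by omega) (by omega) hq _
        · simp [State.setReg, h₁]
        · simp [State.setReg]
        · simp [State.setReg])
      (by
        rintro t ⟨hE, h₁, h₂, -⟩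
        have hszN := hsize N le_rfl
        refine ⟨by simp [Expr.eval, Op.eval, h₁, h₂], ?_⟩
        simp [Expr.cost, Expr.eval, Op.eval, h₁, h₂]; omega)
      s₂
      ⟨E₁.setReg (by omega) (by omega) hq _, by simp [hs₂, hs₁, State.setReg],
        by simp [hs₂, hs₁, State.setReg], by simp [hs₂, State.setReg]⟩
    have hsame' := hsame N s₃ hI
    have hd := g.den_congr hsame' hg
    simp only [den] at hl
    obtain ⟨s', c, e', E, hc⟩ := hf X Y s₃ hY ((hsz N le_rfl).congr hsame')
      ((g.bounded_congr hsame' hg).2 hb) (by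
        rw [hd, hI.1.ptr, List.length_nil, add_zero]; exact hl)
    refine ⟨s', _, .seq (.assign D n s) (.seq (.assign (D + 1) (.const 0) _)
      (.seq (.assign_of hvinit) (.seq e₃ e'))), ?_, ?_⟩
    · rw [hd] at E
      exact hI.1.trans (E.mono (by omega))
    · simp only [Expr.cost, Nat.size_zero, Polynomial.eval_add, Polynomial.eval_mul,
        Polynomial.eval_ofNat, Polynomial.eval_X, Polynomial.eval_one]
      have : (N + 1) * (1 + (4 + 2 * X) + (fs.eval X + 5 + 4 * X)) ≤
          (X + 1) * (20 + 10 * X + fs.eval X) := by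
        apply Nat.mul_le_mul <;> omega
      have hcinit' : init.cost ((s.setReg D (n.eval s)).setReg (D + 1)
          (Expr.eval (s.setReg D (n.eval s)) (.const 0))) ≤ fi.eval X := hcinit
      omega

/-- The output of a generator is polynomially bounded in its loop limits. -/
theorem Gen.exists_length_le (g : Gen) : ∃ f : Polynomial ℕ, ∀ D Y s, g.Bounded Y D s →
    (g.den D s).flatten.length ≤ f.eval Y := by
  induction g with
  | nil => exact ⟨0, by simp [den]⟩
  | emit es => exact ⟨.C es.length, by simp [den]⟩
  | seq g h ihg ihh =>
    obtain ⟨f₁, hf₁⟩ := ihg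
    obtain ⟨f₂, hf₂⟩ := ihh
    refine ⟨f₁ + f₂, fun D Y s hb => ?_⟩
    rw [den, List.flatten_append, List.length_append, Polynomial.eval_add]
    exact Nat.add_le_add (hf₁ D Y s hb.1) (hf₂ D Y s hb.2)
  | guard b g ih =>
    obtain ⟨f, hf⟩ := ih
    refine ⟨f, fun D Y s hb => ?_⟩
    rw [den]
    split_ifs with h
    · exact hf D Y s (hb h)
    · simp
  | loop n g ih =>
    obtain ⟨f, hf⟩ := ih
    refine ⟨.X * f, fun D Y s hb => ?_⟩
    have key : ∀ i ≤ n.eval s, ((List.range i).flatMap fun i =>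
        g.den (D + 2) ((s.setReg D (n.eval s)).setReg (D + 1) i)).flatten.length
          ≤ i * f.eval Y := by
      intro i hi
      induction i with
      | zero => simp
      | succ i ih' =>
        rw [flatMap_range_succ, List.flatten_append, List.length_append, add_mul, one_mul]
        exact Nat.add_le_add (ih' (by omega)) (hf _ _ _ (hb.2 i (by omega)))
    rw [den, Polynomial.eval_mul, Polynomial.eval_X]
    exact (key _ le_rfl).trans (Nat.mul_le_mul_right _ hb.1)
  | bind e g ih => exact ih.imp fun f hf D Y s hb => hf _ _ _ hb
  | size e g ih => exact ih.imp fun f hf D Y s hb => hf _ _ _ hb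
  | fold n init step g ih => exact ih.imp fun f hf D Y s hb => hf _ _ _ hb.2.2

end RAM

/-! ### Nondeterministic straight-line programs on bits

An instruction is a list of 13 numbers: the register whose content is guessed, and then four
clauses with three literals each, which have to hold after the guess.  The literal `2 * r + b`
says that register `r` contains the bit `b`. -/

namespace BitProg

def LitTrue (ρ : ℕ → Bool) (l : ℕ) : Prop := ρ (l / 2) = decide (l % 2 = 1)

/-- Position `0` names the guessed register, and clause `a` occupies the three positions from `1 + 3
* a` on. -/
def InstrSat (ρ : ℕ → Bool) (w : List ℕ) : Prop :=
  ∀ a < 4, ∃ b < 3, LitTrue ρ (w.getD (1 + 3 * a + b) 0)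

/-- Some run of the program from `ρ` ends with registers that satisfy `P`. -/
def Run : List (List ℕ) → ((ℕ → Bool) → Prop) → (ℕ → Bool) → Prop
  | [], P, ρ => P ρ
  | w :: l, P, ρ => ∃ b, InstrSat (Function.update ρ (w.getD 0 0) b) w ∧
      Run l P (Function.update ρ (w.getD 0 0) b)

theorem run_append (l l' : List (List ℕ)) (P : (ℕ → Bool) → Prop) (ρ : ℕ → Bool) :
    Run (l ++ l') P ρ ↔ Run l (Run l' P) ρ := by
  induction l generalizing ρ with
  | nil => rfl
  | cons w l ih => simp [Run, ih]

/-- The instruction uses only registers below `S`. -/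
def Good (S : ℕ) (w : List ℕ) : Prop :=
  w.length = 13 ∧ w.getD 0 0 < S ∧ ∀ a < 4, ∀ b < 3, w.getD (1 + 3 * a + b) 0 / 2 < S

theorem getD_flatten {α : Type*} (d : α) {m : ℕ} : ∀ (l : List (List α)),
    (∀ w ∈ l, w.length = m) → ∀ i j, j < m → l.flatten.getD (m * i + j) d = (l.getD i []).getD j d
  | [], _, _, _, _ => by simp
  | w :: l, h, 0, j, hj => by
    have hw : w.length = m := h w (.head _)
    rw [List.flatten_cons, mul_zero, zero_add, List.getD_append _ _ _ _ (hw.symm ▸ hj)]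
    simp
  | w :: l, h, i + 1, j, hj => by
    have hw : w.length = m := h w (.head _)
    rw [List.flatten_cons, List.getD_append_right _ _ _ _ (by rw [hw]; nlinarith), hw,
      show m * (i + 1) + j - m = m * i + j by rw [mul_add, mul_one]; omega,
      getD_flatten d l (fun w' hw' => h w' (.tail _ hw')) i j hj]
    simp

/-! ### Translation to formulas -/

/-- The variable that stands for register `i` after `τ` instructions: a variable is introduced for
the initial content of each of the `S` registers, and one by each instruction. -/
def cur (S : ℕ) (code : ℕ → ℕ → ℕ) : ℕ → ℕ → ℕ
  | 0, i => if i < S then i else 0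
  | τ + 1, i => if code τ 0 = i then S + τ else cur S code τ i

variable {S : ℕ} {code : ℕ → ℕ → ℕ}

theorem cur_lt (hS : 0 < S) (τ i : ℕ) : cur S code τ i < S + τ := by
  induction τ with
  | zero => rw [cur]; split <;> omega
  | succ τ ih => rw [cur]; split <;> omega

/-- The variable introduced by an instruction is larger than all those in use before, so two
registers below `S` never share a variable. This makes the bags repetition-free. -/
theorem cur_injOn (hS : 0 < S) (τ : ℕ) {i j : ℕ} (hi : i < S) (hj : j < S)
    (h : cur S code τ i = cur S code τ j) : i = j := by
  induction τ with
  | zero => simpa [cur, hi, hj] using h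
  | succ τ ih =>
    have h₁ := cur_lt (code := code) hS τ i
    have h₂ := cur_lt (code := code) hS τ j
    rw [cur, cur] at h
    split_ifs at h with h₃ h₄ h₄
    · omega
    · omega
    · omega
    · exact ih h

/-- Guessing a bit into a register amounts to redirecting the register to a fresh variable. This
identity converts runs into assignments and back. -/
theorem update_cur (σ : ℕ → Bool) (τ : ℕ) :
    Function.update (fun i => σ (cur S code τ i)) (code τ 0) (σ (S + τ)) =
      fun i => σ (cur S code (τ + 1) i) := by
  funext i
  rw [Function.update_apply, cur]
  by_cases h : i = code τ 0
  · simp [h]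
  · simp [h, Ne.symm h]

abbrev codeOf (prog : List (List ℕ)) (τ a : ℕ) : ℕ := (prog.getD τ []).getD a 0

def SatAt (S : ℕ) (code : ℕ → ℕ → ℕ) (σ : ℕ → Bool) (τ : ℕ) : Prop :=
  ∀ a < 4, ∃ b < 3, LitTrue (fun i => σ (cur S code (τ + 1) i)) (code τ (1 + 3 * a + b))

theorem run_congr {prog : List (List ℕ)} (hp : ∀ w ∈ prog, Good S w) {ρ ρ' : ℕ → Bool}
    (h : ∀ i < S, ρ i = ρ' i) (hρ : Run prog (fun _ => True) ρ) :
    Run prog (fun _ => True) ρ' := by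
  induction prog generalizing ρ ρ' with
  | nil => trivial
  | cons w l ih =>
    obtain ⟨b, h₁, h₂⟩ := hρ
    have hu : ∀ i < S, Function.update ρ (w.getD 0 0) b i =
        Function.update ρ' (w.getD 0 0) b i := by
      intro i hi
      simp only [Function.update_apply]
      split <;> simp [h i hi]
    refine ⟨b, fun a ha => ?_, ih (fun w' hw' => hp w' (.tail _ hw')) hu h₂⟩
    obtain ⟨c, hc, hl⟩ := h₁ a ha
    refine ⟨c, hc, ?_⟩
    rw [LitTrue, ← hu _ ((hp w (.head _)).2.2 a ha c hc)]
    exact hl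

/-- An assignment lists the initial contents followed by the guesses. From a run, it is built one
instruction at a time, keeping all values below `S + τ`; conversely, the guess of instruction `τ` is
the value of variable `S + τ`. -/
theorem run_iff_satAt (hS : 0 < S) {prog : List (List ℕ)} (hp : ∀ w ∈ prog, Good S w) :
    (∃ ρ, Run prog (fun _ => True) ρ) ↔
      ∃ σ, ∀ τ < prog.length, SatAt S (codeOf prog) σ τ := by
  have hdrop : ∀ τ < prog.length, prog.drop τ = prog.getD τ [] :: prog.drop (τ + 1) := by
    intro τ hτ
    rw [List.drop_eq_getElem_cons hτ, List.getD_eq_getElem _ _ hτ]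
  constructor
  · rintro ⟨ρ, hρ⟩
    have key : ∀ k τ, τ + k = prog.length → ∀ σ₀ : ℕ → Bool,
        Run (prog.drop τ) (fun _ => True) (fun i => σ₀ (cur S (codeOf prog) τ i)) →
        ∃ σ, (∀ v < S + τ, σ v = σ₀ v) ∧
          ∀ τ', τ ≤ τ' → τ' < prog.length → SatAt S (codeOf prog) σ τ' := by
      intro k
      induction k with
      | zero => exact fun τ hτ σ₀ _ => ⟨σ₀, fun _ _ => rfl, fun τ' h h' => by omega⟩
      | succ k ih =>
        intro τ hτ σ₀ hrun
        rw [hdrop τ (by omega)] at hrun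
        obtain ⟨b, h₁, h₂⟩ := hrun
        have hu : Function.update (fun i => σ₀ (cur S (codeOf prog) τ i)) (codeOf prog τ 0) b =
            fun i => Function.update σ₀ (S + τ) b (cur S (codeOf prog) (τ + 1) i) := by
          rw [← update_cur]
          simp [Function.update_of_ne (cur_lt hS τ _).ne]
        rw [hu] at h₁ h₂
        obtain ⟨σ, h₃, h₄⟩ := ih (τ + 1) (by omega) _ h₂
        refine ⟨σ, fun v hv => ?_, fun τ' h h' => ?_⟩
        · rw [h₃ v (by omega), Function.update_of_ne (by omega)]
        · rcases h.eq_or_lt with rfl | h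
          · intro a ha
            obtain ⟨c, hc, hl⟩ := h₁ a ha
            refine ⟨c, hc, ?_⟩
            rw [LitTrue, h₃ _ (cur_lt hS _ _)]
            exact hl
          · exact h₄ τ' h h'
    -- Registers from `S` on are sent to variable `0`, so the initial memory is reproduced only
    -- below `S`; the program uses no other registers.
    obtain ⟨σ, -, hσ⟩ := key prog.length 0 (by simp) ρ
      (run_congr hp (fun i hi => by simp [cur, hi]) hρ)
    exact ⟨σ, fun τ hτ => hσ τ (by omega) hτ⟩
  · rintro ⟨σ, hσ⟩
    have key : ∀ k τ, τ + k = prog.length →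
        Run (prog.drop τ) (fun _ => True) (fun i => σ (cur S (codeOf prog) τ i)) := by
      intro k
      induction k with
      | zero =>
        intro τ hτ
        rw [List.drop_of_length_le (by omega)]
        trivial
      | succ k ih =>
        intro τ hτ
        rw [hdrop τ (by omega)]
        refine ⟨σ (S + τ), ?_, ?_⟩
        · exact (update_cur (S := S) (code := codeOf prog) σ τ) ▸ hσ τ (by omega)
        · exact (update_cur (S := S) (code := codeOf prog) σ τ) ▸ ih (τ + 1) (by omega)
    exact ⟨_, key prog.length 0 (by simp)⟩

section Instance

variable (T : ℕ)

/-- The variable that stands for register `i` after `τ` instructions, as an element of `Fin`. -/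
def curFin (hS : 0 < S) (code : ℕ → ℕ → ℕ) (τ : Fin (T + 1)) (i : ℕ) : Fin (S + T) :=
  ⟨cur S code τ i, by have := cur_lt (code := code) hS τ i; omega⟩

def clause (hS : 0 < S) (code : ℕ → ℕ → ℕ) (τ : Fin T) (a : ℕ) : Clause (S + T) :=
  (List.range 3).map fun b => (curFin T hS code τ.succ (code τ (1 + 3 * a + b) / 2),
    decide (code τ (1 + 3 * a + b) % 2 = 1))

def formula (hS : 0 < S) (code : ℕ → ℕ → ℕ) : CNF (S + T) :=
  (List.finRange T).flatMap fun τ => (List.range 4).map fun a => clause T hS code τ a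

def bag (hS : 0 < S) (code : ℕ → ℕ → ℕ) (τ : Fin (T + 1)) : List (Fin (S + T)) :=
  (List.range S).map fun i => curFin T hS code τ i

theorem mem_bag {hS : 0 < S} {τ : Fin (T + 1)} {v : Fin (S + T)} :
    v ∈ bag T hS code τ ↔ ∃ i < S, cur S code τ i = v := by
  simp [bag, curFin, Fin.ext_iff]

theorem mem_formula {hS : 0 < S} {C : Clause (S + T)} :
    C ∈ formula T hS code ↔ ∃ (τ : Fin T) (a : ℕ), a < 4 ∧ clause T hS code τ a = C := by
  simp [formula]

theorem fst_mem_clause {hS : 0 < S} {τ : Fin T} {a : ℕ} (ha : a < 4)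
    (hlit : ∀ τ < T, ∀ a < 4, ∀ b < 3, code τ (1 + 3 * a + b) / 2 < S) {v : Fin (S + T)}
    (hv : v ∈ (clause T hS code τ a).map Prod.fst) : v ∈ bag T hS code τ.succ := by
  simp only [clause, List.map_map, List.mem_map, List.mem_range, Function.comp_apply] at hv
  obtain ⟨b, hb, rfl⟩ := hv
  exact (mem_bag T).2 ⟨_, hlit τ τ.2 a ha b hb, rfl⟩

/-- Bag `τ` consists of the variables current after `τ` instructions. A variable is current during
an interval of time, and all clauses of instruction `τ` are evaluated after its guess, hence inside
bag `τ + 1`. -/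
theorem isPathDecomposition (hS : 0 < S) (hreg : ∀ τ < T, code τ 0 < S)
    (hlit : ∀ τ < T, ∀ a < 4, ∀ b < 3, code τ (1 + 3 * a + b) / 2 < S) :
    IsPathDecomposition (formula T hS code).primalGraph
      (((List.finRange (T + 1)).map (bag T hS code)).map List.toFinset) where
  vertex_mem v := by
    have : ∃ τ : Fin (T + 1), v ∈ bag T hS code τ := by
      rcases lt_or_ge v.1 S with h | h
      · exact ⟨0, (mem_bag T).2 ⟨v, h, by simp [cur, h]⟩⟩
      · have hT : v.1 - S < T := by omega
        -- Variable `S + τ` becomes current immediately after instruction `τ`, hence the index `τ +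
        -- 1`.
        refine ⟨⟨v - S + 1, by omega⟩, (mem_bag T).2 ⟨code (v - S) 0, hreg _ hT, ?_⟩⟩
        simp only [cur, if_true]
        omega
    obtain ⟨τ, hτ⟩ := this
    exact ⟨(bag T hS code τ).toFinset, by simp, by simpa using hτ⟩
  edge_mem u v huv := by
    obtain ⟨-, C, hC, hu, hv⟩ := huv
    obtain ⟨τ, a, ha, rfl⟩ := (mem_formula T).1 hC
    exact ⟨(bag T hS code τ.succ).toFinset, by simp,
      by simpa using fst_mem_clause T ha hlit hu, by simpa using fst_mem_clause T ha hlit hv⟩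
  interval v i j l hij hjl hi hl := by
    have hlen : (((List.finRange (T + 1)).map (bag T hS code)).map List.toFinset).length =
      T + 1 := by simp
    have hget : ∀ i : Fin (((List.finRange (T + 1)).map (bag T hS code)).map
        List.toFinset).length, v ∈ (((List.finRange (T + 1)).map (bag T hS code)).map
        List.toFinset).get i ↔ ∃ x < S, cur S code i x = v := by
      intro i
      rw [← mem_bag T (hS := hS) (τ := ⟨i, by omega⟩)]
      simp
    rw [hget] at hi hl ⊢
    obtain ⟨x, hx, hxv⟩ := hi
    have hv : v.1 < S + i := hxv ▸ cur_lt hS _ _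
    by_contra hcon
    push Not at hcon
    -- Variables entering after time `j` are at least `S + j`, whereas `v`, being current at time `i
    -- ≤ j`, is below `S + i`. So `v` cannot return.
    have key : ∀ τ, j.1 ≤ τ → ∀ x < S, cur S code τ x ≠ v := by
      intro τ hτ
      induction τ, hτ using Nat.le_induction with
      | base => exact hcon
      | succ τ hτ ih =>
        intro x hx
        rw [cur]
        have : i.1 ≤ j.1 := hij
        split
        · omega
        · exact ih x hx
    obtain ⟨y, hy, hyv⟩ := hl
    exact key l hjl y hy hyv

/-- The formula and the path decomposition that belong to a program of length `T`. -/
def pathInstance (hS : 0 < S) (hreg : ∀ τ < T, code τ 0 < S)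
    (hlit : ∀ τ < T, ∀ a < 4, ∀ b < 3, code τ (1 + 3 * a + b) / 2 < S) : PathSATInstance where
  n := S + T
  φ := formula T hS code
  arity_le C hC := by
    obtain ⟨τ, a, -, rfl⟩ := (mem_formula T).1 hC
    simp [clause]
  bags := (List.finRange (T + 1)).map (bag T hS code)
  nodup B hB := by
    simp only [List.mem_map, List.mem_finRange, true_and] at hB
    obtain ⟨τ, rfl⟩ := hB
    refine List.Nodup.map_on (fun i hi j hj h => ?_) List.nodup_range
    exact cur_injOn hS τ (List.mem_range.1 hi) (List.mem_range.1 hj) (Fin.ext_iff.1 h)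
  isPathDecomposition := isPathDecomposition T hS hreg hlit

variable (hS : 0 < S) (hreg : ∀ τ < T, code τ 0 < S)
    (hlit : ∀ τ < T, ∀ a < 4, ∀ b < 3, code τ (1 + 3 * a + b) / 2 < S)

theorem pathInstance_yes :
    (pathInstance T hS hreg hlit).Yes ↔ ∃ σ, ∀ τ < T, SatAt S code σ τ := by
  have key : ∀ σ : ℕ → Bool, ∀ τ : Fin T, (∀ a < 4, Clause.Sat (fun v : Fin (S + T) => σ v)
      (clause T hS code τ a)) ↔ SatAt S code σ τ := by
    intro σ τ
    simp [SatAt, LitTrue, Clause.Sat, clause, curFin]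
  constructor
  · rintro ⟨σ, hσ⟩
    refine ⟨fun v => if h : v < S + T then σ ⟨v, h⟩ else false, fun τ hτ => ?_⟩
    refine (key _ ⟨τ, hτ⟩).1 fun a ha => ?_
    have : Clause.Sat (n := S + T) σ (clause T hS code ⟨τ, hτ⟩ a) :=
      hσ _ ((mem_formula T).2 ⟨⟨τ, hτ⟩, a, ha, rfl⟩)
    have hσ' : (fun v : Fin (S + T) => if h : v.1 < S + T then σ ⟨v, h⟩ else false) = σ :=
      funext fun v => dif_pos v.2
    rwa [hσ']
  · rintro ⟨σ, hσ⟩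
    refine ⟨fun v => σ v, fun C hC => ?_⟩
    obtain ⟨τ, a, ha, rfl⟩ := (mem_formula T).1 hC
    exact (key σ τ).2 (hσ τ τ.2) a ha

/-- Bags have at most `S` elements. The subtracted one in the width is not exploited, as it matters
only for a constant factor. -/
theorem pathInstance_width_le : (pathInstance T hS hreg hlit).width ≤ S := by
  have key : ∀ l : List (Finset (Fin (S + T))), (∀ B ∈ l, B.card ≤ S) →
      (l.map Finset.card).foldr max 0 ≤ S := by
    intro l
    induction l with
    | nil => simp
    | cons B l ih => intro h; simp_all
  refine (Nat.sub_le _ _).trans (key _ fun B hB => ?_)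
  simp only [pathInstance, List.map_map, List.mem_map, List.mem_finRange, true_and,
    Function.comp_apply] at hB
  obtain ⟨τ, rfl⟩ := hB
  exact (List.toFinset_card_le _).trans (by simp [bag])

/-- The encoding of the instance that belongs to a program of length `T`. -/
def pathCode (S T : ℕ) (code : ℕ → ℕ → ℕ) : List ℕ :=
  [S + T, 4 * T] ++
  ((List.range T).flatMap fun τ => (List.range 4).flatMap fun a => 3 :: (List.range 3).map fun b =>
    2 * cur S code (τ + 1) (code τ (1 + 3 * a + b) / 2) + code τ (1 + 3 * a + b) % 2) ++
  [T + 1] ++ (List.range (T + 1)).flatMap fun τ => S :: (List.range S).map (cur S code τ)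

theorem flatMap_finRange {α : Type*} (n : ℕ) (f : ℕ → List α) :
    ((List.finRange n).flatMap fun i : Fin n => f i.val) = (List.range n).flatMap f := by
  rw [← List.map_coe_finRange_eq_range, List.flatMap_map]

theorem pathInstance_encode : (pathInstance T hS hreg hlit).encode = pathCode S T code := by
  have h₁ : (formula T hS code).length = 4 * T := by
    simp [formula, List.length_flatMap, mul_comm]
  have h₂ : ((formula T hS code).flatMap fun C =>
      C.length :: C.map fun l => 2 * l.1.val + l.2.toNat) =
      (List.range T).flatMap fun τ => (List.range 4).flatMap fun a =>
        3 :: (List.range 3).map fun b =>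
          2 * cur S code (τ + 1) (code τ (1 + 3 * a + b) / 2) + code τ (1 + 3 * a + b) % 2 := by
    rw [formula, List.flatMap_assoc, ← flatMap_finRange]
    congr 1; funext τ
    rw [List.flatMap_map]
    congr 1; funext a
    simp only [clause, List.length_map, List.length_range, List.map_map, List.cons.injEq,
      true_and, List.map_inj_left, Function.comp_apply, curFin, Fin.val_succ]
    intro b _
    rcases Nat.mod_two_eq_zero_or_one (code τ (1 + 3 * a + b)) with h | h <;> simp [h]
  have h₃ : (((List.finRange (T + 1)).map (bag T hS code)).flatMap fun B =>
      B.length :: B.map Fin.val) =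
      (List.range (T + 1)).flatMap fun τ => S :: (List.range S).map (cur S code τ) := by
    rw [List.flatMap_map, ← flatMap_finRange]
    congr 1; funext τ
    simp [bag, curFin, Function.comp_def]
  simp only [PathSATInstance.encode, CNF.encode, pathInstance, h₁, h₂, h₃, pathCode,
    List.length_map, List.length_finRange, List.cons_append, List.nil_append, List.append_assoc]

theorem length_pathCode (S T : ℕ) (code : ℕ → ℕ → ℕ) :
    (pathCode S T code).length = 3 + 16 * T + (T + 1) * (S + 1) := by
  simp [pathCode, List.length_flatMap]
  ring

end Instance

end BitProg

/-! ### A generator for the formula and path decomposition of a bit program -/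

namespace RAM

instance : Add Expr := ⟨.op .add⟩
instance : Sub Expr := ⟨.op .sub⟩
instance : Mul Expr := ⟨.op .mul⟩
instance : Div Expr := ⟨.op .div⟩
instance : Mod Expr := ⟨.op .mod⟩
instance (n : ℕ) : OfNat Expr n := ⟨.const n⟩

@[simp] theorem Expr.eval_add (s : State) (l r : Expr) : (l + r).eval s = l.eval s + r.eval s := rfl
@[simp] theorem Expr.eval_sub (s : State) (l r : Expr) : (l - r).eval s = l.eval s - r.eval s := rfl
@[simp] theorem Expr.eval_mul (s : State) (l r : Expr) : (l * r).eval s = l.eval s * r.eval s := rfl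
@[simp] theorem Expr.eval_div (s : State) (l r : Expr) : (l / r).eval s = l.eval s / r.eval s := rfl
@[simp] theorem Expr.eval_mod (s : State) (l r : Expr) : (l % r).eval s = l.eval s % r.eval s := rfl
@[simp] theorem Expr.eval_ofNat (s : State) (n : ℕ) : Expr.eval s (no_index (OfNat.ofNat n)) = n := rfl
@[simp] theorem Expr.eval_const (s : State) (n : ℕ) : Expr.eval s (.const n) = n := rfl
@[simp] theorem Expr.eval_reg (s : State) (x : ℕ) : Expr.eval s (.reg x) = s.reg x := rfl
@[simp] theorem Expr.eval_get (s : State) (a : ℕ) (i : Expr) :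
    Expr.eval s (.get a i) = s.arr a (i.eval s) := rfl
@[simp] theorem Expr.eval_eq (s : State) (l r : Expr) :
    Expr.eval s (.op .eq l r) = if l.eval s = r.eval s then 1 else 0 := rfl

@[simp] theorem State.setReg_arr (s : State) (x v : ℕ) : (s.setReg x v).arr = s.arr := rfl
theorem State.setReg_reg (s : State) (x v y : ℕ) :
    (s.setReg x v).reg y = if y = x then v else s.reg y := Function.update_apply ..

/-- Step of the fold that computes `BitProg.cur` for the register with number `x`; the number of
registers is in register `1`, the program in array `1`. -/
def curStep (D : ℕ) (x : Expr) : Expr :=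
  .op .eq (.get 1 (1 + 13 * .reg (D + 1))) x * (.reg 1 + .reg (D + 1)) +
    (1 - .op .eq (.get 1 (1 + 13 * .reg (D + 1))) x) * .reg (D + 2)

/-- Reads the number of registers and a program from array `1`, whose length is in register `0`,
and writes the path instance that belongs to it. -/
def assemble : Gen :=
  .bind (.get 1 0) <| .bind ((.reg 0 - 1) / 13) <|
  .seq (.emit [.reg 1 + .reg 2, 4 * .reg 2]) <|
  .seq (.loop (.reg 2) <| .loop 4 <| .seq (.emit [3]) <| .loop 3 <|
    .bind (.get 1 (1 + 13 * .reg 4 + (1 + 3 * .reg 6 + .reg 8))) <|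
    .fold (.reg 4 + 1) (.reg 9 / 2) (curStep 10 (.reg 9 / 2)) <|
    .emit [2 * .reg 12 + .reg 9 % 2]) <|
  .seq (.emit [.reg 2 + 1]) <|
  .loop (.reg 2 + 1) <| .seq (.emit [.reg 1]) <| .loop (.reg 1) <|
    .fold (.reg 4) (.reg 6) (curStep 7 (.reg 6)) <| .emit [.reg 9]

theorem assemble_ok : assemble.ok 2 1 = true := by decide

/-- The arithmetic of `curStep` is the case distinction in `BitProg.cur`, with the result of a
comparison as multiplier. Starting the fold at `x` is correct only for `x < S`. -/
theorem foldAcc_curStep {S T : ℕ} {code : ℕ → ℕ → ℕ} {D x : ℕ} {s : State} {n init X : Expr}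
    (hD : 2 ≤ D) (hS : s.reg 1 = S) (hcode : ∀ τ < T, ∀ a < 13, s.arr 1 (1 + 13 * τ + a) = code τ a)
    (hinit : init.eval s = x) (hx : x < S)
    (hX : ∀ i v, X.eval (((s.setReg D (n.eval s)).setReg (D + 1) i).setReg (D + 2) v) = x)
    {i : ℕ} (hi : i ≤ T) :
    foldAcc D s n init (curStep D X) i = BitProg.cur S code i x := by
  induction i with
  | zero => simp [foldAcc, hinit, BitProg.cur, hx]
  | succ i ih =>
    have h := hcode i (by omega) 0 (by omega)
    rw [foldAcc, ih (by omega), BitProg.cur]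
    simp only [add_zero] at h
    simp only [curStep, Expr.eval_add, Expr.eval_mul, Expr.eval_eq, Expr.eval_get,
      Expr.eval_ofNat, Expr.eval_reg, Expr.eval_sub, hX, State.setReg_reg, State.setReg_arr,
      if_true, h, show ¬ (1 = D + 2) by omega, show ¬ (1 = D + 1) by omega,
      show ¬ (1 = D) by omega, show ¬ (D + 1 = D + 2) by omega, if_false, hS]
    split_ifs <;> simp

theorem flatten_flatMap_range {α : Type*} (n : ℕ) (f : ℕ → List (List α)) :
    ((List.range n).flatMap f).flatten = (List.range n).flatMap fun i => (f i).flatten := by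
  induction n with
  | zero => rfl
  | succ n ih => rw [flatMap_range_succ, List.flatten_append, ih, flatMap_range_succ]

theorem flatMap_range_congr {α : Type*} {n : ℕ} {f g : ℕ → List α} (h : ∀ i < n, f i = g i) :
    (List.range n).flatMap f = (List.range n).flatMap g :=
  List.flatMap_congr fun i hi => h i (List.mem_range.1 hi)

theorem flatMap_range_singleton {α : Type*} (n : ℕ) (f : ℕ → α) :
    ((List.range n).flatMap fun i => [f i]) = (List.range n).map f :=
  (List.map_eq_flatMap ..).symm

/-- Register `0` and array `1` hold a program of length `T` on `S` registers. -/
structure Loaded (S T : ℕ) (code : ℕ → ℕ → ℕ) (s : State) : Prop where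
  length_eq : s.reg 0 = 1 + 13 * T
  regs_eq : s.arr 1 0 = S
  code_eq : ∀ τ < T, ∀ a < 13, s.arr 1 (1 + 13 * τ + a) = code τ a
  lit_lt : ∀ τ < T, ∀ a < 4, ∀ b < 3, code τ (1 + 3 * a + b) / 2 < S

theorem assemble_den {S T : ℕ} {code : ℕ → ℕ → ℕ} {s : State} (h : Loaded S T code s) :
    (assemble.den 1 s).flatten = BitProg.pathCode S T code := by
  obtain ⟨h0, hS, hcode, hlit⟩ := h
  have hT : (1 + 13 * T - 1) / 13 = T := by omega
  simp only [assemble, Gen.den, Nat.reduceAdd, Expr.eval_add, Expr.eval_mul, Expr.eval_get,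
    Expr.eval_ofNat, Expr.eval_reg, Expr.eval_sub, Expr.eval_div, Expr.eval_mod, State.setReg_reg,
    State.setReg_arr, h0, hT, hS, List.map_cons, List.map_nil, if_true, Nat.reduceEqDiff, if_false,
    OfNat.ofNat_ne_one, OfNat.one_ne_ofNat, zero_ne_one]
  simp only [List.flatten_append, flatten_flatMap_range, List.flatten_cons, List.flatten_nil,
    List.append_nil, BitProg.pathCode, List.append_assoc, List.singleton_append]
  congr 2
  · refine flatMap_range_congr fun τ hτ => flatMap_range_congr fun a ha => ?_
    rw [flatMap_range_singleton]
    congr 1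
    refine List.map_congr_left fun b hb => ?_
    have hb := List.mem_range.1 hb
    rw [hcode τ hτ _ (by omega), foldAcc_curStep (T := T) (by omega) _ _ _ (hlit τ hτ a ha b hb)]
    all_goals try simp [State.setReg_reg]
    · omega
    · exact hcode
  · congr 1
    refine flatMap_range_congr fun τ hτ => ?_
    rw [flatMap_range_singleton]
    congr 1
    refine List.map_congr_left fun i hi => ?_
    rw [foldAcc_curStep (T := T) (x := i) (by omega) _ _ _ (List.mem_range.1 hi)]
    all_goals try simp [State.setReg_reg]
    · omega
    · exact hcode

theorem assemble_bounded {S T Y : ℕ} {code : ℕ → ℕ → ℕ} {s : State} (h : Loaded S T code s)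
    (hY : S + T + 4 ≤ Y) : assemble.Bounded Y 1 s := by
  obtain ⟨h0, hS, hcode, hlit⟩ := h
  have hT : (1 + 13 * T - 1) / 13 = T := by omega
  have hcur : ∀ τ ≤ T, ∀ i < S, Nat.size (BitProg.cur S code τ i) ≤ Y := fun τ hτ i hi =>
    (size_le_self _).trans ((BitProg.cur_lt (by omega) τ i).le.trans (by omega))
  simp only [assemble, Gen.Bounded, Nat.reduceAdd, Expr.eval_add, Expr.eval_mul, Expr.eval_get,
    Expr.eval_ofNat, Expr.eval_reg, Expr.eval_sub, Expr.eval_div, State.setReg_reg,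
    State.setReg_arr, h0, hT, hS, if_true, true_and, and_true, Nat.reduceEqDiff, if_false,
    OfNat.ofNat_ne_one, OfNat.one_ne_ofNat, zero_ne_one]
  refine ⟨⟨by omega, fun τ hτ => ⟨by omega, fun a ha => ⟨by omega, fun b hb => ⟨by omega,
    fun i hi => ?_⟩⟩⟩⟩, by omega, fun τ hτ => ⟨by omega, fun x hx => ⟨by omega, fun i hi => ?_⟩⟩⟩
  · rw [hcode τ hτ _ (by omega), foldAcc_curStep (T := T) (by omega) _ _ _ (hlit τ hτ a ha b hb)]
    · exact hcur _ (by omega) _ (hlit τ hτ a ha b hb)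
    all_goals try simp [State.setReg_reg]
    · omega
    · exact hcode
  · rw [foldAcc_curStep (T := T) (x := x) (by omega) _ _ _ hx]
    · exact hcur _ (by omega) _ hx
    all_goals try simp [State.setReg_reg]
    · omega
    · exact hcode

end RAM

/-! ### From bit programs to running times -/

namespace RAM

theorem Expr.size_eval_le_cost (s : State) (e : Expr) : Nat.size (e.eval s) ≤ e.cost s := by
  cases e <;> simp only [eval, cost] <;> omega

/-- No value can be produced without paying for its bits. This bounds the cost of copying the answer
of the assumed algorithm to register `0`. -/
theorem Exec.size_reg_le {p : Prog} {s s' : State} {c : ℕ} (h : Exec p s s' c) (x : ℕ) :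
    Nat.size (s'.reg x) ≤ Nat.size (s.reg x) + c := by
  induction h with
  | skip => omega
  | assign y e s =>
    rw [State.setReg_reg]
    have := e.size_eval_le_cost s
    split <;> omega
  | store => exact Nat.le_add_right _ _
  | seq => omega
  | ite_true => omega
  | ite_false => omega
  | while_true => omega
  | while_false => omega

theorem exists_eval_le_pow (f : Polynomial ℕ) :
    ∃ K e : ℕ, ∀ Y, 0 < Y → f.eval Y ≤ K * Y ^ e := by
  refine ⟨∑ i ∈ Finset.range (f.natDegree + 1), f.coeff i, f.natDegree, fun Y hY => ?_⟩
  rw [Polynomial.eval_eq_sum_range, Finset.sum_mul]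
  refine Finset.sum_le_sum fun i hi => ?_
  have := Finset.mem_range.1 hi
  gcongr
  omega

/-- Each entry is a register below `S` or a literal over one. This bounds the bit lengths that the
second stage reads. -/
theorem _root_.BitProg.Good.mem_le {S : ℕ} {w : List ℕ} (h : BitProg.Good S w) {v : ℕ}
    (hv : v ∈ w) : v ≤ 2 * S := by
  obtain ⟨i, hi, rfl⟩ := List.getElem_of_mem hv
  rw [← List.getD_eq_getElem _ 0 hi]
  obtain ⟨h₁, h₂, h₃⟩ := h
  rcases Nat.eq_zero_or_pos i with rfl | hi0
  · omega
  · have := h₃ ((i - 1) / 3) (by omega) ((i - 1) % 3) (by omega)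
    rw [show 1 + 3 * ((i - 1) / 3) + (i - 1) % 3 = i by omega] at this
    omega

/-- On the input `w` the generator `g` emits a bit program on `S` registers that has a successful
run if and only if `yes` holds, and `Y` bounds the resources that this takes. -/
structure Generates (g : Gen) (w : List ℕ) (yes : Prop) (S Y : ℕ) : Prop where
  pos : 0 < S
  le : S ≤ Y
  length_le : Nat.size w.length ≤ Y
  entry_le : ∀ v ∈ w, Nat.size v ≤ Y
  bounded : g.Bounded Y 1 (init w)
  den : ∃ prog, g.den 1 (init w) = [S] :: prog ∧ (∀ v ∈ prog, BitProg.Good S v) ∧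
    (yes ↔ ∃ ρ, BitProg.Run prog (fun _ => True) ρ)

theorem length_flatten_of_good {S : ℕ} {prog : List (List ℕ)}
    (h : ∀ v ∈ prog, BitProg.Good S v) : prog.flatten.length = 13 * prog.length := by
  rw [List.length_flatten, List.map_congr_left fun v hv => (h v hv).1, List.map_const',
    List.sum_replicate]
  simp [mul_comm]

theorem writeAt_zero (l : List ℕ) (i : ℕ) : writeAt (fun _ => 0) 0 l i = l.getD i 0 := by
  simpa using writeAt_add (fun _ => 0) 0 l i

theorem size_getD_le {w : List ℕ} {X : ℕ} (h : ∀ v ∈ w, Nat.size v ≤ X) (i : ℕ) :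
    Nat.size (w.getD i 0) ≤ X := by
  rcases lt_or_ge i w.length with hi | hi
  · rw [List.getD_eq_getElem _ _ hi]
    exact h _ (List.getElem_mem hi)
  · rw [List.getD_eq_default _ _ hi]
    simp

theorem size_init_arr_le {w : List ℕ} {X : ℕ} (h : ∀ v ∈ w, Nat.size v ≤ X) (a i : ℕ) :
    Nat.size ((init w).arr a i) ≤ X := by
  simp only [init]
  split
  · exact size_getD_le h i
  · simp

/-- The program that runs the generator `g`, assembles a path instance, and runs `p` on it. -/
def pipeline (g : Gen) (p : Prog) : Prog :=
  .seq (g.compile 1 40 1) <| .seq (.assign 0 (.reg 40)) <| .seq (assemble.compile 2 41 1) <|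
    .seq (p.shift 41 2) (.assign 0 (.reg 41))

/-- Three stages are chained: write the bit program to array `1`, write its path instance to array
`2`, run `p` there. The first two are polynomial in `Y I`, and so is the length of the path
instance, while its width is at most `S I`; since `2 - ε ≥ 1`, the time of `p` is monotone in both.
-/
theorem exists_solves_of_generates {p : Prog} {ε : ℝ} {C c : ℕ} (hε : ε < 1)
    (hp : p.Solves PathSATInstance.encode PathSATInstance.Yes
      fun I => C * (2 - ε) ^ I.width * (I.encode.length : ℝ) ^ c)
    {g : Gen} (hg : g.ok 1 1) {Inst : Type} (encode : Inst → List ℕ) (yes : Inst → Prop)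
    (S Y : Inst → ℕ) (h : ∀ I, Generates g (encode I) (yes I) (S I) (Y I)) :
    ∃ (p' : Prog) (C' c' : ℕ), p'.Solves encode yes
      fun I => C' * (2 - ε) ^ S I * (Y I : ℝ) ^ c' := by
  obtain ⟨f₁, hf₁⟩ := g.compile_spec (o := 1) (q := 40) (by decide) 1 (by decide) hg
  obtain ⟨f₂, hf₂⟩ := assemble.compile_spec (o := 2) (q := 41) (by decide) 1 (by decide)
    assemble_ok
  obtain ⟨fL, hfL⟩ := g.exists_length_le
  -- `h₂` bounds what the second stage handles: entries up to `2 * S`, a program of length at most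
  -- `fL.eval Y`, and the resulting path instance. `Q` adds the costs of both stages and the copies;
  -- the factor `2` on the time of `p` pays for reading its answer.
  let h₂ : Polynomial ℕ := 2 * .X + fL + 10 + (3 + 16 * fL + (fL + 1) * (.X + 1))
  let Q : Polynomial ℕ := f₁.comp (.X + fL) + fL + f₂.comp h₂ + h₂ + 10 + 2 * .C C * h₂ ^ c
  obtain ⟨K, e, hK⟩ := exists_eval_le_pow Q
  refine ⟨pipeline g p, K, e, fun I => ?_⟩
  obtain ⟨hS0, hSY, hlen, hent, hb, prog, hden, hgood, hyes⟩ := h I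
  set w := encode I
  set S := S I
  set Y := Y I
  set T := prog.length with hT
  set l := ((g.den 1 (init w)).flatten) with hl
  have hl' : l = S :: prog.flatten := by rw [hl, hden]; rfl
  have hlT : l.length = 1 + 13 * T := by
    rw [hl', List.length_cons, length_flatten_of_good hgood, add_comm]
  have hlN : l.length ≤ fL.eval Y := hfL 1 Y _ hb
  set N := fL.eval Y with hN
  obtain ⟨s₁, c₁, e₁, E₁, hc₁⟩ := hf₁ (Y + N) Y (init w) (by omega)
    (by
      refine ⟨fun x hx => ?_, fun a _ i => ?_⟩
      · obtain rfl : x = 0 := by omega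
        exact hlen.trans (by omega)
      · exact (size_init_arr_le hent a i).trans (by omega))
    hb (by
      have : (init w).reg 40 = 0 := rfl
      rw [this, zero_add]
      exact (size_le_self _).trans (hlN.trans (Nat.le_add_left _ _)))
  have r₁ : s₁.reg 40 = 1 + 13 * T := by
    have : (init w).reg 40 = 0 := rfl
    rw [E₁.ptr, this, zero_add, ← hlT]
  have a₁ : ∀ i, s₁.arr 1 i = l.getD i 0 := by
    intro i
    rw [E₁.out, ← writeAt_zero]
    rfl
  set s₂ := s₁.setReg 0 (1 + 13 * T) with hs₂
  have e₂ : Exec (.assign 0 (.reg 40)) s₁ s₂ _ := .assign_of r₁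
  have hload : Loaded S T (BitProg.codeOf prog) s₂ := by
    refine ⟨by simp [hs₂, State.setReg_reg], ?_, fun τ hτ a ha => ?_, fun τ hτ a ha b hb => ?_⟩
    · rw [hs₂, State.setReg_arr, a₁, hl']; rfl
    · rw [hs₂, State.setReg_arr, a₁, hl', add_assoc, add_comm, List.getD_cons_succ,
        BitProg.getD_flatten 0 prog (fun w hw => (hgood w hw).1) τ a ha]
    · rw [BitProg.codeOf, List.getD_eq_getElem _ _ hτ]
      exact (hgood _ (List.getElem_mem hτ)).2.2 a ha b hb
  have hreg : ∀ τ < T, BitProg.codeOf prog τ 0 < S := by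
    intro τ hτ
    rw [BitProg.codeOf, List.getD_eq_getElem _ _ hτ]
    exact (hgood _ (List.getElem_mem hτ)).2.1
  have hcode := assemble_den hload
  have hX : h₂.eval Y = 2 * Y + N + 10 + (3 + 16 * N + (N + 1) * (Y + 1)) := by
    simp [h₂, hN]
  set X := h₂.eval Y with hXdef
  have hpl : (BitProg.pathCode S T (BitProg.codeOf prog)).length ≤ X := by
    rw [BitProg.length_pathCode, hX]
    have : (T + 1) * (S + 1) ≤ (N + 1) * (Y + 1) := Nat.mul_le_mul (by omega) (by omega)
    omega
  have z₂ : s₂.reg 41 = 0 := by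
    rw [hs₂, State.setReg_reg, if_neg (by omega), E₁.rest 41 (by decide) (by omega)]
    rfl
  obtain ⟨s₃, c₃, e₃, E₃, hc₃⟩ := hf₂ X X s₂ le_rfl
    (by
      refine ⟨fun x hx => ?_, fun a _ i => ?_⟩
      · obtain rfl : x = 0 := by omega
        rw [hload.length_eq]
        exact (size_le_self _).trans (by omega)
      · by_cases ha : a = 1
        · rw [ha, hs₂, State.setReg_arr, a₁]
          refine size_getD_le (fun v hm => ?_) i
          refine (size_le_self _).trans (le_trans ?_ (show 2 * S ≤ X by omega))
          rw [hl', List.mem_cons] at hm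
          rcases hm with rfl | hm
          · omega
          · obtain ⟨u, hu, hv⟩ := List.mem_flatten.1 hm
            exact (hgood u hu).mem_le hv
        · rw [hs₂, State.setReg_arr, E₁.same.2 a ha]
          exact (size_init_arr_le hent a i).trans (by omega))
    (assemble_bounded hload (by omega))
    (by rw [hcode, z₂, zero_add]; exact (size_le_self _).trans hpl)
  rw [hcode] at E₃
  let J := BitProg.pathInstance T hS0 hreg hload.lit_lt
  have hJ : J.encode = BitProg.pathCode S T (BitProg.codeOf prog) :=
    BitProg.pathInstance_encode T hS0 hreg hload.lit_lt
  -- The output pointer of the second stage is register `0` of the relocated algorithm, and array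
  -- `2` is its array `0`. The memory beyond is still zero.
  have hview : s₃.view 41 2 = init J.encode := by
    rw [hJ]
    simp only [State.view, init, State.mk.injEq]
    constructor
    · funext x
      by_cases hx : x = 0
      · rw [hx, zero_add, E₃.ptr, z₂, zero_add, if_pos rfl]
      · rw [if_neg hx, E₃.rest _ (Nat.le_add_left _ _ |>.trans' (by decide)) (by omega), hs₂,
          State.setReg_reg, if_neg (by omega),
          E₁.rest _ (Nat.le_add_left _ _ |>.trans' (by decide)) (by omega)]
        simp [init]
    · funext a i
      by_cases ha : a = 0
      · rw [ha, zero_add, E₃.out, z₂, hs₂, State.setReg_arr, E₁.same.2 2 (by omega), if_pos rfl,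
          ← writeAt_zero]
        rfl
      · rw [if_neg ha, E₃.same.2 _ (by omega), hs₂, State.setReg_arr, E₁.same.2 _ (by omega)]
        simp [init]
  obtain ⟨s', c', e', hc', hans⟩ := hp J
  obtain ⟨s₄, e₄, hv₄⟩ := e'.shift (r := 41) (a := 2) s₃ hview
  have r₄ : s₄.reg 41 = s'.reg 0 := by rw [← hv₄]; rfl
  have e₅ : Exec (.assign 0 (.reg 41)) s₄ _ _ := .assign_of r₄
  refine ⟨_, _, .seq e₁ (.seq e₂ (.seq e₃ (.seq e₄ e₅))), ?_, ?_⟩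
  · have hsz := e'.size_reg_le 0
    have hsz₀ : Nat.size ((init J.encode).reg 0) ≤ X := by
      have : (init J.encode).reg 0 = J.encode.length := rfl
      rw [this, hJ]
      exact (size_le_self _).trans hpl
    have hsz₁ : Nat.size (1 + 13 * T) ≤ N := (size_le_self _).trans (by omega)
    have hnat : c₁ + (1 + Expr.cost s₁ (.reg 40) + (c₃ + (c' + (1 + Expr.cost s₄ (.reg 41))))) ≤
        f₁.eval (Y + N) + N + f₂.eval X + X + 10 + 2 * c' := by
      simp only [Expr.cost, r₁, r₄]
      omega
    have hbase : (1 : ℝ) ≤ 2 - ε := by linarith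
    have hpow : (1 : ℝ) ≤ (2 - ε) ^ S := one_le_pow₀ hbase
    have hc'' : (c' : ℝ) ≤ C * (2 - ε) ^ S * (X : ℝ) ^ c := by
      refine hc'.trans ?_
      have h₁ : J.width ≤ S := BitProg.pathInstance_width_le T hS0 hreg hload.lit_lt
      have h₂ : (J.encode.length : ℝ) ≤ X := by rw [hJ]; exact_mod_cast hpl
      have h₃ : (2 - ε) ^ J.width ≤ (2 - ε) ^ S := pow_le_pow_right₀ hbase h₁
      have h₄ : (0 : ℝ) ≤ (2 - ε) ^ S := by linarith
      beta_reduce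
      gcongr
    have hQ : Q.eval Y =
        f₁.eval (Y + N) + N + f₂.eval X + X + 10 + 2 * C * X ^ c := by
      simp [Q, hN, hXdef]
    have hK' : ((Q.eval Y : ℕ) : ℝ) ≤ K * (Y : ℝ) ^ e := by
      exact_mod_cast hK Y (by omega)
    calc ((c₁ + (1 + Expr.cost s₁ (.reg 40) + (c₃ + (c' + (1 + Expr.cost s₄ (.reg 41))))) : ℕ) : ℝ)
        ≤ ((f₁.eval (Y + N) + N + f₂.eval X + X + 10 : ℕ) : ℝ) + 2 * c' := by exact_mod_cast hnat
      _ ≤ ((f₁.eval (Y + N) + N + f₂.eval X + X + 10 : ℕ) : ℝ) * (2 - ε) ^ S +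
          2 * (C * (2 - ε) ^ S * (X : ℝ) ^ c) := by
        exact add_le_add (le_mul_of_one_le_right (Nat.cast_nonneg _) hpow) (by linarith)
      _ = ((Q.eval Y : ℕ) : ℝ) * (2 - ε) ^ S := by
        rw [hQ]; push_cast; ring
      _ ≤ K * (Y : ℝ) ^ e * (2 - ε) ^ S := mul_le_mul_of_nonneg_right hK' (by linarith)
      _ = K * (2 - ε) ^ S * (Y : ℝ) ^ e := by ring
  · have h₁ : J.Yes ↔ _ := BitProg.pathInstance_yes T hS0 hreg hload.lit_lt
    rw [hyes, BitProg.run_iff_satAt hS0 hgood, ← h₁, ← hans]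
    simp [State.setReg_reg]

end RAM

namespace BitProg

/-! ### Instructions -/

/-- The instruction that guesses register `r` and has the given literals. -/
def ins {α : Type*} (r a₁ a₂ a₃ b₁ b₂ b₃ c₁ c₂ c₃ d₁ d₂ d₃ : α) : List α :=
  [r, a₁, a₂, a₃, b₁, b₂, b₃, c₁, c₂, c₃, d₁, d₂, d₃]

theorem forall_lt_four {p : ℕ → Prop} : (∀ a < 4, p a) ↔ p 0 ∧ p 1 ∧ p 2 ∧ p 3 := by
  constructor
  · exact fun h => ⟨h 0 (by omega), h 1 (by omega), h 2 (by omega), h 3 (by omega)⟩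
  · rintro ⟨h₀, h₁, h₂, h₃⟩ a ha
    interval_cases a <;> assumption

theorem exists_lt_three {p : ℕ → Prop} : (∃ b < 3, p b) ↔ p 0 ∨ p 1 ∨ p 2 := by
  constructor
  · rintro ⟨b, hb, h⟩
    interval_cases b <;> simp [h]
  · rintro (h | h | h)
    exacts [⟨0, by omega, h⟩, ⟨1, by omega, h⟩, ⟨2, by omega, h⟩]

theorem forall_lt_three {p : ℕ → Prop} : (∀ b < 3, p b) ↔ p 0 ∧ p 1 ∧ p 2 := by
  constructor
  · exact fun h => ⟨h 0 (by omega), h 1 (by omega), h 2 (by omega)⟩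
  · rintro ⟨h₀, h₁, h₂⟩ a ha
    interval_cases a <;> assumption

theorem instrSat_ins (ρ : ℕ → Bool) (r a₁ a₂ a₃ b₁ b₂ b₃ c₁ c₂ c₃ d₁ d₂ d₃ : ℕ) :
    InstrSat ρ (ins r a₁ a₂ a₃ b₁ b₂ b₃ c₁ c₂ c₃ d₁ d₂ d₃) ↔
      (LitTrue ρ a₁ ∨ LitTrue ρ a₂ ∨ LitTrue ρ a₃) ∧ (LitTrue ρ b₁ ∨ LitTrue ρ b₂ ∨ LitTrue ρ b₃) ∧
      (LitTrue ρ c₁ ∨ LitTrue ρ c₂ ∨ LitTrue ρ c₃) ∧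
      (LitTrue ρ d₁ ∨ LitTrue ρ d₂ ∨ LitTrue ρ d₃) := by
  simp [InstrSat, forall_lt_four, exists_lt_three, ins]

theorem good_ins {S r a₁ a₂ a₃ b₁ b₂ b₃ c₁ c₂ c₃ d₁ d₂ d₃ : ℕ} :
    Good S (ins r a₁ a₂ a₃ b₁ b₂ b₃ c₁ c₂ c₃ d₁ d₂ d₃) ↔ r < S ∧
      (a₁ / 2 < S ∧ a₂ / 2 < S ∧ a₃ / 2 < S) ∧ (b₁ / 2 < S ∧ b₂ / 2 < S ∧ b₃ / 2 < S) ∧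
      (c₁ / 2 < S ∧ c₂ / 2 < S ∧ c₃ / 2 < S) ∧ (d₁ / 2 < S ∧ d₂ / 2 < S ∧ d₃ / 2 < S) := by
  simp [Good, forall_lt_four, forall_lt_three, ins]

theorem litTrue_pos (ρ : ℕ → Bool) (r : ℕ) : LitTrue ρ (2 * r + 1) ↔ ρ r = true := by
  simp [LitTrue, show (2 * r + 1) / 2 = r by omega, show (2 * r + 1) % 2 = 1 by omega]

theorem litTrue_neg (ρ : ℕ → Bool) (r : ℕ) : LitTrue ρ (2 * r) ↔ ρ r = false := by
  simp [LitTrue]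

/-- The negation of a literal. -/
def negLit (l : ℕ) : ℕ := 2 * (l / 2) + (1 - l % 2)

theorem litTrue_negLit (ρ : ℕ → Bool) (l : ℕ) : LitTrue ρ (negLit l) ↔ ¬ LitTrue ρ l := by
  have h₁ : (2 * (l / 2) + (1 - l % 2)) / 2 = l / 2 := by omega
  have h₂ : (2 * (l / 2) + (1 - l % 2)) % 2 = 1 - l % 2 := by omega
  rw [LitTrue, LitTrue, negLit, h₁, h₂]
  rcases Nat.mod_two_eq_zero_or_one l with h | h <;> simp [h]

/-- Guess register `r`. -/
def free (r : ℕ) : List ℕ :=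
  ins r (2 * r) (2 * r + 1) (2 * r) (2 * r) (2 * r + 1) (2 * r) (2 * r) (2 * r + 1) (2 * r)
    (2 * r) (2 * r + 1) (2 * r)

/-- Guess register `r`, such that the literal `l` or the literal `l'` holds. -/
def assertOr (r l l' : ℕ) : List ℕ := ins r l l' l l l' l l l' l l l' l

/-- Copy register `p` to register `r`. -/
def copy (r p : ℕ) : List ℕ :=
  ins r (2 * r) (2 * p + 1) (2 * r) (2 * r + 1) (2 * p) (2 * r + 1)
    (2 * r) (2 * p + 1) (2 * r) (2 * r + 1) (2 * p) (2 * r + 1)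

/-- Exclusive disjunction. -/
def xorIns (r p c : ℕ) : List ℕ :=
  ins r (2 * r) (2 * p + 1) (2 * c + 1) (2 * r) (2 * p) (2 * c)
    (2 * r + 1) (2 * p) (2 * c + 1) (2 * r + 1) (2 * p + 1) (2 * c)

/-- Conjunction of `p` with the negation of `a`. -/
def andNot (r p a : ℕ) : List ℕ :=
  ins r (2 * r) (2 * p + 1) (2 * p + 1) (2 * r) (2 * a) (2 * a)
    (2 * r + 1) (2 * p) (2 * a + 1) (2 * r + 1) (2 * p) (2 * a + 1)

/-- Disjunction of register `p` and the literal `l`. -/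
def orLit (r p l : ℕ) : List ℕ :=
  ins r (2 * r) (2 * p + 1) l (2 * r + 1) (2 * p) (2 * p) (2 * r + 1) (negLit l) (negLit l)
    (2 * r + 1) (negLit l) (negLit l)

open Classical in
theorem run_of_forced {w : List ℕ} {l : List (List ℕ)} {P : (ℕ → Bool) → Prop} {ρ : ℕ → Bool}
    {r : ℕ} (v : Bool) (hr : w.getD 0 0 = r)
    (h : ∀ b, InstrSat (Function.update ρ r b) w ↔ b = v) :
    Run (w :: l) P ρ ↔ Run l P (Function.update ρ r v) := by
  simp only [Run, hr, h]
  simp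

theorem run_copy {r p : ℕ} (h : p ≠ r) (l : List (List ℕ)) (P : (ℕ → Bool) → Prop)
    (ρ : ℕ → Bool) : Run (copy r p :: l) P ρ ↔ Run l P (Function.update ρ r (ρ p)) := by
  refine run_of_forced _ rfl fun b => ?_
  simp only [copy, instrSat_ins, litTrue_pos, litTrue_neg, Function.update_self,
    Function.update_of_ne h]
  cases b <;> cases ρ p <;> simp

theorem run_xorIns {r p c : ℕ} (hp : p ≠ r) (hc : c ≠ r) (l : List (List ℕ))
    (P : (ℕ → Bool) → Prop) (ρ : ℕ → Bool) :
    Run (xorIns r p c :: l) P ρ ↔ Run l P (Function.update ρ r (ρ p ^^ ρ c)) := by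
  refine run_of_forced _ rfl fun b => ?_
  simp only [xorIns, instrSat_ins, litTrue_pos, litTrue_neg, Function.update_self,
    Function.update_of_ne hp, Function.update_of_ne hc]
  cases b <;> cases ρ p <;> cases ρ c <;> simp

theorem run_andNot {r p a : ℕ} (hp : p ≠ r) (ha : a ≠ r) (l : List (List ℕ))
    (P : (ℕ → Bool) → Prop) (ρ : ℕ → Bool) :
    Run (andNot r p a :: l) P ρ ↔ Run l P (Function.update ρ r (ρ p && !ρ a)) := by
  refine run_of_forced _ rfl fun b => ?_
  simp only [andNot, instrSat_ins, litTrue_pos, litTrue_neg, Function.update_self,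
    Function.update_of_ne hp, Function.update_of_ne ha]
  cases b <;> cases ρ p <;> cases ρ a <;> simp

theorem litTrue_update {ρ : ℕ → Bool} {r l : ℕ} {b : Bool} (h : l / 2 ≠ r) :
    LitTrue (Function.update ρ r b) l ↔ LitTrue ρ l := by
  rw [LitTrue, LitTrue, Function.update_of_ne h]

open Classical in
theorem run_orLit {r p l : ℕ} (hp : p ≠ r) (hl : l / 2 ≠ r) (k : List (List ℕ))
    (P : (ℕ → Bool) → Prop) (ρ : ℕ → Bool) :
    Run (orLit r p l :: k) P ρ ↔
      Run k P (Function.update ρ r (ρ p || decide (LitTrue ρ l))) := by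
  refine run_of_forced _ rfl fun b => ?_
  simp only [orLit, instrSat_ins, litTrue_pos, litTrue_neg, litTrue_negLit, Function.update_self,
    Function.update_of_ne hp, litTrue_update hl]
  by_cases h : LitTrue ρ l <;> cases b <;> cases ρ p <;> simp [h]

theorem run_assertOr {r l l' : ℕ} (k : List (List ℕ)) (P : (ℕ → Bool) → Prop) (ρ : ℕ → Bool) :
    Run (assertOr r l l' :: k) P ρ ↔ ∃ b, (LitTrue (Function.update ρ r b) l ∨
      LitTrue (Function.update ρ r b) l') ∧ Run k P (Function.update ρ r b) := by
  have : ∀ b, InstrSat (Function.update ρ r b) (assertOr r l l') ↔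
      (LitTrue (Function.update ρ r b) l ∨ LitTrue (Function.update ρ r b) l') := by
    intro b
    simp only [assertOr, instrSat_ins]
    tauto
  simp only [Run, ← this]
  rfl

theorem run_free {r : ℕ} (k : List (List ℕ)) (P : (ℕ → Bool) → Prop) (ρ : ℕ → Bool) :
    Run (free r :: k) P ρ ↔ ∃ b, Run k P (Function.update ρ r b) := by
  have : ∀ b, InstrSat (Function.update ρ r b) (free r) := by
    intro b
    simp only [free, instrSat_ins, litTrue_pos, litTrue_neg, Function.update_self]
    cases b <;> simp
  have h : (free r).getD 0 0 = r := rfl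
  simp only [Run, h, this, true_and]

/-! ### Blocks of instructions

Register `0` holds a choice, registers `1` and `2` are scratch, the next `B` registers are a
counter, and the remaining ones hold further data. -/

/-- Value of the counter. -/
def val (B : ℕ) (ρ : ℕ → Bool) : ℕ := ∑ b ∈ Finset.range B, (ρ (3 + b)).toNat * 2 ^ b

/-- A property of the choice, the counter and the data. -/
def Lift (B : ℕ) (Q : Bool → ℕ → (ℕ → Bool) → Prop) (ρ : ℕ → Bool) : Prop :=
  Q (ρ 0) (val B ρ) fun i => ρ (3 + B + i)

theorem val_lt (B : ℕ) (ρ : ℕ → Bool) : val B ρ < 2 ^ B := by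
  induction B with
  | zero => simp [val]
  | succ B ih =>
    rw [val, Finset.sum_range_succ, ← val, pow_succ]
    have := Bool.toNat_le (ρ (3 + B))
    nlinarith [pow_pos (show 0 < 2 by norm_num) B]

theorem val_congr {B : ℕ} {ρ ρ' : ℕ → Bool} (h : ∀ b < B, ρ (3 + b) = ρ' (3 + b)) :
    val B ρ = val B ρ' :=
  Finset.sum_congr rfl fun b hb => by rw [h b (Finset.mem_range.1 hb)]

theorem lift_congr {B : ℕ} {Q : Bool → ℕ → (ℕ → Bool) → Prop} {ρ ρ' : ℕ → Bool}
    (h : ∀ i, i ≠ 1 → i ≠ 2 → ρ i = ρ' i) : Lift B Q ρ ↔ Lift B Q ρ' := by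
  have h' : ∀ i, ρ (3 + B + i) = ρ' (3 + B + i) := fun i => h _ (by omega) (by omega)
  rw [Lift, Lift, h 0 (by omega) (by omega), val_congr fun b _ => h _ (by omega) (by omega)]
  simp only [h']

theorem val_update {B j : ℕ} (hj : j < B) (ρ : ℕ → Bool) (v : Bool) :
    val B (Function.update ρ (3 + j) v) + (ρ (3 + j)).toNat * 2 ^ j =
      val B ρ + v.toNat * 2 ^ j := by
  have hm := Finset.mem_range.2 hj
  rw [val, val, ← Finset.add_sum_erase _ _ hm, ← Finset.add_sum_erase _ _ hm,
    Function.update_self]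
  have : ∑ b ∈ (Finset.range B).erase j, (Function.update ρ (3 + j) v (3 + b)).toNat * 2 ^ b =
      ∑ b ∈ (Finset.range B).erase j, (ρ (3 + b)).toNat * 2 ^ b := by
    refine Finset.sum_congr rfl fun b hb => ?_
    rw [Function.update_of_ne]
    have := (Finset.mem_erase.1 hb).1
    omega
  omega

theorem val_update_of_le {B r : ℕ} (hr : r < 3 ∨ 3 + B ≤ r) (ρ : ℕ → Bool) (v : Bool) :
    val B (Function.update ρ r v) = val B ρ :=
  val_congr fun b hb => Function.update_of_ne (by omega) _ _

theorem run_flatMap_range_succ (f : ℕ → List (List ℕ)) (n : ℕ) (P : (ℕ → Bool) → Prop) :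
    Run ((List.range (n + 1)).flatMap f) P = Run ((List.range n).flatMap f) (Run (f n) P) := by
  funext ρ
  rw [RAM.flatMap_range_succ, run_append]

/-- Add the bit in register `1` to bit `j` of the counter, leaving the carry in register `1`. -/
def halfAdd (j : ℕ) : List (List ℕ) := [copy 2 (3 + j), xorIns (3 + j) 2 1, andNot 1 2 (3 + j)]

/-- Add the choice, multiplied by `2 ^ b`, to the counter. -/
def inc (B b : ℕ) : List (List ℕ) :=
  copy 1 0 :: ((List.range (B - b)).flatMap fun i => halfAdd (b + i)) ++ [assertOr 2 2 2]

def halfAddFun (j : ℕ) (ρ : ℕ → Bool) : ℕ → Bool :=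
  Function.update (Function.update (Function.update ρ 2 (ρ (3 + j))) (3 + j)
    (ρ (3 + j) ^^ ρ 1)) 1 (ρ (3 + j) && !(ρ (3 + j) ^^ ρ 1))

/-- The old bit is saved in register `2` first, because clauses only see the new content of the
guessed register. The new carry is "old bit and not new bit". -/
theorem run_halfAdd (j : ℕ) (P : (ℕ → Bool) → Prop) (ρ : ℕ → Bool) :
    Run (halfAdd j) P ρ ↔ P (halfAddFun j ρ) := by
  rw [halfAdd, run_copy (by omega), run_xorIns (by omega) (by omega),
    run_andNot (by omega) (by omega), Run, halfAddFun]
  simp [show 2 ≠ 3 + j by omega]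

theorem halfAddFun_of_ne {j i : ℕ} (h₁ : i ≠ 1) (h₂ : i ≠ 2) (hj : i ≠ 3 + j) (ρ : ℕ → Bool) :
    halfAddFun j ρ i = ρ i := by
  simp [halfAddFun, h₁, h₂, hj]

/-- Conservation law: the counter plus the pending carry, weighted by the position to which it
belongs, does not change. -/
theorem val_halfAddFun {B j : ℕ} (hj : j < B) (ρ : ℕ → Bool) :
    val B (halfAddFun j ρ) + (halfAddFun j ρ 1).toNat * 2 ^ (j + 1) =
      val B ρ + (ρ 1).toNat * 2 ^ j := by
  have h := val_update hj (Function.update ρ 2 (ρ (3 + j))) (ρ (3 + j) ^^ ρ 1)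
  rw [halfAddFun, val_update_of_le (r := 1) (by omega), Function.update_self, pow_succ]
  rw [val_update_of_le (r := 2) (by omega), Function.update_of_ne (by omega)] at h
  generalize 2 ^ j = m at *
  revert h
  cases ρ (3 + j) <;> cases ρ 1 <;> simp only [Bool.xor_false, Bool.xor_true, Bool.not_false,
    Bool.not_true, Bool.and_true, Bool.and_false, Bool.toNat_true, Bool.toNat_false] <;> omega

def carryFun (b : ℕ) (ρ : ℕ → Bool) : ℕ → ℕ → Bool
  | 0 => ρ
  | n + 1 => halfAddFun (b + n) (carryFun b ρ n)

theorem run_carry (b n : ℕ) (P : (ℕ → Bool) → Prop) (ρ : ℕ → Bool) :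
    Run ((List.range n).flatMap fun i => halfAdd (b + i)) P ρ ↔ P (carryFun b ρ n) := by
  induction n generalizing P with
  | zero => rfl
  | succ n ih => rw [run_flatMap_range_succ, ih, run_halfAdd, carryFun]

theorem carryFun_of_le {B b n i : ℕ} (hn : b + n ≤ B) (hi : i = 0 ∨ 3 + B ≤ i) (ρ : ℕ → Bool) :
    carryFun b ρ n i = ρ i := by
  induction n with
  | zero => rfl
  | succ n ih =>
    rw [carryFun, halfAddFun_of_ne (by omega) (by omega) (by omega), ih (by omega)]

theorem val_carryFun {B b n : ℕ} (hn : b + n ≤ B) (ρ : ℕ → Bool) :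
    val B (carryFun b ρ n) + (carryFun b ρ n 1).toNat * 2 ^ (b + n) =
      val B ρ + (ρ 1).toNat * 2 ^ b := by
  induction n with
  | zero => rfl
  | succ n ih => rw [carryFun, ← ih (by omega), ← add_assoc, val_halfAddFun (by omega)]

/-- By conservation, the sum overflows exactly if a carry leaves the last position. The final
instruction forbids this: literal `2` says that register `1` contains `0`, and register `2` is
guessed idly because every instruction has to guess something. -/
theorem run_inc {B b : ℕ} (hb : b ≤ B) (Q : Bool → ℕ → (ℕ → Bool) → Prop) :
    Run (inc B b) (Lift B Q) = Lift B fun x N u =>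
      N + x.toNat * 2 ^ b < 2 ^ B ∧ Q x (N + x.toNat * 2 ^ b) u := by
  funext ρ
  apply propext
  rw [inc, List.cons_append, run_copy (by omega), run_append, run_carry, run_assertOr]
  set ρ' := carryFun b (Function.update ρ 1 (ρ 0)) (B - b) with hρ'
  have h₁ := val_carryFun (B := B) (b := b) (n := B - b) (by omega) (Function.update ρ 1 (ρ 0))
  rw [← hρ', Function.update_self, val_update_of_le (by omega), show b + (B - b) = B by omega]
    at h₁
  have h₂ : ∀ i, i = 0 ∨ 3 + B ≤ i → ρ' i = ρ i := fun i hi => by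
    rw [hρ', carryFun_of_le (B := B) (by omega) hi, Function.update_of_ne (by omega)]
  have h₃ : ∀ v, Lift B Q (Function.update ρ' 2 v) ↔ Lift B Q ρ' := fun v =>
    lift_congr fun i _ hi => Function.update_of_ne hi _ _
  have h₄ : ∀ v, LitTrue (Function.update ρ' 2 v) 2 ↔ ρ' 1 = false := fun v => by
    rw [litTrue_update (by omega)]
    exact litTrue_neg ρ' 1
  simp only [Run, h₃, h₄, or_self, exists_const]
  have h₅ := val_lt B ρ'
  have h₆ : ∀ i, ρ' (3 + B + i) = ρ (3 + B + i) := fun i => h₂ _ (by omega)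
  rw [Lift, Lift, h₂ 0 (by omega)]
  simp only [h₆]
  cases h : ρ' 1
  · rw [h, Bool.toNat_false, zero_mul, add_zero] at h₁
    rw [← h₁]
    simp [h₅]
  · rw [h, Bool.toNat_true, one_mul] at h₁
    simp [← h₁]

theorem run_free_zero (B : ℕ) (Q : Bool → ℕ → (ℕ → Bool) → Prop) :
    Run [free 0] (Lift B Q) = Lift B fun _ N u => ∃ x, Q x N u := by
  funext ρ
  apply propext
  rw [run_free]
  refine exists_congr fun x => ?_
  have hne : ∀ i, Function.update ρ 0 x (3 + B + i) = ρ (3 + B + i) := fun i =>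
    Function.update_of_ne (by omega) _ _
  rw [Run, Lift, Function.update_self, val_update_of_le (by omega)]
  simp only [hne]

theorem run_assertOr_zero (B i : ℕ) (Q : Bool → ℕ → (ℕ → Bool) → Prop) :
    Run [assertOr 0 1 (2 * (3 + B + i) + 1)] (Lift B Q) = Lift B fun _ N u =>
      ∃ x, (x = true ∨ u i = true) ∧ Q x N u := by
  funext ρ
  apply propext
  rw [run_assertOr]
  refine exists_congr fun x => ?_
  have h : LitTrue (Function.update ρ 0 x) 1 ↔ x = true := by
    simpa using litTrue_pos (Function.update ρ 0 x) 0
  have hne : ∀ i, Function.update ρ 0 x (3 + B + i) = ρ (3 + B + i) := fun i =>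
    Function.update_of_ne (by omega) _ _
  rw [Run, Lift, Function.update_self, val_update_of_le (by omega), litTrue_pos, h]
  simp only [hne]

theorem run_assert (B i : ℕ) (Q : Bool → ℕ → (ℕ → Bool) → Prop) :
    Run [assertOr 2 (2 * (3 + B + i) + 1) (2 * (3 + B + i) + 1)] (Lift B Q) = Lift B fun x N u =>
      u i = true ∧ Q x N u := by
  funext ρ
  apply propext
  rw [run_assertOr]
  have h₃ : ∀ v, Lift B Q (Function.update ρ 2 v) ↔ Lift B Q ρ := fun v =>
    lift_congr fun i _ hi => Function.update_of_ne hi _ _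
  simp only [Run, h₃, litTrue_pos, Function.update_of_ne (show 3 + B + i ≠ 2 by omega), or_self,
    exists_const]
  rfl

theorem lift_update (B i : ℕ) (Q : Bool → ℕ → (ℕ → Bool) → Prop) (ρ : ℕ → Bool) (v : Bool) :
    Lift B Q (Function.update ρ (3 + B + i) v) ↔
      Lift B (fun x N u => Q x N (Function.update u i v)) ρ := by
  rw [Lift, Lift, Function.update_of_ne (by omega), val_update_of_le (by omega)]
  have : (fun j => Function.update ρ (3 + B + i) v (3 + B + j)) =
      Function.update (fun j => ρ (3 + B + j)) i v := by
    funext j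
    simp [Function.update_apply]
  rw [this]

theorem run_setFalse (B i : ℕ) (Q : Bool → ℕ → (ℕ → Bool) → Prop) :
    Run [assertOr (3 + B + i) (2 * (3 + B + i)) (2 * (3 + B + i))] (Lift B Q) =
      Lift B fun x N u => Q x N (Function.update u i false) := by
  funext ρ
  apply propext
  rw [run_assertOr]
  simp only [litTrue_neg, Function.update_self, or_self, exists_eq_left, Run, lift_update]

/-- Disjunction of the data bit `i` and the literal `l`. -/
def orInto (B i l : ℕ) : List (List ℕ) := [copy 2 (3 + B + i), orLit (3 + B + i) 2 l]

open Classical in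
-- The data bit passes through register `2`, since an instruction cannot read the old content of its
-- own target; the literal must therefore avoid both registers.
theorem run_orInto {B i l : ℕ} (h₂ : l / 2 ≠ 2) (hl : l / 2 ≠ 3 + B + i)
    (Q : Bool → ℕ → (ℕ → Bool) → Prop) (ρ : ℕ → Bool) :
    Run (orInto B i l) (Lift B Q) ρ ↔ Lift B (fun x N u =>
      Q x N (Function.update u i (u i || decide (LitTrue ρ l)))) ρ := by
  rw [orInto, run_copy (by omega), run_orLit (by omega) hl, Run, lift_update,
    Function.update_self, litTrue_update h₂]
  rw [lift_congr (ρ' := ρ) fun i _ hi => Function.update_of_ne hi _ _]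
  rfl

theorem run_orInto_zero (B i : ℕ) (Q : Bool → ℕ → (ℕ → Bool) → Prop) :
    Run (orInto B i 1) (Lift B Q) = Lift B fun x N u =>
      Q x N (Function.update u i (u i || x)) := by
  funext ρ
  apply propext
  rw [run_orInto (by omega) (by omega)]
  have h : LitTrue ρ 1 ↔ ρ 0 = true := litTrue_pos ρ 0
  simp only [h, Lift]
  simp

theorem run_orInto_data {B i v s : ℕ} (hs : s < 2) (hv : v ≠ i)
    (Q : Bool → ℕ → (ℕ → Bool) → Prop) :
    Run (orInto B i (2 * (3 + B + v) + s)) (Lift B Q) = Lift B fun x N u =>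
      Q x N (Function.update u i (u i || decide (u v = decide (s = 1)))) := by
  funext ρ
  apply propext
  rw [run_orInto (by omega) (by omega)]
  have h : LitTrue ρ (2 * (3 + B + v) + s) ↔ ρ (3 + B + v) = decide (s = 1) := by
    rw [LitTrue, show (2 * (3 + B + v) + s) / 2 = 3 + B + v by omega,
      show (2 * (3 + B + v) + s) % 2 = s by omega]
  simp only [h, Lift]

end BitProg

namespace BitProg

/-! ### Initial and final values of the counter -/

theorem run_append' (l l' : List (List ℕ)) (P : (ℕ → Bool) → Prop) :
    Run (l ++ l') P = Run l (Run l' P) :=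
  funext fun ρ => propext (run_append l l' P ρ)

theorem sum_bits (T B : ℕ) : ∑ b ∈ Finset.range B, T / 2 ^ b % 2 * 2 ^ b = T % 2 ^ B := by
  induction B with
  | zero => simp [Nat.mod_one]
  | succ B ih => rw [Finset.sum_range_succ, ih, Nat.mod_pow_succ, mul_comm]

theorem sum_two_pow (B : ℕ) : ∑ b ∈ Finset.range B, 2 ^ b = 2 ^ B - 1 := by
  have := Nat.geomSum_eq (le_refl 2) B
  simpa using this

/-- Set the counter to `2 ^ B - 1 - T`. -/
def initCounter (B T : ℕ) : List (List ℕ) := (List.range B).flatMap fun b =>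
  [assertOr (3 + b) (2 * (3 + b) + (1 - T / 2 ^ b % 2)) (2 * (3 + b) + (1 - T / 2 ^ b % 2))]

def initCounterFun (T : ℕ) (ρ : ℕ → Bool) : ℕ → ℕ → Bool
  | 0 => ρ
  | n + 1 => Function.update (initCounterFun T ρ n) (3 + n) (decide (1 - T / 2 ^ n % 2 = 1))

theorem initCounterFun_of_lt (T : ℕ) (ρ : ℕ → Bool) {n b : ℕ} (hb : b < n) :
    initCounterFun T ρ n (3 + b) = decide (1 - T / 2 ^ b % 2 = 1) := by
  induction n with
  | zero => omega
  | succ n ih =>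
    rw [initCounterFun, Function.update_apply]
    split_ifs with h
    · obtain rfl : b = n := by omega
      rfl
    · exact ih (by omega)

theorem initCounterFun_of_ne (T : ℕ) (ρ : ℕ → Bool) {n i : ℕ} (hi : i < 3 ∨ 3 + n ≤ i) :
    initCounterFun T ρ n i = ρ i := by
  induction n with
  | zero => rfl
  | succ n ih => rw [initCounterFun, Function.update_of_ne (by omega), ih (by omega)]

/-- Every counter bit is set to the complement of the corresponding bit of `T`, and complementary
numbers add up to `2 ^ B - 1`. -/
theorem run_initCounter {B T : ℕ} (hT : T < 2 ^ B) (Q : Bool → ℕ → (ℕ → Bool) → Prop) :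
    Run (initCounter B T) (Lift B Q) = Lift B fun x _ u => Q x (2 ^ B - 1 - T) u := by
  have key : ∀ n P ρ, Run ((List.range n).flatMap fun b =>
      [assertOr (3 + b) (2 * (3 + b) + (1 - T / 2 ^ b % 2)) (2 * (3 + b) + (1 - T / 2 ^ b % 2))])
      P ρ ↔ P (initCounterFun T ρ n) := by
    intro n
    induction n with
    | zero => exact fun P ρ => Iff.rfl
    | succ n ih =>
      intro P ρ
      rw [run_flatMap_range_succ, ih, run_assertOr, initCounterFun]
      have h : ∀ v ρ', LitTrue (Function.update ρ' (3 + n) v)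
          (2 * (3 + n) + (1 - T / 2 ^ n % 2)) ↔ v = decide (1 - T / 2 ^ n % 2 = 1) := by
        intro v ρ'
        rw [LitTrue, show (2 * (3 + n) + (1 - T / 2 ^ n % 2)) / 2 = 3 + n by omega,
          show (2 * (3 + n) + (1 - T / 2 ^ n % 2)) % 2 = 1 - T / 2 ^ n % 2 by omega,
          Function.update_self]
      simp only [h, or_self, exists_eq_left, Run]
  funext ρ
  apply propext
  rw [initCounter, key, Lift, Lift, initCounterFun_of_ne T ρ (by omega)]
  have h₁ : ∀ i, initCounterFun T ρ B (3 + B + i) = ρ (3 + B + i) := fun i =>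
    initCounterFun_of_ne T ρ (by omega)
  have h₂ : val B (initCounterFun T ρ B) + T = 2 ^ B - 1 := by
    have h₃ := sum_bits T B
    rw [Nat.mod_eq_of_lt hT] at h₃
    have h₄ : val B (initCounterFun T ρ B) + ∑ b ∈ Finset.range B, T / 2 ^ b % 2 * 2 ^ b =
        2 ^ B - 1 := by
      rw [val, ← sum_two_pow, ← Finset.sum_add_distrib]
      refine Finset.sum_congr rfl fun b hb => ?_
      rw [initCounterFun_of_lt T ρ (Finset.mem_range.1 hb)]
      rcases Nat.mod_two_eq_zero_or_one (T / 2 ^ b) with h | h <;> simp [h]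
    rwa [h₃] at h₄
  rw [show val B (initCounterFun T ρ B) = 2 ^ B - 1 - T by omega]
  simp only [h₁]

/-- Check that the value of the counter is `2 ^ B - 1`. -/
def allOnes (B : ℕ) : List (List ℕ) :=
  (List.range B).flatMap fun b => [assertOr 2 (2 * (3 + b) + 1) (2 * (3 + b) + 1)]

theorem run_allOnes (B : ℕ) :
    Run (allOnes B) (fun _ => True) = Lift B fun _ N _ => N = 2 ^ B - 1 := by
  -- Each check guesses register `2` idly, so the postcondition has to be indifferent to it.
  have key : ∀ n (R : (ℕ → Bool) → Prop), (∀ ρ v, R (Function.update ρ 2 v) ↔ R ρ) → ∀ ρ,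
      Run ((List.range n).flatMap fun b => [assertOr 2 (2 * (3 + b) + 1) (2 * (3 + b) + 1)]) R ρ ↔
        (∀ b < n, ρ (3 + b) = true) ∧ R ρ := by
    intro n
    induction n with
    | zero => simp [Run]
    | succ n ih =>
      intro R hR ρ
      have h : Run [assertOr 2 (2 * (3 + n) + 1) (2 * (3 + n) + 1)] R =
          fun ρ => ρ (3 + n) = true ∧ R ρ := by
        funext ρ
        apply propext
        rw [run_assertOr]
        simp only [litTrue_pos, Function.update_of_ne (show 3 + n ≠ 2 by omega), or_self, Run, hR,
          exists_const]
      rw [run_flatMap_range_succ, h, ih]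
      · rw [← and_assoc]
        refine and_congr_left fun _ => ?_
        constructor
        · rintro ⟨h₁, h₂⟩ b hb
          rcases Nat.lt_succ_iff_lt_or_eq.1 hb with hb | rfl
          exacts [h₁ b hb, h₂]
        · exact fun h => ⟨fun b hb => h b (by omega), h n (by omega)⟩
      · intro ρ v
        rw [hR, Function.update_of_ne (by omega)]
  funext ρ
  apply propext
  rw [allOnes, key _ _ (by simp), and_true, Lift]
  have h₁ : val B ρ + ∑ b ∈ Finset.range B, (!ρ (3 + b)).toNat * 2 ^ b = 2 ^ B - 1 := by
    rw [val, ← Finset.sum_add_distrib, ← sum_two_pow]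
    refine Finset.sum_congr rfl fun b _ => ?_
    cases ρ (3 + b) <;> simp
  rw [show val B ρ = 2 ^ B - 1 ↔ ∑ b ∈ Finset.range B, (!ρ (3 + b)).toNat * 2 ^ b = 0 by omega]
  simp

theorem lift_true (B : ℕ) : Lift B (fun _ _ _ => True) = fun _ => True := rfl

/-! ### Sequences of choices -/

def iterU (F : ℕ → Bool → (ℕ → Bool) → ℕ → Bool) (xs : ℕ → Bool) (u : ℕ → Bool) : ℕ → ℕ → Bool
  | 0 => u
  | j + 1 => F j (xs j) (iterU F xs u j)

theorem iterU_congr {F : ℕ → Bool → (ℕ → Bool) → ℕ → Bool} {xs xs' u : ℕ → Bool} {n : ℕ}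
    (h : ∀ j < n, xs j = xs' j) : iterU F xs u n = iterU F xs' u n := by
  induction n with
  | zero => rfl
  | succ n ih => rw [iterU, iterU, ih fun j hj => h j (by omega), h n (by omega)]

/-- Successive existential choices are gathered into one sequence `xs`: the choice made by item `n`
is inserted at place `n`, which affects neither the earlier sums nor the earlier data. -/
theorem run_items {B n : ℕ} {f : ℕ → List (List ℕ)} {ok : ℕ → Bool → (ℕ → Bool) → Prop}
    {w : ℕ → Bool → ℕ} {F : ℕ → Bool → (ℕ → Bool) → ℕ → Bool}
    (h : ∀ j < n, ∀ Q : ℕ → (ℕ → Bool) → Prop, Run (f j) (Lift B fun _ => Q) =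
      Lift B fun _ N u => ∃ x, ok j x u ∧ N + w j x < 2 ^ B ∧ Q (N + w j x) (F j x u))
    (Q : ℕ → (ℕ → Bool) → Prop) :
    Run ((List.range n).flatMap f) (Lift B fun _ => Q) = Lift B fun _ N u => ∃ xs : ℕ → Bool,
      (∀ j < n, ok j (xs j) (iterU F xs u j)) ∧
      (∀ j < n, N + ∑ i ∈ Finset.range (j + 1), w i (xs i) < 2 ^ B) ∧
      Q (N + ∑ i ∈ Finset.range n, w i (xs i)) (iterU F xs u n) := by
  induction n generalizing Q with
  | zero => simp [Run, iterU, Lift]; rfl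
  | succ n ih =>
    rw [run_flatMap_range_succ, h n (by omega), ih fun j hj => h j (by omega)]
    congr 1
    funext _ N u
    apply propext
    constructor
    · rintro ⟨xs, h₁, h₂, x, h₃, h₄, h₅⟩
      have hx : ∀ j < n, xs j = Function.update xs n x j := fun j hj =>
        (Function.update_of_ne (by omega) _ _).symm
      have hs : ∀ j ≤ n, ∑ i ∈ Finset.range j, w i (xs i) =
          ∑ i ∈ Finset.range j, w i (Function.update xs n x i) := fun j hj =>
        Finset.sum_congr rfl fun i hi => by rw [hx i (by have := Finset.mem_range.1 hi; omega)]
      have hu : ∀ j ≤ n, iterU F xs u j = iterU F (Function.update xs n x) u j := fun j hj =>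
        iterU_congr fun i hi => hx i (by omega)
      rw [hs n le_rfl, hu n le_rfl] at h₅
      rw [hu n le_rfl] at h₃
      rw [hs n le_rfl] at h₄
      refine ⟨Function.update xs n x, fun j hj => ?_, fun j hj => ?_, ?_⟩
      · rcases Nat.lt_succ_iff_lt_or_eq.1 hj with hj | rfl
        · rw [← hx j hj, ← hu j hj.le]
          exact h₁ j hj
        · rwa [Function.update_self]
      · rcases Nat.lt_succ_iff_lt_or_eq.1 hj with hj | rfl
        · rw [← hs (j + 1) hj]
          exact h₂ j hj
        · rwa [Finset.sum_range_succ, Function.update_self, ← add_assoc]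
      · rwa [Finset.sum_range_succ, Function.update_self, ← add_assoc, iterU, Function.update_self]
    · rintro ⟨xs, h₁, h₂, h₃⟩
      refine ⟨xs, fun j hj => h₁ j (by omega), fun j hj => h₂ j (by omega), xs n, h₁ n (by omega),
        ?_, ?_⟩
      · have := h₂ n (by omega)
        rwa [Finset.sum_range_succ, ← add_assoc] at this
      · rwa [Finset.sum_range_succ, ← add_assoc] at h₃

/-! ### Maximization with constraints on fixed data -/

/-- The instructions `l` add the truth value of `c` to the data bit `i`, and keep the bits in `D`,
which determine `c`. -/
def OrBlock (B : ℕ) (D : Set ℕ) (i : ℕ) (l : List (List ℕ)) (c : (ℕ → Bool) → Prop) : Prop :=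
  (∀ u u' : ℕ → Bool, (∀ j ∈ D, u j = u' j) → (c u ↔ c u')) ∧
  ∃ F : (ℕ → Bool) → ℕ → Bool,
    (∀ Q, Run l (Lift B Q) = Lift B fun x N u => Q x N (F u)) ∧
    ∀ u, (F u i = true ↔ u i = true ∨ c u) ∧ ∀ j ∈ D, F u j = u j

namespace OrBlock

variable {B : ℕ} {D : Set ℕ} {i : ℕ}

theorem nil (B : ℕ) (D : Set ℕ) (i : ℕ) : OrBlock B D i [] fun _ => False :=
  ⟨fun _ _ _ => Iff.rfl, id, fun _ => rfl, fun u => ⟨by simp, fun _ _ => rfl⟩⟩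

theorem append {l l' : List (List ℕ)} {c c' : (ℕ → Bool) → Prop} (h : OrBlock B D i l c)
    (h' : OrBlock B D i l' c') : OrBlock B D i (l ++ l') fun u => c u ∨ c' u := by
  obtain ⟨hc, F, hF, hF'⟩ := h
  obtain ⟨hc', G, hG, hG'⟩ := h'
  refine ⟨fun u u' hu => or_congr (hc u u' hu) (hc' u u' hu), G ∘ F, fun Q => ?_, fun u => ⟨?_, ?_⟩⟩
  · funext ρ
    rw [run_append, hG, hF]
    rfl
  · rw [Function.comp_apply, (hG' _).1, (hF' u).1, hc' (F u) u fun j hj => (hF' u).2 j hj, or_assoc]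
  · exact fun j hj => ((hG' _).2 j hj).trans ((hF' u).2 j hj)

theorem congr {l : List (List ℕ)} {c c' : (ℕ → Bool) → Prop} (h : OrBlock B D i l c)
    (hc : ∀ u, c u ↔ c' u) : OrBlock B D i l c' := by
  rwa [← show c = c' from funext fun u => propext (hc u)]

theorem flatMap {n : ℕ} {l : ℕ → List (List ℕ)} {c : ℕ → (ℕ → Bool) → Prop}
    (h : ∀ a < n, OrBlock B D i (l a) (c a)) :
    OrBlock B D i ((List.range n).flatMap l) fun u => ∃ a < n, c a u := by
  induction n with
  | zero => exact (nil B D i).congr (by simp)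
  | succ n ih =>
    rw [RAM.flatMap_range_succ]
    refine ((ih fun a ha => h a (by omega)).append (h n (by omega))).congr fun u => ?_
    constructor
    · rintro (⟨a, ha, hc⟩ | hc)
      exacts [⟨a, by omega, hc⟩, ⟨n, by omega, hc⟩]
    · rintro ⟨a, ha, hc⟩
      rcases Nat.lt_succ_iff_lt_or_eq.1 ha with ha | ha
      · exact .inl ⟨a, ha, hc⟩
      · exact .inr (ha ▸ hc)

theorem ite {p : Prop} [Decidable p] {l : List (List ℕ)} {c : (ℕ → Bool) → Prop}
    (h : p → OrBlock B D i l c) : OrBlock B D i (if p then l else []) fun u => p ∧ c u := by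
  split_ifs with hp
  · exact (h hp).congr (by simp [hp])
  · exact (nil B D i).congr (by simp [hp])

theorem orInto {v s : ℕ} (hi : i ∉ D) (hv : v ∈ D) (hs : s < 2) :
    OrBlock B D i (orInto B i (2 * (3 + B + v) + s)) fun u => u v = decide (s = 1) :=
  ⟨fun u u' hu => by simp only [hu v hv], _,
    fun Q => run_orInto_data hs (by rintro rfl; exact hi hv) Q,
    fun u => ⟨by simp, fun j hj => Function.update_of_ne (by rintro rfl; exact hi hj) _ _⟩⟩

/-- The negation of a condition that is computed with the help of the data bit `1`. -/
theorem not {l : List (List ℕ)} {c : (ℕ → Bool) → Prop} (h : OrBlock B {j | j ≠ 1} 1 l c)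
    (hc : ∀ u u' : ℕ → Bool, (∀ j, 2 ≤ j → u j = u' j) → (c u ↔ c u')) :
    OrBlock B {j | 2 ≤ j} 0
      (assertOr (3 + B + 1) (2 * (3 + B + 1)) (2 * (3 + B + 1)) :: l ++
        BitProg.orInto B 0 (2 * (3 + B + 1) + 0)) fun u => ¬ c u := by
  obtain ⟨-, F, hF, hF'⟩ := h
  refine ⟨fun u u' hu => not_congr (hc u u' hu),
    fun u => Function.update (F (Function.update u 1 false)) 0
      (F (Function.update u 1 false) 0 || decide (F (Function.update u 1 false) 1 = decide (0 = 1))),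
    fun Q => ?_, fun u => ⟨?_, fun j hj => ?_⟩⟩
  · funext ρ
    rw [run_append, run_orInto_data (by omega) (by omega), ← List.singleton_append, run_append, hF,
      run_setFalse]
  · beta_reduce
    rw [Function.update_self, Bool.or_eq_true, decide_eq_true_eq, (hF' _).2 0 (by simp),
      Function.update_of_ne (by omega)]
    have h₁ := (hF' (Function.update u 1 false)).1
    rw [Function.update_self, hc _ u fun j hj => Function.update_of_ne (by omega) _ _] at h₁
    simp only [Bool.false_eq_true, false_or] at h₁
    rw [← h₁]
    simp
  · have hj : 2 ≤ j := hj
    beta_reduce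
    rw [Function.update_of_ne (by omega), (hF' _).2 j (show j ≠ 1 by omega),
      Function.update_of_ne (by omega)]

end OrBlock

/-- Choose whether to violate the condition that is computed by `l`, and count the violations. -/
def item (B : ℕ) (l : List (List ℕ)) : List (List ℕ) :=
  assertOr (3 + B + 0) (2 * (3 + B + 0)) (2 * (3 + B + 0)) :: l ++
    assertOr 0 1 (2 * (3 + B + 0) + 1) :: inc B 0

/-- The flag, data bit `0`, is cleared and then set by `l` if the condition holds. The choice may be
`0` only if the flag is set, so violations must be counted. Counting a satisfied condition is also
allowed, which is harmless for an upper bound. -/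
theorem run_item {B : ℕ} {D : Set ℕ} {l : List (List ℕ)} {c : (ℕ → Bool) → Prop}
    (hD : 0 ∉ D) (h : OrBlock B D 0 l c) : ∃ F : (ℕ → Bool) → ℕ → Bool,
      (∀ u, ∀ j ∈ D, F u j = u j) ∧ ∀ Q : ℕ → (ℕ → Bool) → Prop,
        Run (item B l) (Lift B fun _ => Q) = Lift B fun _ N u =>
          ∃ x : Bool, (x = true ∨ c u) ∧ N + x.toNat < 2 ^ B ∧ Q (N + x.toNat) (F u) := by
  obtain ⟨hc, F, hF, hF'⟩ := h
  have hu : ∀ u : ℕ → Bool, ∀ j ∈ D, Function.update u 0 false j = u j := fun u j hj =>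
    Function.update_of_ne (by rintro rfl; exact hD hj) _ _
  refine ⟨fun u => F (Function.update u 0 false), fun u j hj => ?_, fun Q => ?_⟩
  · show F (Function.update u 0 false) j = u j
    rw [(hF' _).2 j hj, hu u j hj]
  · have : Run (item B l) (Lift B fun _ => Q) =
        Run [assertOr (3 + B + 0) (2 * (3 + B + 0)) (2 * (3 + B + 0))] (Run l
          (Run [assertOr 0 1 (2 * (3 + B + 0) + 1)] (Run (inc B 0) (Lift B fun _ => Q)))) := by
      rw [← run_append', ← run_append', ← run_append', item]
      simp
    rw [this, run_inc (by omega), run_assertOr_zero, hF, run_setFalse]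
    funext ρ
    apply propext
    refine exists_congr fun x => ?_
    rw [(hF' _).1, Function.update_self, hc _ _ (hu _)]
    simp

/-- The main program for maximization problems. -/
def budget (B T m : ℕ) (l : ℕ → List (List ℕ)) : List (List ℕ) :=
  initCounter B T ++ (List.range m).flatMap fun j => item B (l j)

open Classical in
-- A counter that starts at `2 ^ B - 1 - T` absorbs at most `T` without overflow. The cheapest run
-- counts exactly the violated conditions. Items preserve the bits in `D`, so all conditions refer
-- to the same data.
theorem run_budget {B T m : ℕ} (hT : T < 2 ^ B) {D : Set ℕ} (hD : 0 ∉ D)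
    {l : ℕ → List (List ℕ)} {c : ℕ → (ℕ → Bool) → Prop}
    (h : ∀ j < m, OrBlock B D 0 (l j) (c j)) :
    (∃ ρ, Run (budget B T m l) (fun _ => True) ρ) ↔
      ∃ u, ((Finset.range m).filter fun j => ¬ c j u).card ≤ T := by
  have h' : ∀ j, ∃ F : (ℕ → Bool) → ℕ → Bool, j < m →
      (∀ u, ∀ j ∈ D, F u j = u j) ∧ ∀ Q : ℕ → (ℕ → Bool) → Prop,
        Run (item B (l j)) (Lift B fun _ => Q) = Lift B fun _ N u =>
          ∃ x : Bool, (x = true ∨ c j u) ∧ N + x.toNat < 2 ^ B ∧ Q (N + x.toNat) (F u) := by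
    intro j
    by_cases hj : j < m
    · obtain ⟨F, hF⟩ := run_item hD (h j hj)
      exact ⟨F, fun _ => hF⟩
    · exact ⟨id, fun h => absurd h hj⟩
  choose F hF using h'
  have hrun := run_items (n := m) (ok := fun j x u => x = true ∨ c j u)
    (w := fun _ x => x.toNat) (F := fun j _ => F j) (fun j hj => (hF j hj).2) fun _ _ => True
  have hiter : ∀ xs u, ∀ j ≤ m, ∀ i ∈ D, iterU (fun j _ => F j) xs u j i = u i := by
    intro xs u j hj i hi
    induction j with
    | zero => rfl
    | succ j ih => rw [iterU, (hF j (by omega)).1 _ i hi, ih (by omega)]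
  have hcard : ∀ u, ((Finset.range m).filter fun j => ¬ c j u).card =
      ∑ j ∈ Finset.range m, (decide (¬ c j u)).toNat := by
    intro u
    rw [Finset.card_filter]
    refine Finset.sum_congr rfl fun j _ => ?_
    by_cases hc : c j u <;> simp [hc]
  have hmain : ∀ ρ, Run (budget B T m l) (fun _ => True) ρ ↔
      ((Finset.range m).filter fun j => ¬ c j fun i => ρ (3 + B + i)).card ≤ T := by
    intro ρ
    rw [budget, run_append]
    have : (Run ((List.range m).flatMap fun j => item B (l j)) fun _ => True) =
      Lift B _ := hrun
    rw [this, run_initCounter hT, hcard]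
    constructor
    · rintro ⟨xs, h₁, h₂, -⟩
      have h₃ : ∑ j ∈ Finset.range m, (decide (¬ c j fun i => ρ (3 + B + i))).toNat ≤
          ∑ j ∈ Finset.range m, (xs j).toNat := by
        refine Finset.sum_le_sum fun j hj => ?_
        have hj := Finset.mem_range.1 hj
        have h₄ := h₁ j hj
        rw [(h j hj).1 _ _ (hiter xs _ j hj.le)] at h₄
        rcases h₄ with h₄ | h₄
        · rw [h₄]; exact Bool.toNat_le _
        · simp [h₄]
      refine h₃.trans ?_
      rcases Nat.eq_zero_or_pos m with rfl | hm
      · simp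
      -- The overflow test of the last item bounds the whole sum.
      · have h₄ := h₂ (m - 1) (by omega)
        rw [show m - 1 + 1 = m by omega] at h₄
        omega
    · intro hle
      refine ⟨fun j => decide (¬ c j fun i => ρ (3 + B + i)), fun j hj => ?_, fun j hj => ?_,
        trivial⟩
      · rw [(h j hj).1 _ _ (hiter _ _ j hj.le)]
        by_cases hc : c j fun i => ρ (3 + B + i) <;> simp [hc]
      · have : ∑ i ∈ Finset.range (j + 1), (decide (¬ c i fun i => ρ (3 + B + i))).toNat ≤
            ∑ i ∈ Finset.range m, (decide (¬ c i fun i => ρ (3 + B + i))).toNat :=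
          Finset.sum_le_sum_of_subset (Finset.range_subset_range.2 hj)
        beta_reduce
        omega
  simp only [hmain]
  constructor
  · rintro ⟨ρ, hρ⟩
    exact ⟨_, hρ⟩
  · rintro ⟨u, hu⟩
    refine ⟨fun i => u (i - (3 + B)), ?_⟩
    simpa using hu

/-! ### Covering -/

/-- Choose some of `m` sets that cover the numbers below `n`, and count them. -/
def cover (B T n m : ℕ) (mem : ℕ → ℕ → Bool) : List (List ℕ) :=
  initCounter B T ++
  (((List.range n).flatMap fun e => [assertOr (3 + B + e) (2 * (3 + B + e)) (2 * (3 + B + e))]) ++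
  (((List.range m).flatMap fun j => free 0 ::
    ((List.range n).flatMap fun e => if mem j e then orInto B e 1 else []) ++ inc B 0) ++
  (List.range n).flatMap fun e => [assertOr 2 (2 * (3 + B + e) + 1) (2 * (3 + B + e) + 1)]))

theorem run_flatMap_data {B n : ℕ} {f : ℕ → List (List ℕ)}
    {G : ℕ → Bool → (ℕ → Bool) → ℕ → Bool}
    (h : ∀ e, ∀ Q, Run (f e) (Lift B Q) = Lift B fun x N u => Q x N (G e x u))
    (Q : Bool → ℕ → (ℕ → Bool) → Prop) : Run ((List.range n).flatMap f) (Lift B Q) =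
      Lift B fun x N u => Q x N (iterU (fun e _ => G e x) (fun _ => false) u n) := by
  induction n generalizing Q with
  | zero => rfl
  | succ n ih => rw [run_flatMap_range_succ, h, ih]; rfl

theorem iterU_update {g : ℕ → Bool → Bool} (u xs : ℕ → Bool) (n : ℕ) :
    iterU (fun e _ u => Function.update u e (g e (u e))) xs u n =
      fun e => if e < n then g e (u e) else u e := by
  induction n with
  | zero => rfl
  | succ n ih =>
    rw [iterU, ih]
    funext e
    rw [Function.update_apply]
    split_ifs with h₁ h₂ h₃ h₃ h₄
    all_goals first | rfl | omega | skip
    all_goals simp_all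

/-- Data bit `e` becomes the disjunction of the choices of the sets containing `e`, so the final
assertions say that everything is covered. The counter limits the number of chosen sets. -/
theorem run_cover {B T n m : ℕ} (hT : T < 2 ^ B) (mem : ℕ → ℕ → Bool) :
    (∃ ρ, Run (cover B T n m mem) (fun _ => True) ρ) ↔ ∃ xs : ℕ → Bool,
      (∀ e < n, ∃ j < m, xs j = true ∧ mem j e = true) ∧
        ∑ j ∈ Finset.range m, (xs j).toNat ≤ T := by
  have hassert : ∀ k, ((Run ((List.range k).flatMap fun e =>
      [assertOr 2 (2 * (3 + B + e) + 1) (2 * (3 + B + e) + 1)])) fun _ => True) =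
      Lift B fun _ _ u => ∀ e < k, u e = true := by
    intro k
    have : ∀ Q, Run ((List.range k).flatMap fun e =>
        [assertOr 2 (2 * (3 + B + e) + 1) (2 * (3 + B + e) + 1)]) (Lift B Q) =
        Lift B fun x N u => (∀ e < k, u e = true) ∧ Q x N u := by
      induction k with
      | zero => intro Q; simp [Run]
      | succ k ih =>
        intro Q
        rw [run_flatMap_range_succ, run_assert, ih]
        congr 1
        funext x N u
        rw [← and_assoc]
        congr 1
        apply propext
        constructor
        · rintro ⟨h₁, h₂⟩ b hb
          rcases Nat.lt_succ_iff_lt_or_eq.1 hb with hb | rfl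
          exacts [h₁ b hb, h₂]
        · exact fun h => ⟨fun b hb => h b (by omega), h k (by omega)⟩
    rw [← lift_true B, this]
    simp
  have hdata : ∀ j, ∀ Q, Run ((List.range n).flatMap fun e =>
      if mem j e then orInto B e 1 else []) (Lift B Q) = Lift B fun x N u =>
        Q x N fun e => if e < n then u e || x && mem j e else u e := by
    intro j Q
    rw [run_flatMap_data (G := fun e x u => Function.update u e (u e || x && mem j e))]
    · congr 1
      funext x N u
      rw [iterU_update (g := fun e b => b || x && mem j e)]
    · intro e Q
      cases mem j e
      · simp [Run]
      · simp [run_orInto_zero]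
  have hitem : ∀ j < m, ∀ Q : ℕ → (ℕ → Bool) → Prop, Run (free 0 ::
      ((List.range n).flatMap fun e => if mem j e then orInto B e 1 else []) ++ inc B 0)
      (Lift B fun _ => Q) = Lift B fun _ N u => ∃ x : Bool, True ∧ N + x.toNat < 2 ^ B ∧
        Q (N + x.toNat) fun e => if e < n then u e || x && mem j e else u e := by
    intro j _ Q
    have : Run (free 0 ::
        ((List.range n).flatMap fun e => if mem j e then orInto B e 1 else []) ++ inc B 0)
        (Lift B fun _ => Q) = Run [free 0] (Run ((List.range n).flatMap fun e =>
          if mem j e then orInto B e 1 else []) (Run (inc B 0) (Lift B fun _ => Q))) := by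
      funext ρ
      rw [run_append, ← List.singleton_append, run_append]
    rw [this, run_inc (by omega), hdata, run_free_zero]
    simp
  have hinit : ∀ Q, Run ((List.range n).flatMap fun e =>
      [assertOr (3 + B + e) (2 * (3 + B + e)) (2 * (3 + B + e))]) (Lift B Q) =
      Lift B fun x N u => Q x N fun e => if e < n then false else u e := by
    intro Q
    rw [run_flatMap_data (G := fun e _ u => Function.update u e false)]
    · congr 1
      funext x N u
      rw [iterU_update (g := fun _ _ => false)]
    · intro e Q
      exact run_setFalse B e Q
  have hiter : ∀ xs u j e, e < n →
      (iterU (fun j x u e => if e < n then u e || x && mem j e else u e) xs u j e = true ↔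
        u e = true ∨ ∃ i < j, xs i = true ∧ mem i e = true) := by
    intro xs u j e he
    induction j with
    | zero => simp [iterU]
    | succ j ih =>
      rw [iterU, if_pos he, Bool.or_eq_true, ih, Bool.and_eq_true, or_assoc]
      refine or_congr_right ?_
      constructor
      · rintro (⟨i, hi, h⟩ | h)
        exacts [⟨i, by omega, h⟩, ⟨j, by omega, h⟩]
      · rintro ⟨i, hi, h⟩
        rcases Nat.lt_succ_iff_lt_or_eq.1 hi with hi | rfl
        exacts [.inl ⟨i, hi, h⟩, .inr h]
  have hmain : Run (cover B T n m mem) (fun _ => True) = fun _ => ∃ xs : ℕ → Bool,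
      (∀ e < n, ∃ j < m, xs j = true ∧ mem j e = true) ∧
        ∑ j ∈ Finset.range m, (xs j).toNat ≤ T := by
    have : Run (cover B T n m mem) (fun _ => True) = Run (initCounter B T)
        (Run ((List.range n).flatMap fun e =>
          [assertOr (3 + B + e) (2 * (3 + B + e)) (2 * (3 + B + e))])
        (Run ((List.range m).flatMap fun j => free 0 ::
          ((List.range n).flatMap fun e => if mem j e then orInto B e 1 else []) ++ inc B 0)
        (Run ((List.range n).flatMap fun e =>
          [assertOr 2 (2 * (3 + B + e) + 1) (2 * (3 + B + e) + 1)]) fun _ => True))) := by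
      funext ρ
      rw [cover, run_append]
      congr 1; funext ρ
      rw [run_append]
      congr 1; funext ρ
      rw [run_append]
    rw [this, hassert, run_items (B := B) (Q := fun _ u => ∀ e < n, u e = true) hitem, hinit,
      run_initCounter hT]
    funext ρ
    apply propext
    refine exists_congr fun xs => ?_
    constructor
    · rintro ⟨-, h₁, h₂⟩
      refine ⟨fun e he => ?_, ?_⟩
      · have := (hiter _ _ _ _ he).1 (h₂ e he)
        simpa [he] using this
      · rcases Nat.eq_zero_or_pos m with rfl | hm
        · simp
        · have h₄ := h₁ (m - 1) (by omega)
          rw [show m - 1 + 1 = m by omega] at h₄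
          omega
    · rintro ⟨h₁, h₂⟩
      refine ⟨fun _ _ => trivial, fun j hj => ?_, fun e he => ?_⟩
      · have : ∑ i ∈ Finset.range (j + 1), (xs i).toNat ≤ ∑ i ∈ Finset.range m, (xs i).toNat :=
          Finset.sum_le_sum_of_subset (Finset.range_subset_range.2 hj)
        omega
      · exact (hiter _ _ _ _ he).2 (.inr (h₁ e he))
  simp only [hmain, exists_const]

/-! ### Sums -/

/-- Choose some of the numbers `v i`, for `i < n`, with the sum `t`. -/
def choose (B t n : ℕ) (v : ℕ → ℕ) : List (List ℕ) :=
  initCounter B t ++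
  (((List.range n).flatMap fun i => free 0 ::
    ((List.range B).flatMap fun b => if v i / 2 ^ b % 2 ≠ 0 then inc B b else [])) ++ allOnes B)

/-- Starting from `2 ^ B - 1 - t`, the counter ends with all ones exactly if the chosen numbers add
up to `t`; in that case no partial sum overflows. -/
theorem run_choose {B t n : ℕ} (ht : t < 2 ^ B) {v : ℕ → ℕ} (hv : ∀ i < n, v i < 2 ^ B) :
    (∃ ρ, Run (choose B t n v) (fun _ => True) ρ) ↔ ∃ xs : ℕ → Bool,
      ∑ i ∈ Finset.range n, (xs i).toNat * v i = t := by
  have hadd : ∀ i k, k ≤ B → ∀ Q, Run ((List.range k).flatMap fun b =>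
      if v i / 2 ^ b % 2 ≠ 0 then inc B b else []) (Lift B Q) = Lift B fun x N u =>
        N + x.toNat * (v i % 2 ^ k) < 2 ^ B ∧ Q x (N + x.toNat * (v i % 2 ^ k)) u := by
    intro i k
    induction k with
    | zero =>
      intro _ Q
      funext ρ
      simp [Run, Nat.mod_one, Lift, val_lt]
    | succ k ih =>
      intro hk Q
      rw [run_flatMap_range_succ]
      rcases Nat.mod_two_eq_zero_or_one (v i / 2 ^ k) with h | h
      · rw [if_neg (by omega), show Run [] (Lift B Q) = Lift B Q from rfl, ih (by omega),
          Nat.mod_pow_succ, h, mul_zero, add_zero]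
      · rw [if_pos (by omega), run_inc (by omega), ih (by omega), Nat.mod_pow_succ, h, mul_one]
        congr 1
        funext x N u
        apply propext
        -- Adding the remaining bit only increases the sum, so the last overflow test implies the
        -- previous ones.
        rw [mul_add, ← add_assoc, and_iff_right_of_imp]
        exact fun h => lt_of_le_of_lt (Nat.le_add_right _ _) h.1
  have hitem : ∀ i < n, ∀ Q : ℕ → (ℕ → Bool) → Prop, Run (free 0 ::
      ((List.range B).flatMap fun b => if v i / 2 ^ b % 2 ≠ 0 then inc B b else []))
      (Lift B fun _ => Q) = Lift B fun _ N u => ∃ x : Bool, True ∧ N + x.toNat * v i < 2 ^ B ∧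
        Q (N + x.toNat * v i) u := by
    intro i hi Q
    have : Run (free 0 ::
        ((List.range B).flatMap fun b => if v i / 2 ^ b % 2 ≠ 0 then inc B b else []))
        (Lift B fun _ => Q) = Run [free 0] (Run ((List.range B).flatMap fun b =>
          if v i / 2 ^ b % 2 ≠ 0 then inc B b else []) (Lift B fun _ => Q)) := by
      funext ρ
      rw [← List.singleton_append, run_append]
    rw [this, hadd i B le_rfl, run_free_zero, Nat.mod_eq_of_lt (hv i hi)]
    simp
  have hmain : Run (choose B t n v) (fun _ => True) = fun _ => ∃ xs : ℕ → Bool,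
      ∑ i ∈ Finset.range n, (xs i).toNat * v i = t := by
    have : Run (choose B t n v) (fun _ => True) = Run (initCounter B t)
        (Run ((List.range n).flatMap fun i => free 0 ::
          ((List.range B).flatMap fun b => if v i / 2 ^ b % 2 ≠ 0 then inc B b else []))
        (Run (allOnes B) fun _ => True)) := by
      funext ρ
      rw [choose, run_append]
      congr 1; funext ρ
      rw [run_append]
    rw [this, run_allOnes, run_items (B := B) (Q := fun N _ => N = 2 ^ B - 1)
      (w := fun i x => x.toNat * v i) (F := fun _ _ u => u) (ok := fun _ _ _ => True) hitem,
      run_initCounter ht]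
    funext ρ
    apply propext
    refine exists_congr fun xs => ?_
    constructor
    · rintro ⟨-, -, h⟩
      omega
    · intro h
      refine ⟨fun _ _ => trivial, fun j hj => ?_, by omega⟩
      have : ∑ i ∈ Finset.range (j + 1), (xs i).toNat * v i ≤
          ∑ i ∈ Finset.range n, (xs i).toNat * v i :=
        Finset.sum_le_sum_of_subset (Finset.range_subset_range.2 hj)
      omega
  simp only [hmain, exists_const]

end BitProg

namespace RAM

theorem Expr.eval_setReg {o D x v : ℕ} {s : State} {e : Expr} (he : e.ok o D) (hx : D ≤ x) :
    e.eval (s.setReg x v) = e.eval s :=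
  Expr.eval_congr ((State.Same.refl o D s).setReg_right hx v) e he

namespace Expr

/-- The definitions in this namespace are symbolic counterparts of the instructions on numbers:
evaluating the emitted expressions gives the latter definitionally. -/
def negLit (l : Expr) : Expr := 2 * (l / 2) + (1 - l % 2)

def free (r : Expr) : List Expr :=
  BitProg.ins r (2 * r) (2 * r + 1) (2 * r) (2 * r) (2 * r + 1) (2 * r) (2 * r) (2 * r + 1) (2 * r)
    (2 * r) (2 * r + 1) (2 * r)

def assertOr (r l l' : Expr) : List Expr := BitProg.ins r l l' l l l' l l l' l l l' l

def copy (r p : Expr) : List Expr :=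
  BitProg.ins r (2 * r) (2 * p + 1) (2 * r) (2 * r + 1) (2 * p) (2 * r + 1)
    (2 * r) (2 * p + 1) (2 * r) (2 * r + 1) (2 * p) (2 * r + 1)

def xorIns (r p c : Expr) : List Expr :=
  BitProg.ins r (2 * r) (2 * p + 1) (2 * c + 1) (2 * r) (2 * p) (2 * c)
    (2 * r + 1) (2 * p) (2 * c + 1) (2 * r + 1) (2 * p + 1) (2 * c)

def andNot (r p a : Expr) : List Expr :=
  BitProg.ins r (2 * r) (2 * p + 1) (2 * p + 1) (2 * r) (2 * a) (2 * a)
    (2 * r + 1) (2 * p) (2 * a + 1) (2 * r + 1) (2 * p) (2 * a + 1)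

def orLit (r p l : Expr) : List Expr :=
  BitProg.ins r (2 * r) (2 * p + 1) l (2 * r + 1) (2 * p) (2 * p) (2 * r + 1) (negLit l) (negLit l)
    (2 * r + 1) (negLit l) (negLit l)

end Expr

namespace Gen

/-! ### Instructions and blocks -/

theorem den_seq (g h : Gen) (D : ℕ) (s : State) :
    (seq g h).den D s = g.den D s ++ h.den D s := rfl

theorem den_loop (n : Expr) (g : Gen) (D : ℕ) (s : State) :
    (Gen.loop n g).den D s = (List.range (n.eval s)).flatMap fun i =>
      g.den (D + 2) ((s.setReg D (n.eval s)).setReg (D + 1) i) := rfl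

theorem den_assertOr (r l l' : Expr) (D : ℕ) (s : State) :
    (emit (r.assertOr l l')).den D s =
      [BitProg.assertOr (r.eval s) (l.eval s) (l'.eval s)] := rfl

theorem den_copy (r p : Expr) (D : ℕ) (s : State) :
    (emit (r.copy p)).den D s = [BitProg.copy (r.eval s) (p.eval s)] := rfl

theorem den_xorIns (r p c : Expr) (D : ℕ) (s : State) :
    (emit (r.xorIns p c)).den D s = [BitProg.xorIns (r.eval s) (p.eval s) (c.eval s)] := rfl

theorem den_andNot (r p a : Expr) (D : ℕ) (s : State) :
    (emit (r.andNot p a)).den D s = [BitProg.andNot (r.eval s) (p.eval s) (a.eval s)] := rfl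

def inc (D : ℕ) (B b : Expr) : Gen :=
  .seq (.emit (Expr.copy 1 0)) <|
  .seq (.loop (B - b) <| .seq (.emit (Expr.copy 2 (3 + (b + .reg (D + 1))))) <|
    .seq (.emit (Expr.xorIns (3 + (b + .reg (D + 1))) 2 1)) <|
    .emit (Expr.andNot 1 2 (3 + (b + .reg (D + 1))))) <|
  .emit (Expr.assertOr 2 2 2)

theorem den_inc {o D : ℕ} {B b : Expr} (hb : b.ok o D) (s : State) :
    (inc D B b).den D s = BitProg.inc (B.eval s) (b.eval s) := by
  have h : ∀ i j, b.eval ((s.setReg D i).setReg (D + 1) j) = b.eval s := fun i j => by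
    rw [Expr.eval_setReg hb (by omega), Expr.eval_setReg hb (by omega)]
  rw [inc, den_seq, den_seq, den_loop, den_copy, den_assertOr, BitProg.inc, List.cons_append]
  refine congrArg (BitProg.copy 1 0 :: ·) (congrArg (· ++ _) (List.flatMap_congr fun i _ => ?_))
  rw [den_seq, den_seq, den_copy, den_xorIns, den_andNot, BitProg.halfAdd]
  simp [h, State.setReg_reg]

theorem bounded_inc {D Y : ℕ} {B b : Expr} {s : State} (hY : B.eval s ≤ Y) :
    (inc D B b).Bounded Y D s := by
  simp only [inc, Bounded, Expr.eval_sub, and_true, true_and]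
  exact ⟨by omega, fun _ _ => trivial⟩

theorem foldAcc_mul {D : ℕ} {s : State} {n e : Expr} {v : ℕ}
    (he : ∀ i j k, e.eval (((s.setReg D i).setReg (D + 1) j).setReg (D + 2) k) = v) (i : ℕ) :
    foldAcc D s n 1 (e * .reg (D + 2)) i = v ^ i := by
  induction i with
  | zero => rfl
  | succ i ih => simp [foldAcc, he, ih, State.setReg_reg, pow_succ, mul_comm]

/-- Bind register `D + 2` to a power. -/
def pow (D : ℕ) (e i : Expr) (g : Gen) : Gen := .fold i 1 (e * .reg (D + 2)) g

theorem den_pow {o D : ℕ} {e i : Expr} (he : e.ok o D) (g : Gen) (s : State) :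
    (pow D e i g).den D s = g.den (D + 3) (((s.setReg D (i.eval s)).setReg (D + 1)
      (i.eval s)).setReg (D + 2) (e.eval s ^ i.eval s)) := by
  rw [pow, den, foldAcc_mul fun _ _ _ => by
    rw [Expr.eval_setReg he (by omega), Expr.eval_setReg he (by omega),
      Expr.eval_setReg he (by omega)]]

theorem bounded_pow {o D Y : ℕ} {e i : Expr} (he : e.ok o D) {g : Gen} {s : State}
    (hi : i.eval s ≤ Y) (hs : ∀ j ≤ i.eval s, Nat.size (e.eval s ^ j) ≤ Y)
    (hg : g.Bounded Y (D + 3) (((s.setReg D (i.eval s)).setReg (D + 1)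
      (i.eval s)).setReg (D + 2) (e.eval s ^ i.eval s))) : (pow D e i g).Bounded Y D s := by
  have h := foldAcc_mul (D := D) (s := s) (n := i) (e := e) (v := e.eval s) fun _ _ _ => by
    rw [Expr.eval_setReg he (by omega), Expr.eval_setReg he (by omega),
      Expr.eval_setReg he (by omega)]
  rw [pow, Bounded]
  simp only [h]
  exact ⟨hi, hs, hg⟩

/-- The inequality is strict because `2 ^ i` has `i + 1` bits. -/
theorem bounded_two_pow {D Y : ℕ} {i : Expr} {g : Gen} {s : State} (hi : i.eval s < Y)
    (hg : g.Bounded Y (D + 3) (((s.setReg D (i.eval s)).setReg (D + 1)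
      (i.eval s)).setReg (D + 2) (2 ^ i.eval s))) : (pow D 2 i g).Bounded Y D s :=
  bounded_pow (o := 0) rfl hi.le
    (fun j hj => (Nat.size_pow (n := j)).le.trans (show j + 1 ≤ Y by omega)) hg

def initCounter (D : ℕ) (B T : Expr) : Gen :=
  .loop B <| pow (D + 2) 2 (.reg (D + 1)) <|
  .emit (Expr.assertOr (3 + .reg (D + 1)) (2 * (3 + .reg (D + 1)) + (1 - T / .reg (D + 4) % 2))
    (2 * (3 + .reg (D + 1)) + (1 - T / .reg (D + 4) % 2)))

theorem den_initCounter {o D : ℕ} {B T : Expr} (hT : T.ok o D) (s : State) :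
    (initCounter D B T).den D s = BitProg.initCounter (B.eval s) (T.eval s) := by
  have h : ∀ a b c d e, T.eval (((((s.setReg D a).setReg (D + 1) b).setReg (D + 2) c).setReg
      (D + 2 + 1) d).setReg (D + 2 + 2) e) = T.eval s := fun a b c d e => by
    simp only [Expr.eval_setReg hT, show D ≤ D + 2 + 2 by omega, show D ≤ D + 2 + 1 by omega,
      show D ≤ D + 2 by omega, show D ≤ D + 1 by omega, le_refl]
  rw [initCounter, den_loop, BitProg.initCounter]
  refine List.flatMap_congr fun i _ => ?_
  rw [den_pow (o := o) rfl, den_assertOr]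
  simp [h, State.setReg_reg]

theorem bounded_initCounter {D Y : ℕ} {B T : Expr} {s : State} (hY : B.eval s ≤ Y) :
    (initCounter D B T).Bounded Y D s := by
  refine ⟨hY, fun i hi => bounded_two_pow ?_ trivial⟩
  simp [State.setReg_reg]
  omega

def orInto (B i l : Expr) : Gen :=
  .seq (.emit (Expr.copy 2 (3 + B + i))) (.emit (Expr.orLit (3 + B + i) 2 l))

theorem den_orInto (B i l : Expr) (D : ℕ) (s : State) :
    (orInto B i l).den D s = BitProg.orInto (B.eval s) (i.eval s) (l.eval s) := rfl

def setFalse (B i : Expr) : Gen :=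
  .emit (Expr.assertOr (3 + B + i) (2 * (3 + B + i)) (2 * (3 + B + i)))

theorem den_setFalse (B i : Expr) (D : ℕ) (s : State) :
    (setFalse B i).den D s = [BitProg.assertOr (3 + B.eval s + i.eval s)
      (2 * (3 + B.eval s + i.eval s)) (2 * (3 + B.eval s + i.eval s))] := rfl

def item (D : ℕ) (B : Expr) (g : Gen) : Gen :=
  .seq (setFalse B 0) <| .seq g <| .seq (.emit (Expr.assertOr 0 1 (2 * (3 + B + 0) + 1))) <| inc D B 0

theorem den_item (D : ℕ) (B : Expr) (g : Gen) (s : State) :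
    (item D B g).den D s = BitProg.item (B.eval s) (g.den D s) := by
  rw [item, den_seq, den_seq, den_seq, den_inc (o := 0) rfl, den_assertOr, den_setFalse, BitProg.item]
  simp

theorem bounded_item {D Y : ℕ} {B : Expr} {g : Gen} {s : State} (hY : B.eval s ≤ Y)
    (hg : g.Bounded Y D s) : (item D B g).Bounded Y D s :=
  ⟨trivial, hg, trivial, bounded_inc hY⟩

end Gen

end RAM

namespace BitProg

/-! ### Range of the registers -/

theorem good_free {S r : ℕ} (hr : r < S) : Good S (free r) := by
  rw [free, good_ins]; omega

theorem good_assertOr {S r l l' : ℕ} (hr : r < S) (hl : l / 2 < S) (hl' : l' / 2 < S) :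
    Good S (assertOr r l l') := by
  rw [assertOr, good_ins]; omega

theorem good_copy {S r p : ℕ} (hr : r < S) (hp : p < S) : Good S (copy r p) := by
  rw [copy, good_ins]; omega

theorem good_xorIns {S r p c : ℕ} (hr : r < S) (hp : p < S) (hc : c < S) :
    Good S (xorIns r p c) := by
  rw [xorIns, good_ins]; omega

theorem good_andNot {S r p a : ℕ} (hr : r < S) (hp : p < S) (ha : a < S) :
    Good S (andNot r p a) := by
  rw [andNot, good_ins]; omega

theorem good_orLit {S r p l : ℕ} (hr : r < S) (hp : p < S) (hl : l / 2 < S) :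
    Good S (orLit r p l) := by
  have : negLit l / 2 < S := by rw [negLit]; omega
  rw [orLit, good_ins]; omega

/-- All instructions use registers below `S` only. -/
def AllGood (S : ℕ) (l : List (List ℕ)) : Prop := ∀ v ∈ l, Good S v

namespace AllGood

variable {S : ℕ}

theorem nil (S : ℕ) : AllGood S [] := by simp [AllGood]

theorem cons {v : List ℕ} {l : List (List ℕ)} (hv : Good S v) (hl : AllGood S l) :
    AllGood S (v :: l) := by
  rw [AllGood, List.forall_mem_cons]
  exact ⟨hv, hl⟩

theorem append {l l' : List (List ℕ)} (h : AllGood S l) (h' : AllGood S l') :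
    AllGood S (l ++ l') := by
  rw [AllGood, List.forall_mem_append]
  exact ⟨h, h'⟩

theorem flatMap {n : ℕ} {f : ℕ → List (List ℕ)} (h : ∀ i < n, AllGood S (f i)) :
    AllGood S ((List.range n).flatMap f) := by
  intro v hv
  obtain ⟨i, hi, hv⟩ := List.mem_flatMap.1 hv
  exact h i (List.mem_range.1 hi) v hv

theorem ite {p : Prop} [Decidable p] {l : List (List ℕ)} (h : p → AllGood S l) :
    AllGood S (if p then l else []) := by
  split_ifs with hp
  exacts [h hp, nil S]

theorem inc {B b : ℕ} (hS : 3 + B ≤ S) : AllGood S (inc B b) := by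
  refine append (cons (good_copy (by omega) (by omega)) (flatMap fun i hi => ?_))
    (cons (good_assertOr (by omega) (by omega) (by omega)) (nil S))
  exact cons (good_copy (by omega) (by omega)) <| cons (good_xorIns (by omega) (by omega) (by omega))
    <| cons (good_andNot (by omega) (by omega) (by omega)) (nil S)

theorem initCounter {B T : ℕ} (hS : 3 + B ≤ S) : AllGood S (initCounter B T) :=
  flatMap fun i hi => cons (good_assertOr (by omega) (by omega) (by omega)) (nil S)

theorem orInto {B i l : ℕ} (hi : 3 + B + i < S) (hl : l / 2 < S) : AllGood S (orInto B i l) :=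
  cons (good_copy (by omega) (by omega)) <| cons (good_orLit hi (by omega) hl) (nil S)

theorem item {B : ℕ} {l : List (List ℕ)} (hS : 3 + B < S) (hl : AllGood S l) :
    AllGood S (item B l) :=
  append (cons (good_assertOr (by omega) (by omega) (by omega)) hl) <|
    cons (good_assertOr (by omega) (by omega) (by omega)) (inc hS.le)

theorem budget {B T m : ℕ} {l : ℕ → List (List ℕ)} (hS : 3 + B < S)
    (hl : ∀ j < m, AllGood S (l j)) : AllGood S (budget B T m l) :=
  append (initCounter hS.le) (flatMap fun j hj => item hS (hl j hj))

theorem cover {B T n m : ℕ} {mem : ℕ → ℕ → Bool} (hS : 3 + B + n ≤ S) :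
    AllGood S (cover B T n m mem) := by
  refine append (initCounter (by omega)) <| append (flatMap fun e he => ?_) <|
    append (flatMap fun j _ => append (cons (good_free (by omega)) (flatMap fun e he => ite fun _ =>
      orInto (by omega) (by omega))) (inc (by omega))) (flatMap fun e he => ?_)
  all_goals exact cons (good_assertOr (by omega) (by omega) (by omega)) (nil S)

theorem choose {B t n : ℕ} {v : ℕ → ℕ} (hS : 3 + B ≤ S) : AllGood S (choose B t n v) :=
  append (initCounter hS) <| append (flatMap fun i _ => cons (good_free (by omega))
    (flatMap fun b _ => ite fun _ => inc hS)) <| flatMap fun b _ =>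
      cons (good_assertOr (by omega) (by omega) (by omega)) (nil S)

end AllGood

end BitProg

namespace RAM

/-! ### Subset Sum -/

namespace Gen

/-- Cells `0` and `1` hold the number of items and the target; the items start at cell `2`. Register
`2` keeps the bit length of the target, and register `9` the power of two that isolates the current
bit of an item. -/
def subsetSum : Gen :=
  .size (.get 0 1) <| .seq (.emit [3 + .reg 2]) <| .seq (initCounter 3 (.reg 2) (.get 0 1)) <|
  .seq (.loop (.get 0 0) <| .seq (.emit (Expr.free 0)) <| .loop (.reg 2) <| pow 7 2 (.reg 6) <|
    .guard (.get 0 (2 + .reg 4) / .reg 9 % 2) <| inc 10 (.reg 2) (.reg 6)) <|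
  .loop (.reg 2) <| .emit (Expr.assertOr 2 (2 * (3 + .reg 4) + 1) (2 * (3 + .reg 4) + 1))

theorem subsetSum_ok : subsetSum.ok 1 1 = true := by decide

theorem den_subsetSum (s : State) : subsetSum.den 1 s = [3 + Nat.size (s.arr 0 1)] ::
    BitProg.choose (Nat.size (s.arr 0 1)) (s.arr 0 1) (s.arr 0 0) fun i => s.arr 0 (2 + i) := by
  simp [subsetSum, den, den_initCounter (o := 1) (B := .reg 2) (T := .get 0 1) rfl,
    den_pow (o := 1) (e := 2) rfl, den_inc (o := 1) (D := 10) (b := .reg 6) rfl,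
    State.setReg_reg, BitProg.choose, BitProg.allOnes]
  rfl

theorem bounded_subsetSum {Y : ℕ} {s : State} (hB : Nat.size (s.arr 0 1) ≤ Y)
    (hn : s.arr 0 0 ≤ Y) : subsetSum.Bounded Y 1 s := by
  refine ⟨trivial, bounded_initCounter hB, ⟨hn, fun i _ => ⟨trivial, hB, fun b hb => ?_⟩⟩, hB,
    fun _ _ => trivial⟩
  exact bounded_two_pow (lt_of_lt_of_le hb hB) fun _ => bounded_inc hB

end Gen

theorem getD_map_finRange {α : Type*} {n : ℕ} (f : Fin n → α) (d : α) {e : ℕ} (he : e < n) :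
    ((List.finRange n).map f).getD e d = f ⟨e, he⟩ := by
  rw [List.getD_eq_getElem _ _ (by simpa using he)]
  simp

theorem getD_flatMap_finRange {α : Type*} {m n : ℕ} {f : Fin m → List α} (d : α)
    (hf : ∀ j, (f j).length = n) {j : ℕ} (hj : j < m) {e : ℕ} (he : e < n) :
    ((List.finRange m).flatMap f).getD (j * n + e) d = (f ⟨j, hj⟩).getD e d := by
  rw [List.flatMap_def, mul_comm,
    BitProg.getD_flatten d _ (List.forall_mem_map.2 fun j _ => hf j) j e he,
    getD_map_finRange _ _ hj]

theorem length_flatMap_finRange {α : Type*} {m n : ℕ} {f : Fin m → List α}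
    (hf : ∀ j, (f j).length = n) : ((List.finRange m).flatMap f).length = m * n := by
  simp [List.length_flatMap, hf]

theorem init_arr_zero (w : List ℕ) (i : ℕ) : (init w).arr 0 i = w.getD i 0 := rfl

/-- The counter needs the bit length of `t` only, and every `v i` fits since it is at most `t`. -/
theorem generates_subsetSum (I : SubsetSumInstance) :
    Generates Gen.subsetSum I.encode I.Yes (3 + Nat.size I.t) (I.n + Nat.size I.t + 3) := by
  have hw : I.encode.length = I.n + 2 := by simp [SubsetSumInstance.encode]
  have h₀ : (init I.encode).arr 0 0 = I.n := rfl
  have h₁ : (init I.encode).arr 0 1 = I.t := rfl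
  have h₂ : ∀ i (hi : i < I.n), (init I.encode).arr 0 (2 + i) = I.v ⟨i, hi⟩ := fun i hi => by
    rw [init_arr_zero, SubsetSumInstance.encode, add_comm, List.getD_cons_succ,
      List.getD_cons_succ, List.getD_eq_getElem _ _ (by simpa using hi), List.getElem_ofFn]
  refine ⟨by omega, by omega, (size_le_self _).trans (by omega), fun v hv => ?_,
    Gen.bounded_subsetSum (by rw [h₁]; omega) (by rw [h₀]; omega), _, by
    rw [Gen.den_subsetSum, h₀, h₁], BitProg.AllGood.choose (by omega), ?_⟩
  · simp only [SubsetSumInstance.encode, List.mem_cons, List.mem_ofFn] at hv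
    obtain rfl | rfl | ⟨i, rfl⟩ := hv
    · exact (size_le_self _).trans (by omega)
    · omega
    · exact (Nat.size_le_size (I.v_le i)).trans (by omega)
  · rw [BitProg.run_choose (Nat.lt_size_self _) fun i hi => by
      rw [h₂ i hi]; exact (I.v_le _).trans_lt (Nat.lt_size_self _)]
    have : ∀ xs : ℕ → Bool, ∑ i ∈ Finset.range I.n,
        (xs i).toNat * (init I.encode).arr 0 (2 + i) = ∑ i : Fin I.n, (xs i).toNat * I.v i := by
      intro xs
      rw [← Fin.sum_univ_eq_sum_range fun i => (xs i).toNat * (init I.encode).arr 0 (2 + i)]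
      exact Finset.sum_congr rfl fun i _ => by rw [h₂ i i.2]
    simp only [this]
    constructor
    · rintro ⟨S, hS⟩
      refine ⟨fun i => decide (∃ h : i < I.n, ⟨i, h⟩ ∈ S), ?_⟩
      rw [← hS, ← Finset.univ_inter S, ← Finset.sum_ite_mem]
      refine Finset.sum_congr rfl fun i _ => ?_
      by_cases hi : i ∈ S <;> simp [hi]
    · rintro ⟨xs, hxs⟩
      refine ⟨Finset.univ.filter fun i => xs i = true, ?_⟩
      rw [← hxs, Finset.sum_filter]
      refine Finset.sum_congr rfl fun i _ => ?_
      cases xs i <;> simp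

/-! ### Set Cover -/

namespace Gen

def setCover : Gen :=
  .size (.get 0 1) <| .seq (.emit [3 + .reg 2 + .get 0 0]) <|
  .seq (initCounter 3 (.reg 2) (.get 0 2)) <|
  .seq (.loop (.get 0 0) <| setFalse (.reg 2) (.reg 4)) <|
  .seq (.loop (.get 0 1) <| .seq (.emit (Expr.free 0)) <| .seq (.loop (.get 0 0) <|
    .guard (.get 0 (3 + (.reg 4 * .get 0 0 + .reg 6))) <| orInto (.reg 2) (.reg 6) 1) <|
    inc 5 (.reg 2) 0) <|
  .loop (.get 0 0) <| .emit (Expr.assertOr 2 (2 * (3 + .reg 2 + .reg 4) + 1)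
    (2 * (3 + .reg 2 + .reg 4) + 1))

theorem setCover_ok : setCover.ok 1 1 = true := by decide

theorem den_setCover (s : State) : setCover.den 1 s = [3 + Nat.size (s.arr 0 1) + s.arr 0 0] ::
    BitProg.cover (Nat.size (s.arr 0 1)) (s.arr 0 2) (s.arr 0 0) (s.arr 0 1) fun j e =>
      decide (s.arr 0 (3 + (j * s.arr 0 0 + e)) ≠ 0) := by
  simp [setCover, den, den_initCounter (o := 1) (B := .reg 2) (T := .get 0 2) rfl,
    den_inc (o := 1) (D := 5) (b := 0) rfl, den_setFalse, den_orInto,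
    State.setReg_reg, BitProg.cover]
  rfl

theorem bounded_setCover {Y : ℕ} {s : State} (hm : s.arr 0 1 ≤ Y)
    (hn : s.arr 0 0 ≤ Y) : setCover.Bounded Y 1 s := by
  have hB : Nat.size (s.arr 0 1) ≤ Y := (size_le_self _).trans hm
  exact ⟨trivial, bounded_initCounter hB, ⟨hn, fun _ _ => trivial⟩, ⟨hm, fun i _ => ⟨trivial,
    ⟨hn, fun _ _ _ => ⟨trivial, trivial⟩⟩, bounded_inc hB⟩⟩, hn, fun _ _ => trivial⟩

end Gen

/-- One bit per element plus a counter for numbers up to `m`. The incidence matrix is row-major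
after three header cells, so set `j` has its bit for `e` in cell `3 + (j * n + e)`. -/
theorem generates_setCover (I : SetCoverInstance) :
    Generates Gen.setCover I.encode I.Yes (3 + Nat.size I.m + I.n)
      ((I.n + 4) * (I.m + 4)) := by
  have hY : 3 + Nat.size I.m + I.n + I.m * I.n ≤ (I.n + 4) * (I.m + 4) := by
    have := size_le_self I.m
    nlinarith
  have hw : I.encode.length = I.m * I.n + 3 := by
    simp [SetCoverInstance.encode, length_flatMap_finRange (n := I.n)]
  have h₀ : (init I.encode).arr 0 0 = I.n := rfl
  have h₁ : (init I.encode).arr 0 1 = I.m := rfl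
  have h₂ : (init I.encode).arr 0 2 = I.t := rfl
  have h₃ : ∀ j (hj : j < I.m) e (he : e < I.n),
      (init I.encode).arr 0 (3 + (j * I.n + e)) ≠ 0 ↔ ⟨e, he⟩ ∈ I.F ⟨j, hj⟩ := by
    intro j hj e he
    rw [init_arr_zero, SetCoverInstance.encode, add_comm, List.getD_cons_succ,
      List.getD_cons_succ, List.getD_cons_succ,
      getD_flatMap_finRange _ (fun j => by simp) hj he, getD_map_finRange _ _ he]
    simp
  have ht := I.t_le
  have hm : I.m ≤ (I.n + 4) * (I.m + 4) := by nlinarith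
  refine ⟨by omega, by omega, (size_le_self _).trans (by omega), fun v hv => ?_,
    Gen.bounded_setCover (by rw [h₁]; omega) (by rw [h₀]; omega), _, by
    rw [Gen.den_setCover, h₀, h₁, h₂], BitProg.AllGood.cover (by omega), ?_⟩
  · refine (size_le_self _).trans ?_
    simp only [SetCoverInstance.encode, List.mem_cons, List.mem_flatMap, List.mem_map] at hv
    obtain rfl | rfl | rfl | ⟨j, -, e, -, rfl⟩ := hv
    · omega
    · omega
    · omega
    · split_ifs <;> omega
  · rw [BitProg.run_cover (ht.trans_lt (Nat.lt_size_self _))]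
    constructor
    · rintro ⟨S, hS, hcov⟩
      refine ⟨fun j => decide (∃ h : j < I.m, ⟨j, h⟩ ∈ S), fun e he => ?_, ?_⟩
      · obtain ⟨j, hj, hm⟩ := hcov ⟨e, he⟩
        refine ⟨j, j.2, by simpa using hj, ?_⟩
        rw [decide_eq_true_eq, h₃ j j.2 e he]
        exact hm
      · rw [← Fin.sum_univ_eq_sum_range fun j => (decide (∃ h : j < I.m, ⟨j, h⟩ ∈ S)).toNat]
        refine le_trans (le_of_eq ?_) hS
        rw [Finset.card_eq_sum_ones, ← Finset.univ_inter S, ← Finset.sum_ite_mem]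
        refine Finset.sum_congr rfl fun i _ => ?_
        by_cases hi : i ∈ S <;> simp [hi]
    · rintro ⟨xs, hxs, hsum⟩
      refine ⟨Finset.univ.filter fun j => xs j = true, ?_, fun e => ?_⟩
      · refine le_trans (le_of_eq ?_) hsum
        rw [Finset.card_filter, ← Fin.sum_univ_eq_sum_range fun j => (xs j).toNat]
        refine Finset.sum_congr rfl fun i _ => ?_
        cases xs i <;> simp
      · obtain ⟨j, hj, hx, hm⟩ := hxs e e.2
        rw [decide_eq_true_eq, h₃ j hj e e.2] at hm
        exact ⟨⟨j, hj⟩, by simpa using hx, hm⟩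

/-! ### Maximum Satisfiability -/

namespace Gen

/-- Clauses have different lengths, so the position of clause `j` is found by a fold over the
earlier ones. Literals are shifted by `2 * (3 + B + 1)`, with `B` in register `2`, to skip the
choice, the scratch registers, the counter and the flag. -/
def maxSAT : Gen :=
  .size (.get 0 2) <| .seq (.emit [4 + .reg 2 + .get 0 1]) <|
  .seq (initCounter 3 (.reg 2) (.get 0 2 - .get 0 0)) <|
  .loop (.get 0 2) <| .fold (.reg 4) 3 (.reg 7 + 1 + .get 0 (.reg 7)) <| item 8 (.reg 2) <|
  .loop (.get 0 (.reg 7)) <|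
    orInto (.reg 2) 0 (2 * (3 + .reg 2 + 1) + .get 0 (.reg 7 + 1 + .reg 9))

theorem maxSAT_ok : maxSAT.ok 1 1 = true := by decide

/-- Position of the clause with number `j` in the encoding of a formula. -/
def clausePos (A : ℕ → ℕ) : ℕ → ℕ
  | 0 => 3
  | j + 1 => clausePos A j + 1 + A (clausePos A j)

theorem foldAcc_clausePos {D : ℕ} (s : State) (n : Expr) (j : ℕ) :
    foldAcc D s n 3 (.reg (D + 2) + 1 + .get 0 (.reg (D + 2))) j = clausePos (s.arr 0) j := by
  induction j with
  | zero => rfl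
  | succ j ih => simp [foldAcc, ih, State.setReg_reg, clausePos]

theorem den_maxSAT (s : State) : maxSAT.den 1 s = [4 + Nat.size (s.arr 0 2) + s.arr 0 1] ::
    BitProg.budget (Nat.size (s.arr 0 2)) (s.arr 0 2 - s.arr 0 0) (s.arr 0 2) fun j =>
      (List.range (s.arr 0 (clausePos (s.arr 0) j))).flatMap fun a =>
        BitProg.orInto (Nat.size (s.arr 0 2)) 0 (2 * (3 + Nat.size (s.arr 0 2) + 1) +
          s.arr 0 (clausePos (s.arr 0) j + 1 + a)) := by
  have h := foldAcc_clausePos (D := 5)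
  simp only [Nat.reduceAdd] at h
  simp [maxSAT, den, den_initCounter (o := 1) (B := .reg 2) (T := .get 0 2 - .get 0 0) rfl,
    den_item, den_orInto, State.setReg_reg, BitProg.budget, h]

theorem bounded_maxSAT {Y : ℕ} {s : State} (hm : s.arr 0 2 ≤ Y)
    (hpos : ∀ j ≤ s.arr 0 2, clausePos (s.arr 0) j ≤ Y)
    (hlen : ∀ j < s.arr 0 2, s.arr 0 (clausePos (s.arr 0) j) ≤ Y) : maxSAT.Bounded Y 1 s := by
  have hB : Nat.size (s.arr 0 2) ≤ Y := (size_le_self _).trans hm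
  have h := foldAcc_clausePos (D := 5)
  simp only [Nat.reduceAdd] at h
  refine ⟨trivial, bounded_initCounter hB, ⟨hm, fun j hj => ⟨hj.le.trans hm, fun i hi => ?_,
    bounded_item hB ⟨?_, fun _ _ => ⟨trivial, trivial⟩⟩⟩⟩⟩
  · rw [h]
    exact (size_le_self _).trans (hpos i (hi.trans hj.le))
  · simp [State.setReg_reg, h]
    exact hlen j hj

end Gen

theorem getD_flatMap_take {α β : Type*} (f : α → List β) (d : β) : ∀ (l : List α) {j : ℕ}
    (hj : j < l.length) {a : ℕ}, a < (f l[j]).length →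
    (l.flatMap f).getD (((l.take j).flatMap f).length + a) d = (f l[j]).getD a d
  | x :: l, 0, _, a, ha => by
    simpa using List.getD_append (f x) (l.flatMap f) d a (by simpa using ha)
  | x :: l, j + 1, hj, a, ha => by
    rw [List.take_succ_cons, List.flatMap_cons, List.flatMap_cons, List.length_append,
      List.getD_append_right _ _ _ _ (by omega), add_assoc, Nat.add_sub_cancel_left]
    exact getD_flatMap_take f d l (by simpa using hj) (by simpa using ha)

theorem length_filter_eq_sum {α : Type*} {p : α → Bool} : ∀ (l : List α) {q : ℕ → Prop}
    [DecidablePred q], (∀ j (hj : j < l.length), q j ↔ p l[j] = true) →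
    (l.filter p).length = ∑ j ∈ Finset.range l.length, if q j then 1 else 0
  | [], _, _, _ => rfl
  | x :: l, q, _, h => by
    have h₀ := h 0 (by simp)
    have ih := length_filter_eq_sum l (q := fun j => q (j + 1)) fun j hj =>
      h (j + 1) (by simpa using hj)
    rw [List.length_cons, Finset.sum_range_succ', ← ih, List.filter_cons]
    rw [List.getElem_cons_zero] at h₀
    by_cases hx : p x = true
    · rw [if_pos hx, if_pos (h₀.2 hx), List.length_cons]
    · rw [if_neg hx, if_neg (mt h₀.1 hx), add_zero]

theorem _root_.MaxSATInstance.length_add_le (I : MaxSATInstance) :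
    I.φ.length + 3 ≤ I.encode.length := by
  have : I.φ.length ≤ (I.φ.flatMap fun C =>
      C.length :: C.map fun l => 2 * l.1.val + l.2.toNat).length := by
    rw [List.length_flatMap]
    simp
  rw [MaxSATInstance.encode, CNF.encode, List.length_cons, List.length_cons, List.length_cons]
  omega

open Classical in
-- The data are an assignment, condition `j` says that clause `j` is satisfied, and the budget is
-- the number of clauses minus `t`.
theorem generates_maxSAT (I : MaxSATInstance) :
    Generates Gen.maxSAT I.encode I.Yes (4 + Nat.size I.φ.length + I.n)
      (2 * I.n + I.encode.length + 4) := by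
  obtain ⟨n, φ, t, ht⟩ := I
  set I : MaxSATInstance := ⟨n, φ, t, ht⟩
  set f : Clause n → List ℕ := fun C => C.length :: C.map fun l => 2 * l.1.val + l.2.toNat with hf
  have hI : I.encode = t :: n :: φ.length :: φ.flatMap f := rfl
  set A := (init I.encode).arr 0 with hA
  have h₀ : A 0 = t := rfl
  have h₁ : A 1 = n := rfl
  have h₂ : A 2 = φ.length := rfl
  have hA' : ∀ j (hj : j < φ.length), ∀ a < (f φ[j]).length,
      A (3 + ((φ.take j).flatMap f).length + a) = (f φ[j]).getD a 0 := by
    intro j hj a ha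
    rw [hA, init_arr_zero, hI, add_assoc, add_comm 3, List.getD_cons_succ, List.getD_cons_succ,
      List.getD_cons_succ, getD_flatMap_take f 0 φ hj ha]
  have hlen : ∀ j (hj : j < φ.length), A (3 + ((φ.take j).flatMap f).length) = φ[j].length :=
    fun j hj => hA' j hj 0 (by simp [hf])
  have hpos : ∀ j ≤ φ.length, Gen.clausePos A j = 3 + ((φ.take j).flatMap f).length := by
    intro j hj
    induction j with
    | zero => rfl
    | succ j ih =>
      rw [Gen.clausePos, ih (by omega), hlen j (by omega), List.take_add_one,
        List.getElem?_eq_getElem (by omega), Option.toList_some, List.flatMap_append,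
        List.length_append, List.flatMap_singleton, hf]
      simp only [List.length_cons, List.length_map]
      omega
  have hlit : ∀ j (hj : j < φ.length) a (ha : a < φ[j].length),
      A (Gen.clausePos A j + 1 + a) = 2 * φ[j][a].1.val + φ[j][a].2.toNat := by
    intro j hj a ha
    rw [hpos j hj.le, add_assoc _ 1, add_comm 1, hA' j hj _ (by simpa [hf] using ha), hf,
      List.getD_cons_succ, List.getD_eq_getElem _ _ (by simpa using ha), List.getElem_map]
  have htot : I.encode.length = 3 + (φ.flatMap f).length := by
    rw [hI]; simp only [List.length_cons]; omega
  have hpos_le : ∀ j ≤ φ.length, Gen.clausePos A j ≤ I.encode.length := fun j hj => by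
    rw [hpos j hj, htot]
    have := congrArg (fun l => (l.flatMap f).length) (List.take_append_drop j φ)
    simp only [List.flatMap_append, List.length_append] at this
    omega
  have hC : ∀ C ∈ φ, C.length + 4 ≤ I.encode.length := fun C hC => by
    have := (List.sublist_flatten_of_mem (List.mem_map_of_mem (f := f) hC)).length_le
    rw [← List.flatMap_def] at this
    simp only [hf, List.length_cons, List.length_map] at this htot
    omega
  have hm : φ.length + 3 ≤ I.encode.length := I.length_add_le
  have hsize := size_le_self φ.length
  have hprog : ∀ j < φ.length, A (Gen.clausePos A j) = (φ.getD j []).length := fun j hj => by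
    rw [hpos j hj.le, hlen j hj, List.getD_eq_getElem _ _ hj]
  show Generates Gen.maxSAT I.encode I.Yes (4 + Nat.size φ.length + n)
    (2 * n + I.encode.length + 4)
  refine ⟨by omega, by omega, (size_le_self _).trans (by omega), fun v hv => ?_,
    Gen.bounded_maxSAT (by rw [← hA, h₂]; omega) (fun j hj => ?_) (fun j hj => ?_), _, by
    rw [Gen.den_maxSAT, ← hA, h₀, h₁, h₂], ?_, ?_⟩
  · refine (size_le_self _).trans ?_
    simp only [hI, hf, List.mem_cons, List.mem_flatMap, List.mem_map] at hv
    obtain rfl | rfl | rfl | ⟨C, hC', rfl | ⟨l, -, rfl⟩⟩ := hv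
    · omega
    · omega
    · omega
    · have := hC C hC'
      omega
    · have := l.1.2
      have := Bool.toNat_le l.2
      omega
  · exact (hpos_le j hj).trans (by omega)
  · rw [← hA, hpos j (le_of_lt hj), hlen j hj]
    have := hC φ[j] (List.getElem_mem hj)
    omega
  · refine BitProg.AllGood.budget (by omega) fun j hj => BitProg.AllGood.flatMap fun a ha =>
      BitProg.AllGood.orInto (by omega) ?_
    rw [hpos j hj.le, hlen j hj] at ha
    rw [hlit j hj a ha]
    have := φ[j][a].1.2
    have := Bool.toNat_le φ[j][a].2
    omega
  · have hB : φ.length - t < 2 ^ Nat.size φ.length :=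
      (Nat.sub_le _ _).trans_lt (Nat.lt_size_self _)
    obtain ⟨c, hc⟩ : ∃ c : ℕ → (ℕ → Bool) → Prop, ∀ j u, c j u ↔
        ∃ a < A (Gen.clausePos A j), u (1 + A (Gen.clausePos A j + 1 + a) / 2) =
          decide (A (Gen.clausePos A j + 1 + a) % 2 = 1) := ⟨_, fun _ _ => Iff.rfl⟩
    rw [BitProg.run_budget (D := {j | 1 ≤ j}) (c := c) hB (by simp)]
    · have hsat : ∀ u : ℕ → Bool, ∀ j (hj : j < φ.length),
          c j u ↔ decide (Clause.Sat (fun v => u (1 + v)) φ[j]) = true := by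
        intro u j hj
        rw [hc, decide_eq_true_eq, Clause.Sat, List.exists_mem_iff_exists_getElem, hpos j hj.le,
          hlen j hj, ← hpos j hj.le]
        refine exists_congr fun a => ?_
        rw [← exists_prop]
        refine exists_congr fun ha => ?_
        rw [hlit j hj a ha]
        have h₁ : (2 * φ[j][a].1.val + φ[j][a].2.toNat) / 2 = φ[j][a].1.val := by
          have := Bool.toNat_le φ[j][a].2
          have := Bool.toNat_lt φ[j][a].2
          omega
        have h₂ : decide ((2 * φ[j][a].1.val + φ[j][a].2.toNat) % 2 = 1) = φ[j][a].2 := by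
          cases φ[j][a].2 <;> simp
        rw [h₁, h₂]
      have hcount : ∀ u : ℕ → Bool, ((Finset.range φ.length).filter fun j => ¬ c j u).card ≤
          φ.length - t ↔ t ≤ (φ.filter fun C => Clause.Sat (fun v => u (1 + v)) C).length := by
        intro u
        have h := Finset.card_filter_add_card_filter_not (s := Finset.range φ.length)
          fun j => c j u
        rw [Finset.card_filter, ← length_filter_eq_sum (p := fun C => decide (Clause.Sat _ C))
          φ (hsat u), Finset.card_range] at h
        have ht : t ≤ φ.length := ht
        omega
      constructor
      · rintro ⟨σ, hσ⟩
        -- Data bit `0` is the flag, so variable `v` is data bit `v + 1`.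
        refine ⟨fun i => if h : i - 1 < n then σ ⟨i - 1, h⟩ else false, ?_⟩
        refine (hcount _).2 (le_of_le_of_eq hσ ?_)
        simp [I]
      · rintro ⟨u, hu⟩
        exact ⟨fun v => u (1 + v), (hcount u).1 hu⟩
    · intro j hj
      refine (BitProg.OrBlock.flatMap fun a _ => ?_).congr fun u => (hc j u).symm
      have := BitProg.OrBlock.orInto (B := Nat.size φ.length) (D := {j | 1 ≤ j}) (i := 0)
        (v := 1 + A (Gen.clausePos A j + 1 + a) / 2) (s := A (Gen.clausePos A j + 1 + a) % 2)
        (by simp) (by simp) (Nat.mod_lt _ (by omega))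
      rwa [show 2 * (3 + Nat.size φ.length + (1 + A (Gen.clausePos A j + 1 + a) / 2)) +
        A (Gen.clausePos A j + 1 + a) % 2 = 2 * (3 + Nat.size φ.length + 1) +
        A (Gen.clausePos A j + 1 + a) by omega] at this

end RAM

/-! ### Most-Orthogonal Vectors: positions stored in groups -/

namespace BitProg

/-- Set the data bit `0` if group `h` of the data bits, which starts at position `2 + h * B'`, holds
the number `a`. -/
def matchGroup (B B' h a : ℕ) : List (List ℕ) :=
  assertOr (3 + B + 1) (2 * (3 + B + 1)) (2 * (3 + B + 1)) ::
    ((List.range B').flatMap fun b =>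
      orInto B 1 (2 * (3 + B + (2 + (h * B' + b))) + (1 - a / 2 ^ b % 2))) ++
    orInto B 0 (2 * (3 + B + 1) + 0)

/-- Instructions only accumulate disjunctions, so equality is obtained by De Morgan: data bit `1`
collects the mismatches, and its negation is added to the flag. -/
theorem orBlock_matchGroup (B B' h a : ℕ) :
    OrBlock B {j | 2 ≤ j} 0 (matchGroup B B' h a) fun u =>
      ∀ b < B', u (2 + (h * B' + b)) = decide (a / 2 ^ b % 2 = 1) := by
  refine (OrBlock.not (c := fun u => ∃ b < B', u (2 + (h * B' + b)) =
    decide (1 - a / 2 ^ b % 2 = 1)) ?_ ?_).congr fun u => ?_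
  · exact OrBlock.flatMap fun b _ =>
      OrBlock.orInto (by simp) (show 2 + (h * B' + b) ≠ 1 by omega) (by omega)
  · intro u u' hu
    simp only [hu _ (Nat.le_add_right 2 _)]
  · simp only [not_exists, not_and]
    refine forall₂_congr fun b _ => ?_
    rcases Nat.mod_two_eq_zero_or_one (a / 2 ^ b) with h | h <;> simp [h]

theorem AllGood.matchGroup {S B B' h a : ℕ} (hS : 5 + B + (h + 1) * B' ≤ S) :
    AllGood S (matchGroup B B' h a) := by
  have : (h + 1) * B' = h * B' + B' := by ring
  exact append (cons (good_assertOr (by omega) (by omega) (by omega)) (flatMap fun b hb =>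
    orInto (by omega) (by omega))) (orInto (by omega) (by omega))

end BitProg

namespace RAM

namespace Gen

/-- Positions in an array are guessed for groups of `G` arrays at a time. -/
def mostOrthogonal (G : ℕ) : Gen :=
  pow 1 (.get 0 1) (.const G) <| .size (.reg 3) <| .size (.get 0 2) <|
  .seq (.emit [5 + .reg 7 + (.get 0 0 / .const G + 1) * .reg 5]) <|
  .seq (initCounter 8 (.reg 7) (.get 0 2 - .get 0 3)) <|
  .loop (.get 0 2) <| item 10 (.reg 7) <|
  .loop (.get 0 0) <| pow 12 (.get 0 1) (.reg 11 % .const G) <| .loop (.reg 3) <|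
  .guard (1 - .get 0 (4 + (.reg 11 * (.get 0 1 * .get 0 2) +
    (.reg 16 / .reg 14 % .get 0 1 * .get 0 2 + .reg 9)))) <|
  .seq (setFalse (.reg 7) 1) <|
  .seq (.loop (.reg 5) <| pow 19 2 (.reg 18) <|
    orInto (.reg 7) 1 (2 * (3 + .reg 7 + (2 + (.reg 11 / .const G * .reg 5 + .reg 18))) +
      (1 - .reg 16 / .reg 21 % 2))) <|
  orInto (.reg 7) 0 (2 * (3 + .reg 7 + 1) + 0)

theorem mostOrthogonal_ok (G : ℕ) : (mostOrthogonal G).ok 1 1 = true := by rfl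

theorem den_mostOrthogonal (G : ℕ) (s : State) {k n d t : ℕ} (hk : s.arr 0 0 = k)
    (hn : s.arr 0 1 = n) (hd : s.arr 0 2 = d) (ht : s.arr 0 3 = t) :
    (mostOrthogonal G).den 1 s = [5 + Nat.size d + (k / G + 1) * Nat.size (n ^ G)] ::
      BitProg.budget (Nat.size d) (d - t) d fun j => (List.range k).flatMap fun i =>
        (List.range (n ^ G)).flatMap fun a =>
          if 1 - s.arr 0 (4 + (i * (n * d) + (a / n ^ (i % G) % n * d + j))) ≠ 0 then
            BitProg.matchGroup (Nat.size d) (Nat.size (n ^ G)) (i / G) a else [] := by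
  simp [mostOrthogonal, den, den_initCounter (o := 1) (B := .reg 7) (T := .get 0 2 - .get 0 3) rfl,
    den_pow (o := 1) (e := .get 0 1) rfl, den_pow (o := 1) (e := 2) rfl,
    den_item, den_orInto, den_setFalse, State.setReg_reg, BitProg.budget, BitProg.matchGroup, hk,
    hn, hd, ht]

theorem bounded_mostOrthogonal {G Y : ℕ} {s : State} {k n d : ℕ} (hk : s.arr 0 0 = k)
    (hn : s.arr 0 1 = n) (hd : s.arr 0 2 = d) (hn0 : 0 < n) (hG0 : 0 < G) (hkY : k ≤ Y)
    (hdY : d ≤ Y) (hnY : n ^ G ≤ Y) (hG : G ≤ Y) : (mostOrthogonal G).Bounded Y 1 s := by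
  have hB : Nat.size d ≤ Y := (size_le_self _).trans hdY
  have hB' : Nat.size (n ^ G) ≤ Y := (size_le_self _).trans hnY
  have hpow : ∀ j ≤ G, Nat.size (n ^ j) ≤ Y := fun j hj =>
    (size_le_self _).trans ((Nat.pow_le_pow_right hn0 hj).trans hnY)
  refine bounded_pow (o := 1) rfl hG (by simpa [hn] using hpow) ⟨trivial, bounded_initCounter ?_,
    ⟨?_, fun j hj => bounded_item ?_ ⟨?_, fun i hi => bounded_pow (o := 1) rfl ?_ (fun b hb => ?_)
    ⟨?_, fun a ha _ => ⟨trivial, ⟨?_, fun b hb => bounded_two_pow ?_ ⟨trivial, trivial⟩⟩,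
    trivial, trivial⟩⟩⟩⟩⟩
  all_goals simp only [Expr.eval_get, Expr.eval_reg, Expr.eval_ofNat, Expr.eval_mod,
    Expr.eval_const, State.setReg_reg, State.setReg_arr, hk, hn, hd, Nat.reduceAdd,
    Nat.reduceEqDiff, if_true, if_false] at *
  all_goals first | omega | skip
  · exact (Nat.mod_lt _ hG0).le.trans hG
  · exact hpow b (hb.trans (Nat.mod_lt _ hG0).le)

end Gen

theorem _root_.Nat.eq_of_bits {B a b : ℕ} (ha : a < 2 ^ B) (hb : b < 2 ^ B)
    (h : ∀ i < B, decide (a / 2 ^ i % 2 = 1) = decide (b / 2 ^ i % 2 = 1)) : a = b := by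
  rw [← Nat.mod_eq_of_lt ha, ← Nat.mod_eq_of_lt hb, ← BitProg.sum_bits, ← BitProg.sum_bits]
  refine Finset.sum_congr rfl fun i hi => ?_
  have h := h i (Finset.mem_range.1 hi)
  rw [decide_eq_decide] at h
  congr 1
  rcases Nat.mod_two_eq_zero_or_one (a / 2 ^ i) with h₁ | h₁ <;>
    rcases Nat.mod_two_eq_zero_or_one (b / 2 ^ i) with h₂ | h₂ <;> simp_all

/-- Every function is the bit string of a number on each block of length `B`. -/
theorem exists_bits (B : ℕ) (u : ℕ → Bool) :
    ∃ a < 2 ^ B, ∀ b < B, u b = decide (a / 2 ^ b % 2 = 1) := by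
  refine ⟨finFunctionFinEquiv fun b : Fin B => (⟨(u b).toNat, Bool.toNat_lt _⟩ : Fin 2),
    Fin.is_lt _, fun b hb => ?_⟩
  have h := finFunctionFinEquiv_symm_apply_val
    (finFunctionFinEquiv fun b : Fin B => (⟨(u b).toNat, Bool.toNat_lt _⟩ : Fin 2)) ⟨b, hb⟩
  rw [Equiv.symm_apply_apply] at h
  rw [← h]
  cases u b <;> simp

open Classical in
-- The data are one number per group of `G` arrays, whose digits in base `n` are the selected
-- positions. Coordinate `j` is a zero of the product if, for some array `i`, the stored number of
-- its group equals an `a` below `n ^ G` whose digit for `i` points to a vector with a zero at `j`.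
-- At most `d - t` coordinates may fail this. The header cell with `k` is read at run time, so one
-- generator serves all `k`.
theorem generates_mostOrthogonal {G : ℕ} (hG : 0 < G) (I : Σ k, MOVInstance k) :
    Generates (Gen.mostOrthogonal G) I.2.encode I.2.Yes
      (5 + Nat.size I.2.d + (I.1 / G + 1) * Nat.size (I.2.n ^ G))
      ((I.1 + 5) * (I.2.d + 1) * (I.2.n ^ G + G)) := by
  obtain ⟨k, n, d, hn, hd, A, t, ht⟩ := I
  set I : MOVInstance k := ⟨n, d, hn, hd, A, t, ht⟩
  show Generates (Gen.mostOrthogonal G) I.encode I.Yes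
    (5 + Nat.size d + (k / G + 1) * Nat.size (n ^ G)) ((k + 5) * (d + 1) * (n ^ G + G))
  have hsd := size_le_self d
  have hsN := size_le_self (n ^ G)
  have hnN : n ≤ n ^ G := Nat.le_self_pow hG.ne' n
  set N := n ^ G with hN
  set B' := Nat.size N with hB'
  have hY₁ : 5 + d + (k + 1) * N ≤ (k + 5) * (d + 1) * (N + G) := by
    nlinarith [Nat.zero_le (k * d * N), Nat.zero_le (d * N), Nat.zero_le ((k + 5) * (d + 1) * G)]
  have hY₂ : 4 + k * (N * d) ≤ (k + 5) * (d + 1) * (N + G) := by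
    nlinarith [Nat.zero_le (k * d * N), Nat.zero_le (d * N), Nat.zero_le ((k + 5) * (d + 1) * G)]
  have hY₃ : k + G ≤ (k + 5) * (d + 1) * (N + G) := by
    nlinarith [Nat.zero_le (k * d * N), Nat.zero_le (k * d * G), Nat.zero_le (k * G),
      Nat.zero_le (k * N), Nat.zero_le (d * G), Nat.zero_le (d * N)]
  have hdiv : (k / G + 1) * B' ≤ (k + 1) * N :=
    Nat.mul_le_mul (Nat.succ_le_succ (Nat.div_le_self k G)) hsN
  have hknd : k * (n * d) ≤ k * (N * d) := by gcongr
  have hkN : N ≤ (k + 1) * N := Nat.le_mul_of_pos_left N (Nat.succ_pos k)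
  have hinner : ∀ i : Fin k, ((List.finRange n).flatMap fun a => (List.finRange d).map fun j =>
      (A i a j).toNat).length = n * d := fun i => length_flatMap_finRange fun a => by simp
  have hw : I.encode.length = 4 + k * (n * d) := by
    show (k :: n :: d :: t :: (List.finRange k).flatMap fun i => (List.finRange n).flatMap fun a =>
      (List.finRange d).map fun j => (A i a j).toNat).length = _
    simp only [List.length_cons, length_flatMap_finRange hinner]
    omega
  have h₀ : (init I.encode).arr 0 0 = k := rfl
  have h₁ : (init I.encode).arr 0 1 = n := rfl
  have h₂ : (init I.encode).arr 0 2 = d := rfl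
  have h₃ : (init I.encode).arr 0 3 = t := rfl
  have h₄ : ∀ i (hi : i < k) a (ha : a < n) j (hj : j < d),
      (init I.encode).arr 0 (4 + (i * (n * d) + (a * d + j))) =
        (A ⟨i, hi⟩ ⟨a, ha⟩ ⟨j, hj⟩).toNat := by
    intro i hi a ha j hj
    rw [init_arr_zero, MOVInstance.encode, add_comm, List.getD_cons_succ,
      List.getD_cons_succ, List.getD_cons_succ, List.getD_cons_succ,
      getD_flatMap_finRange _ hinner hi (show a * d + j < n * d by nlinarith),
      getD_flatMap_finRange _ (fun a => by simp) ha hj, getD_map_finRange _ _ hj]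
  have hgrp : ∀ i < k, (i / G + 1) * B' ≤ (k / G + 1) * B' := fun i hi =>
    Nat.mul_le_mul_right _ (Nat.succ_le_succ (Nat.div_le_div_right hi.le))
  refine ⟨by omega, by omega, (size_le_self _).trans (by omega), fun v hv => ?_,
    Gen.bounded_mostOrthogonal h₀ h₁ h₂ (by omega) hG (by omega) (by omega) (by omega) (by omega),
    _, by rw [Gen.den_mostOrthogonal G _ h₀ h₁ h₂ h₃], ?_, ?_⟩
  · refine (size_le_self _).trans ?_
    replace hv : v ∈ (k :: n :: d :: t :: _ : List ℕ) := hv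
    simp only [List.mem_cons, List.mem_flatMap, List.mem_map] at hv
    obtain rfl | rfl | rfl | rfl | ⟨i, -, a, -, j, -, rfl⟩ := hv
    · omega
    · omega
    · omega
    · omega
    · exact (Bool.toNat_le _).trans (by omega)
  · refine BitProg.AllGood.budget (by omega) fun j hj => BitProg.AllGood.flatMap fun i hi =>
      BitProg.AllGood.flatMap fun a ha => BitProg.AllGood.ite fun _ =>
      BitProg.AllGood.matchGroup (le_trans (Nat.add_le_add_left (hgrp i hi) _) le_rfl)
  · have hB : d - t < 2 ^ Nat.size d := (Nat.sub_le _ _).trans_lt (Nat.lt_size_self _)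
    have hNB : N < 2 ^ B' := Nat.lt_size_self _
    obtain ⟨c, hc⟩ : ∃ c : ℕ → (ℕ → Bool) → Prop, ∀ j u, c j u ↔ ∃ i < k, ∃ a < N,
        1 - (init I.encode).arr 0 (4 + (i * (n * d) + (a / n ^ (i % G) % n * d + j))) ≠ 0 ∧
        ∀ b < B', u (2 + (i / G * B' + b)) = decide (a / 2 ^ b % 2 = 1) := ⟨_, fun _ _ => Iff.rfl⟩
    rw [BitProg.run_budget (D := {j | 2 ≤ j}) (c := c) hB (by simp)]
    · have hmod : ∀ x, x % n < n := fun x => Nat.mod_lt x (by omega)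
      have hsel : ∀ i < k, ∀ a j (hj : j < d) (hi : i < k), (1 - (init I.encode).arr 0
          (4 + (i * (n * d) + (a / n ^ (i % G) % n * d + j))) ≠ 0 ↔
            A ⟨i, hi⟩ ⟨a / n ^ (i % G) % n, hmod _⟩ ⟨j, hj⟩ = false) := by
        intro i _ a j hj hi
        rw [h₄ i hi _ (hmod _) j hj]
        cases A ⟨i, hi⟩ ⟨a / n ^ (i % G) % n, hmod _⟩ ⟨j, hj⟩ <;> simp
      have hcount : ∀ q : ℕ → Prop, ((Finset.range d).filter fun j => ¬ q j).card ≤ d - t ↔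
          t ≤ (Finset.univ.filter fun j : Fin d => q j).card := by
        intro q
        have h := Finset.card_filter_add_card_filter_not (s := Finset.range d) q
        rw [Finset.card_filter, ← Fin.sum_univ_eq_sum_range fun j => if q j then 1 else 0,
          ← Finset.card_filter, Finset.card_range] at h
        omega
      simp only [hcount]
      constructor
      · rintro ⟨s, hs⟩
        let s' : ℕ → Fin n := fun i => if h : i < k then s ⟨i, h⟩ else ⟨0, by omega⟩
        -- The positions selected in the arrays of a group become the base `n` digits of one number.
        -- Places beyond the last array get the dummy position `0`.
        let a : ℕ → Fin (n ^ G) := fun h => finFunctionFinEquiv fun r : Fin G => s' (h * G + r)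
        have ha : ∀ i (hi : i < k), (⟨a (i / G) / n ^ (i % G) % n, hmod _⟩ : Fin n) =
            s ⟨i, hi⟩ := by
          intro i hi
          have h := finFunctionFinEquiv_symm_apply_val (a (i / G)) ⟨i % G, Nat.mod_lt _ hG⟩
          rw [Equiv.symm_apply_apply] at h
          refine Fin.ext (h.symm.trans ?_)
          simp [s', Nat.div_add_mod', hi]
        refine ⟨fun p => decide ((a ((p - 2) / B')).val / 2 ^ ((p - 2) % B') % 2 = 1),
          le_trans hs (Finset.card_le_card fun j hj => ?_)⟩
        obtain ⟨i, hi⟩ := (Finset.mem_filter.1 hj).2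
        refine Finset.mem_filter.2 ⟨Finset.mem_univ _, (hc _ _).2 ⟨i, i.2, a (i / G), (a _).2,
          (hsel i i.2 _ j j.2 i.2).2 ?_, fun b hb => ?_⟩⟩
        · rw [ha i i.2]
          exact hi
        · rw [Nat.add_sub_cancel_left, mul_comm, Nat.mul_add_div (by omega),
            Nat.div_eq_of_lt hb, add_zero, Nat.mul_add_mod, Nat.mod_eq_of_lt hb]
      -- A stored number may be `n ^ G` or more. Its digits modulo `n` still select vectors, and
      -- since it matches no `a` below `n ^ G`, the program can only undercount the zeroes of that
      -- selection.
      · rintro ⟨u, hu⟩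
        choose a ha hbits using fun h => exists_bits B' fun b => u (2 + (h * B' + b))
        refine ⟨fun i => ⟨a (i / G) / n ^ (i.val % G) % n, hmod _⟩,
          le_trans hu (Finset.card_le_card fun j hj => ?_)⟩
        obtain ⟨i, hi, a', ha', hA, hb⟩ := (hc _ _).1 (Finset.mem_filter.1 hj).2
        refine Finset.mem_filter.2 ⟨Finset.mem_univ _, ⟨i, hi⟩, ?_⟩
        obtain rfl : a' = a (i / G) := Nat.eq_of_bits (ha'.trans hNB) (ha _) fun b h => by
          rw [← hbits _ b h, hb b h]
        exact (hsel i hi _ j j.2 hi).1 hA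
    · intro j hj
      exact (BitProg.OrBlock.flatMap fun i _ => BitProg.OrBlock.flatMap fun a _ =>
        BitProg.OrBlock.ite fun _ => BitProg.orBlock_matchGroup _ _ _ _).congr
          fun u => (hc j u).symm

end RAM

/-! ### Running-time estimates and conclusions -/

open RAM

theorem RAM.Prog.Solves.mono {Inst : Type} {p : Prog} {encode : Inst → List ℕ} {yes : Inst → Prop}
    {T T' : Inst → ℝ} (h : p.Solves encode yes T) (hT : ∀ I, T I ≤ T' I) :
    p.Solves encode yes T' := fun I =>
  let ⟨s, c, hc, hle, hs⟩ := h I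
  ⟨s, c, hc, hle.trans (hT I), hs⟩

theorem exists_add_one_pow_le {r : ℝ} (hr : 1 < r) (c : ℕ) :
    ∃ K : ℕ, ∀ n : ℕ, ((n : ℝ) + 1) ^ c ≤ K * r ^ n := by
  obtain ⟨C, -, hC⟩ := Asymptotics.bound_of_isBigO_nat_atTop
    (isLittleO_pow_const_const_pow_of_one_lt (R := ℝ) c hr).isBigO
  -- The asymptotic bound is applied at `n + 1`, which costs the additional factor `r`.
  obtain ⟨K, hK⟩ := exists_nat_ge (C * r)
  refine ⟨K, fun n => ?_⟩
  have h := hC (x := n + 1) (by positivity)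
  rw [Real.norm_of_nonneg (by positivity), Real.norm_of_nonneg (by positivity)] at h
  push_cast at h
  calc ((n : ℝ) + 1) ^ c ≤ C * r * r ^ n := by rw [pow_succ] at h; linarith
    _ ≤ K * r ^ n := by gcongr

theorem two_pow_size_le {t : ℕ} (ht : 0 < t) : (2 : ℝ) ^ Nat.size t ≤ 2 * t := by
  have h₁ : Nat.size t ≠ 0 := by rw [Ne, Nat.size_eq_zero]; omega
  have h₂ : 2 ^ (Nat.size t - 1) ≤ t := Nat.lt_size.1 (by omega)
  obtain ⟨s, hs⟩ := Nat.exists_eq_succ_of_ne_zero h₁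
  rw [hs, Nat.succ_sub_one] at h₂
  rw [hs, pow_succ]
  have : (2 : ℝ) ^ s ≤ t := by exact_mod_cast h₂
  linarith

/-- A counter of logarithmic length contributes only a linear factor to the running time. -/
theorem pow_size_le {a : ℝ} (h₀ : 0 ≤ a) (h₂ : a ≤ 2) {t : ℕ} (ht : 0 < t) :
    a ^ Nat.size t ≤ 2 * t :=
  (pow_le_pow_left₀ h₀ h₂ _).trans (two_pow_size_le ht)

theorem pow_size_le_rpow {a : ℝ} (ha : 1 ≤ a) {t : ℕ} (ht : 0 < t) :
    a ^ Nat.size t ≤ (2 * t : ℝ) ^ Real.logb 2 a := by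
  have hlog : 0 ≤ Real.logb 2 a := Real.logb_nonneg (by norm_num) ha
  calc a ^ Nat.size t = ((2 : ℝ) ^ Real.logb 2 a) ^ Nat.size t := by
        rw [Real.rpow_logb (by norm_num) (by norm_num) (by linarith)]
    _ = ((2 : ℝ) ^ Nat.size t) ^ Real.logb 2 a := by
        rw [← Real.rpow_natCast, ← Real.rpow_natCast, ← Real.rpow_mul (by norm_num),
          ← Real.rpow_mul (by norm_num), mul_comm]
    _ ≤ _ := Real.rpow_le_rpow (by positivity) (two_pow_size_le ht) hlog

/-- Halving the saving absorbs polynomial factors, because the ratio `(2 - ε / 2) / (2 - ε)` exceeds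
`1`. -/
theorem exists_pow_mul_le {ε : ℝ} (hε₀ : 0 < ε) (hε₁ : ε < 1) (c : ℕ) :
    ∃ K : ℕ, ∀ n : ℕ, (2 - ε) ^ n * ((n : ℝ) + 1) ^ c ≤ K * (2 - ε / 2) ^ n := by
  have hr : 1 < (2 - ε / 2) / (2 - ε) := by rw [one_lt_div] <;> linarith
  obtain ⟨K, hK⟩ := exists_add_one_pow_le hr c
  refine ⟨K, fun n => ?_⟩
  calc (2 - ε) ^ n * ((n : ℝ) + 1) ^ c
      ≤ (2 - ε) ^ n * (K * ((2 - ε / 2) / (2 - ε)) ^ n) := by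
        gcongr
        · exact pow_nonneg (by linarith) _
        · exact hK n
    _ = K * (2 - ε / 2) ^ n := by
        rw [div_pow]
        have : (2 - ε) ^ n ≠ 0 := pow_ne_zero _ (by linarith)
        field_simp

/-- `PP-SETH` fails for the given `ε`. -/
def FastPathSAT (ε : ℝ) : Prop :=
  ∃ (p : Prog) (C c : ℕ), p.Solves PathSATInstance.encode PathSATInstance.Yes
    fun I => C * (2 - ε) ^ I.width * (I.encode.length : ℝ) ^ c

namespace FastPathSAT

variable {ε : ℝ}

/-- The time is `(2 - ε) ^ log t` up to polynomial factors. Factors polynomial in `log t` are not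
permitted by the target bound, so they are moved into the base `2 - ε / 2`, which is `2 ^ θ` with `θ
< 1`. -/
theorem fastSubsetSum (hε₀ : 0 < ε) (hε₁ : ε < 1) (h : FastPathSAT ε) : FastSubsetSum := by
  obtain ⟨p, C, c, hp⟩ := h
  obtain ⟨p', C', c', hp'⟩ := exists_solves_of_generates hε₁ hp Gen.subsetSum_ok _ _ _ _
    generates_subsetSum
  obtain ⟨K, hK⟩ := exists_pow_mul_le hε₀ hε₁ c'
  have hθ : Real.logb 2 (2 - ε / 2) < 1 := by
    rw [Real.logb_lt_iff_lt_rpow (by norm_num) (by linarith), Real.rpow_one]; linarith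
  have hθ₀ : 0 ≤ Real.logb 2 (2 - ε / 2) := Real.logb_nonneg (by norm_num) (by linarith)
  refine ⟨1 - Real.logb 2 (2 - ε / 2), by linarith, p', C' * 8 * 4 ^ c' * K * 2, c', hp'.mono
    fun I => ?_⟩
  rw [sub_sub_cancel]
  set θ := Real.logb 2 (2 - ε / 2)
  set B := Nat.size I.t with hB
  have hn := I.one_le_n
  have ht : 0 < I.t := (I.one_le_v ⟨0, hn⟩).trans (I.v_le _)
  have hY : ((I.n + B + 3 : ℕ) : ℝ) ≤ 4 * I.n * (B + 1) := by
    have : I.n + B + 3 ≤ 4 * I.n * (B + 1) := by nlinarith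
    exact_mod_cast this
  have h₁ : (2 - ε) ^ B * (B + 1 : ℝ) ^ c' ≤ K * (2 * (I.t : ℝ) ^ θ) := by
    calc (2 - ε) ^ B * (B + 1 : ℝ) ^ c' ≤ K * (2 - ε / 2) ^ B := hK B
      _ ≤ K * (2 * I.t : ℝ) ^ θ := by
          gcongr
          exact pow_size_le_rpow (by linarith) ht
      _ ≤ _ := by
          rw [Real.mul_rpow (by norm_num) (by positivity)]
          gcongr
          calc (2 : ℝ) ^ θ ≤ 2 ^ (1 : ℝ) := Real.rpow_le_rpow_of_exponent_le (by norm_num) hθ.le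
            _ = 2 := Real.rpow_one _
  have h₂ : (2 - ε) ^ 3 ≤ 8 := by
    calc (2 - ε) ^ 3 ≤ 2 ^ 3 := pow_le_pow_left₀ (by linarith) (by linarith) _
      _ = 8 := by norm_num
  have h₃ : (0 : ℝ) ≤ (2 - ε) ^ B := pow_nonneg (by linarith) _
  have h₄ : (0 : ℝ) ≤ (2 - ε) ^ 3 := pow_nonneg (by linarith) _
  calc (C' : ℝ) * (2 - ε) ^ (3 + B) * ((I.n + B + 3 : ℕ) : ℝ) ^ c'
      ≤ C' * (2 - ε) ^ (3 + B) * (4 * I.n * (B + 1)) ^ c' := by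
        gcongr; exact mul_nonneg (Nat.cast_nonneg _) (pow_nonneg (by linarith) _)
    _ = C' * (2 - ε) ^ 3 * 4 ^ c' * ((2 - ε) ^ B * (B + 1 : ℝ) ^ c') * (I.n : ℝ) ^ c' := by
      rw [pow_add, mul_pow, mul_pow]; ring
    _ ≤ C' * 8 * 4 ^ c' * (K * (2 * (I.t : ℝ) ^ θ)) * (I.n : ℝ) ^ c' := by gcongr
    _ = _ := by push_cast; ring

/-- The bound in the conjecture is polynomial in `m` but not in `n`. Hence polynomial factors in `n`
go into the base `2 - ε / 2`, and the counter contributes one more factor `m`. -/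
theorem not_scc (hε₀ : 0 < ε) (hε₁ : ε < 1) (h : FastPathSAT ε) : ¬ SCC := by
  intro hscc
  obtain ⟨p, C, c, hp⟩ := h
  obtain ⟨p', C', c', hp'⟩ := exists_solves_of_generates hε₁ hp Gen.setCover_ok _ _ _ _
    generates_setCover
  obtain ⟨K, hK⟩ := exists_pow_mul_le hε₀ hε₁ c'
  refine hscc (ε / 2) (by linarith) (by linarith) ⟨p', C' * 8 * 2 * 20 ^ c' * K, c' + 1, hp'.mono
    fun I => ?_⟩
  have hm := I.one_le_m
  have hY : (((I.n + 4) * (I.m + 4) : ℕ) : ℝ) ≤ 20 * (I.n + 1) * I.m := by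
    have : (I.n + 4) * (I.m + 4) ≤ 20 * (I.n + 1) * I.m := by nlinarith
    exact_mod_cast this
  have h₁ := hK I.n
  have h₂ : (2 - ε) ^ 3 ≤ 8 := by
    calc (2 - ε) ^ 3 ≤ 2 ^ 3 := pow_le_pow_left₀ (by linarith) (by linarith) _
      _ = 8 := by norm_num
  have h₃ : (2 - ε) ^ Nat.size I.m ≤ 2 * I.m := pow_size_le (by linarith) (by linarith) hm
  have h₄ : ∀ i, (0 : ℝ) ≤ (2 - ε) ^ i := fun i => pow_nonneg (by linarith) _
  have h₅ := h₄ I.n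
  have h₆ := h₄ 3
  have h₇ := h₄ (Nat.size I.m)
  calc (C' : ℝ) * (2 - ε) ^ (3 + Nat.size I.m + I.n) * (((I.n + 4) * (I.m + 4) : ℕ) : ℝ) ^ c'
      ≤ C' * (2 - ε) ^ (3 + Nat.size I.m + I.n) * (20 * (I.n + 1) * I.m) ^ c' := by
        gcongr; exact mul_nonneg (Nat.cast_nonneg _) (h₄ _)
    _ = C' * (2 - ε) ^ 3 * (2 - ε) ^ Nat.size I.m * 20 ^ c' *
        ((2 - ε) ^ I.n * (I.n + 1 : ℝ) ^ c') * (I.m : ℝ) ^ c' := by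
      rw [pow_add, pow_add, mul_pow, mul_pow]; ring
    _ ≤ C' * 8 * (2 * I.m) * 20 ^ c' * (K * (2 - ε / 2) ^ I.n) * (I.m : ℝ) ^ c' := by gcongr
    _ = _ := by push_cast; ring

theorem exists_solves_maxSAT (hε₀ : 0 < ε) (hε₁ : ε < 1) (h : FastPathSAT ε) :
    ∃ (p : Prog) (C c : ℕ), p.Solves MaxSATInstance.encode MaxSATInstance.Yes
      fun I => C * (2 - ε / 2) ^ I.n * (I.encode.length : ℝ) ^ c := by
  obtain ⟨p, C, c, hp⟩ := h
  obtain ⟨p', C', c', hp'⟩ := exists_solves_of_generates hε₁ hp Gen.maxSAT_ok _ _ _ _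
    generates_maxSAT
  obtain ⟨K, hK⟩ := exists_pow_mul_le hε₀ hε₁ c'
  refine ⟨p', C' * 16 * 2 * 4 ^ c' * K, c' + 1, hp'.mono fun I => ?_⟩
  set L := I.encode.length
  have hL : I.φ.length + 3 ≤ L := I.length_add_le
  have hY : ((2 * I.n + L + 4 : ℕ) : ℝ) ≤ 4 * (I.n + 1) * L := by
    have : 2 * I.n + L + 4 ≤ 4 * (I.n + 1) * L := by nlinarith
    exact_mod_cast this
  have h₁ := hK I.n
  have h₂ : (2 - ε) ^ 4 ≤ 16 := by
    calc (2 - ε) ^ 4 ≤ 2 ^ 4 := pow_le_pow_left₀ (by linarith) (by linarith) _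
      _ = 16 := by norm_num
  have h₄ : ∀ i, (0 : ℝ) ≤ (2 - ε) ^ i := fun i => pow_nonneg (by linarith) _
  have h₃ : (2 - ε) ^ Nat.size I.φ.length ≤ 2 * L := by
    calc (2 - ε) ^ Nat.size I.φ.length ≤ (2 - ε) ^ Nat.size L :=
          pow_le_pow_right₀ (by linarith) (Nat.size_le_size (by omega))
      _ ≤ 2 * L := pow_size_le (by linarith) (by linarith) (by omega)
  have h₅ := h₄ I.n
  have h₆ := h₄ 4
  have h₇ := h₄ (Nat.size I.φ.length)
  calc (C' : ℝ) * (2 - ε) ^ (4 + Nat.size I.φ.length + I.n) *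
        ((2 * I.n + L + 4 : ℕ) : ℝ) ^ c'
      ≤ C' * (2 - ε) ^ (4 + Nat.size I.φ.length + I.n) * (4 * (I.n + 1) * L) ^ c' := by
        gcongr; exact mul_nonneg (Nat.cast_nonneg _) (h₄ _)
    _ = C' * (2 - ε) ^ 4 * (2 - ε) ^ Nat.size I.φ.length * 4 ^ c' *
        ((2 - ε) ^ I.n * (I.n + 1 : ℝ) ^ c') * (L : ℝ) ^ c' := by
      rw [pow_add, pow_add, mul_pow, mul_pow]; ring
    _ ≤ C' * 16 * (2 * L) * 4 ^ c' * (K * (2 - ε / 2) ^ I.n) * (L : ℝ) ^ c' := by gcongr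
    _ = _ := by push_cast; ring

theorem not_maxSETHUnboundedArity (hε₀ : 0 < ε) (hε₁ : ε < 1) (h : FastPathSAT ε) :
    ¬ MaxSETHUnboundedArity := fun hseth =>
  hseth (ε / 2) (by linarith) (by linarith) (h.exists_solves_maxSAT hε₀ hε₁)

theorem not_maxSETH (hε₀ : 0 < ε) (hε₁ : ε < 1) (h : FastPathSAT ε) : ¬ MaxSETH := by
  intro hseth
  obtain ⟨q, hq⟩ := hseth (ε / 2) (by linarith) (by linarith)
  obtain ⟨p, C, c, hp⟩ := h.exists_solves_maxSAT hε₀ hε₁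
  -- The algorithm does not depend on the arity, so it refutes every `q` at once.
  exact hq ⟨p, C, c, fun I => hp I.1⟩

/-- With `2 - ε = 2 ^ θ`, the groups cost about `n ^ (θ * k * (1 + 1 / G))`. All other factors that
grow with `n` or `k` are made at most `n ^ (δ * k)` each, or go into the constants. -/
theorem fastMostOrthogonalVectors (hε₀ : 0 < ε) (hε₁ : ε < 1) (h : FastPathSAT ε) :
    FastMostOrthogonalVectors := by
  obtain ⟨p, C, c, hp⟩ := h
  set θ := Real.logb 2 (2 - ε) with hθdef
  have hθ : θ < 1 := by
    rw [Real.logb_lt_iff_lt_rpow (by norm_num) (by linarith), Real.rpow_one]; linarith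
  have hθ₀ : 0 ≤ θ := Real.logb_nonneg (by norm_num) (by linarith)
  -- The gap `1 - θ` is split into four parts: rounding within groups, the polynomial in `k`, the
  -- terms independent of `k`, and the saving that remains.
  obtain ⟨δ, hδ⟩ : ∃ δ, δ = (1 - θ) / 4 := ⟨_, rfl⟩
  have hδ₀ : 0 < δ := by linarith
  obtain ⟨G, hG⟩ := exists_nat_ge (1 / δ)
  have hG₀ : 0 < G := by
    have : (0 : ℝ) < G := lt_of_lt_of_le (by positivity) hG
    exact_mod_cast this
  have hGδ : 1 / (G : ℝ) ≤ δ := by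
    rw [div_le_iff₀ (by positivity)] at hG ⊢
    linarith
  obtain ⟨p', C', c', hp'⟩ := exists_solves_of_generates hε₁ hp (Gen.mostOrthogonal_ok G) _ _ _ _
    (generates_mostOrthogonal hG₀)
  obtain ⟨K, hK⟩ := exists_add_one_pow_le (Real.one_lt_rpow (by norm_num : (1 : ℝ) < 2) hδ₀) c'
  -- From here on `δ * k` exceeds `G + 1`, for the possibly incomplete last group, plus `G * c'`,
  -- for the factor `n ^ G` in the resource bound.
  obtain ⟨k₀, hk₀⟩ := exists_nat_ge (((G + 1) + G * c' : ℝ) / δ)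
  refine ⟨k₀ + 2, δ, by omega, hδ₀, p', C' * 32 * 2 * 10 ^ c' * (G + 1) ^ c' * K, c' + 1,
    fun k hk => ?_⟩
  have hp'' : p'.Solves (MOVInstance.encode (k := k)) MOVInstance.Yes _ := fun I => hp' ⟨k, I⟩
  refine hp''.mono fun I => ?_
  beta_reduce
  have hn := I.two_le_n
  have hd := I.one_le_d
  set n := I.n
  set d := I.d
  have hn₀ : (0 : ℝ) < n := by exact_mod_cast (show 0 < n by omega)
  have hn₁ : (1 : ℝ) ≤ n := by exact_mod_cast (show 1 ≤ n by omega)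
  have hn₂ : (2 : ℝ) ≤ n := by exact_mod_cast hn
  have hN₀ : 0 < n ^ G := by positivity
  have h₄ : ∀ i, (0 : ℝ) ≤ (2 - ε) ^ i := fun i => pow_nonneg (by linarith) _
  have hY : (((k + 5) * (d + 1) * (n ^ G + G) : ℕ) : ℝ) ≤
      10 * (k + 1) * d * ((G + 1) * (n : ℝ) ^ (G : ℝ)) := by
    have h₁ : k + 5 ≤ 5 * (k + 1) := by omega
    have h₂ : d + 1 ≤ 2 * d := by omega
    have h₃ : n ^ G + G ≤ (G + 1) * n ^ G := by nlinarith
    have : (k + 5) * (d + 1) * (n ^ G + G) ≤ 10 * (k + 1) * d * ((G + 1) * n ^ G) :=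
      (Nat.mul_le_mul (Nat.mul_le_mul h₁ h₂) h₃).trans (le_of_eq (by ring))
    rw [Real.rpow_natCast]
    exact_mod_cast this
  -- A polynomial in `k` is at most a constant times `2 ^ (δ * k)`, and `2 ≤ n`. This keeps the
  -- constants independent of `k`.
  have hk' : ((k : ℝ) + 1) ^ c' ≤ K * (n : ℝ) ^ (δ * k) := by
    refine (hK k).trans ?_
    rw [← Real.rpow_natCast, ← Real.rpow_mul (by norm_num)]
    gcongr
  have hY' : (((k + 5) * (d + 1) * (n ^ G + G) : ℕ) : ℝ) ^ c' ≤
      10 ^ c' * (K * (n : ℝ) ^ (δ * k)) * (d : ℝ) ^ c' * ((G + 1) ^ c' * (n : ℝ) ^ ((G : ℝ) * c')) := by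
    calc (((k + 5) * (d + 1) * (n ^ G + G) : ℕ) : ℝ) ^ c'
        ≤ (10 * (k + 1) * d * ((G + 1) * (n : ℝ) ^ (G : ℝ))) ^ c' := by gcongr
      _ = 10 ^ c' * ((k : ℝ) + 1) ^ c' * (d : ℝ) ^ c' *
          ((G + 1) ^ c' * (n : ℝ) ^ ((G : ℝ) * c')) := by
        rw [mul_pow, mul_pow, mul_pow, mul_pow, Real.rpow_mul_natCast hn₀.le]
      _ ≤ _ := by gcongr
  have hN : (2 - ε) ^ ((k / G + 1) * Nat.size (n ^ G)) ≤
      (n : ℝ) ^ (((G : ℝ) + 1) * θ * (k / G + 1)) := by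
    rw [mul_comm, pow_mul]
    -- The rounding factor satisfies `2 ≤ n`, so it costs one more factor `n` per group rather than
    -- one per array.
    have h₁ : (2 - ε) ^ Nat.size (n ^ G) ≤ (n : ℝ) ^ (((G : ℝ) + 1) * θ) := by
      refine (pow_size_le_rpow (by linarith) hN₀).trans ?_
      rw [← hθdef, Real.rpow_mul hn₀.le]
      refine Real.rpow_le_rpow (by positivity) ?_ hθ₀
      rw [Real.rpow_add hn₀, Real.rpow_one, Real.rpow_natCast]
      push_cast
      nlinarith [pow_pos hn₀ G]
    calc ((2 - ε) ^ Nat.size (n ^ G)) ^ (k / G + 1)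
        ≤ ((n : ℝ) ^ (((G : ℝ) + 1) * θ)) ^ (k / G + 1) := pow_le_pow_left₀ (h₄ _) h₁ _
      _ = (n : ℝ) ^ (((G : ℝ) + 1) * θ * ((k / G : ℕ) + 1)) := by
        rw [← Real.rpow_natCast, ← Real.rpow_mul hn₀.le]
        push_cast
        rfl
      _ ≤ _ := by
        gcongr
        exact Nat.cast_div_le
  have hexp : ((G : ℝ) + 1) * θ * (k / G + 1) + δ * k + G * c' ≤ (1 - δ) * k := by
    have hG₁ : (0 : ℝ) < G := by exact_mod_cast hG₀
    have hk₁ : (k₀ : ℝ) ≤ k := by exact_mod_cast (show k₀ ≤ k by omega)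
    have h₁ : (G : ℝ) + 1 + G * c' ≤ δ * k := by
      rw [div_le_iff₀ hδ₀] at hk₀
      nlinarith
    have h₂ : ((G : ℝ) + 1) * θ * (k / G + 1) =
        θ * k + θ * k * (1 / G) + (G + 1) * θ := by
      field_simp
    have h₃ : θ * k * (1 / (G : ℝ)) ≤ k * δ := by
      calc θ * k * (1 / (G : ℝ)) ≤ 1 * k * δ := by gcongr
        _ = k * δ := by ring
    have h₅ : ((G : ℝ) + 1) * θ ≤ G + 1 := by nlinarith
    have h₆ : θ = 1 - 4 * δ := by linarith
    rw [h₂]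
    have h₇ : θ * k = k - 4 * (δ * k) := by rw [h₆]; ring
    linarith
  have h₂ : (2 - ε) ^ 5 ≤ 32 := by
    calc (2 - ε) ^ 5 ≤ 2 ^ 5 := pow_le_pow_left₀ (by linarith) (by linarith) _
      _ = 32 := by norm_num
  have h₃ : (2 - ε) ^ Nat.size d ≤ 2 * d := pow_size_le (by linarith) (by linarith) hd
  calc (C' : ℝ) * (2 - ε) ^ (5 + Nat.size d + (k / G + 1) * Nat.size (n ^ G)) *
        (((k + 5) * (d + 1) * (n ^ G + G) : ℕ) : ℝ) ^ c'
      = C' * ((2 - ε) ^ 5 * (2 - ε) ^ Nat.size d * (2 - ε) ^ ((k / G + 1) * Nat.size (n ^ G))) *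
        (((k + 5) * (d + 1) * (n ^ G + G) : ℕ) : ℝ) ^ c' := by
        rw [pow_add, pow_add]
    _ ≤ C' * (32 * (2 * d) * (n : ℝ) ^ (((G : ℝ) + 1) * θ * (k / G + 1))) *
        (10 ^ c' * (K * (n : ℝ) ^ (δ * k)) * (d : ℝ) ^ c' *
          ((G + 1) ^ c' * (n : ℝ) ^ ((G : ℝ) * c'))) := by
        have := h₄ 5
        have := h₄ (Nat.size d)
        have := h₄ ((k / G + 1) * Nat.size (n ^ G))
        gcongr
    _ = C' * 32 * 2 * 10 ^ c' * (G + 1) ^ c' * K *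
        (n : ℝ) ^ (((G : ℝ) + 1) * θ * (k / G + 1) + δ * k + G * c') * (d : ℝ) ^ (c' + 1) := by
        rw [Real.rpow_add hn₀, Real.rpow_add hn₀]; ring
    _ ≤ C' * 32 * 2 * 10 ^ c' * (G + 1) ^ c' * K * (n : ℝ) ^ ((1 - δ) * k) *
        (d : ℝ) ^ (c' + 1) := by gcongr
    _ = _ := by push_cast; rfl

end FastPathSAT

theorem FastMostOrthogonalVectors.not_maxKOVA (h : FastMostOrthogonalVectors) : ¬ MaxKOVA := by
  intro hova
  obtain ⟨k₀, ε, hk₀, hε, p, C, c, hp⟩ := h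
  -- The minimum with `1 / 2` is needed since `ε` is not known to be below `1`.
  refine hova (k₀ + 1) (by omega) (min ε (1 / 2)) (by positivity)
    ((min_le_right _ _).trans_lt (by norm_num)) ⟨p, C, c, (hp (k₀ + 1) (by omega)).mono fun I => ?_⟩
  have hn₁ : (1 : ℝ) ≤ I.n := by exact_mod_cast (show 1 ≤ I.n by have := I.two_le_n; omega)
  gcongr
  exact min_le_left _ _

theorem mainTheorem6 :
    ¬ PPSETH →
      (FastMostOrthogonalVectors ∧ ¬ MaxSETH ∧ ¬ MaxSETHUnboundedArity ∧ ¬ MaxKOVA) ∧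
      (FastSubsetSum ∧ ¬ SCC) := by
  intro h
  obtain ⟨ε, hε₀, hε₁, h⟩ : ∃ ε : ℝ, 0 < ε ∧ ε < 1 ∧ FastPathSAT ε := by
    by_contra hne
    exact h fun ε hε₀ hε₁ hp => hne ⟨ε, hε₀, hε₁, hp⟩
  have hmov := h.fastMostOrthogonalVectors hε₀ hε₁
  exact ⟨⟨hmov, h.not_maxSETH hε₀ hε₁, h.not_maxSETHUnboundedArity hε₀ hε₁, hmov.not_maxKOVA⟩,
    h.fastSubsetSum hε₀ hε₁, h.not_scc hε₀ hε₁⟩
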